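/- Let $n,p\ge 0$, let $(M^{2n},g,J)$ be a nearly Kähler manifold, i.e. an almost Hermitian manifold ($J^2=-1$, $g(JX,JY)=g(X,Y)$, everything smooth) with $(\nabla_XJ)X=0$ for all $X\in TM$, where $\nabla$ is the Levi-Civita connection, and let $f:M^{2n}\to\mathbb{Q}^{2n+p}_c$ be a smooth isometric immersion into a Riemannian manifold of constant sectional curvature $c$, with second fundamental form $\alpha$. Let $T(X,Y)=\bar\nabla_XY-\bar\nabla_YX-[X,Y]$ be the torsion of the intrinsic (canonical) Hermitian connection $\bar\nabla$, the unique connection preserving $g$ and $J$ such that $\nabla-\bar\nabla$ is a 1-form with values in the skew-symmetric endomorphisms of $TM$ anticommuting with $J$. Let $\eta$ be a smooth normal vector field along $f$. For $x\in M$ put $$\Delta_x=\{X\in T_xM:\ \alpha(X,Y)=\langle X,Y\rangle\,\eta_x\ \text{ for all }Y\in T_xM\},$$ $$\Delta'_x=\{X\in T_xM:\ \alpha(X,JY)+\alpha(JX,Y)=0\ \text{ for all }Y\in T_xM\},$$ $$\Delta''_x=\{X\in T_xM:\ \alpha(T(X,Y),Z)+\alpha(T(X,Z),Y)=0\ \text{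 for all }Y,Z\in T_xM\},$$ and $D_x=\Delta_x\cap\Delta'_x\cap\Delta''_x$, with orthogonal complement $D_x^\perp$ in $T_xM$. For $X\in D_x$ define $C_X:D_x^\perp\to D_x^\perp$ by $C_X(Z)=T(X,Z)^\perp$, the orthogonal projection of $T(X,Z)$ onto $D_x^\perp$. Then for every $x\in M$ and every $X\in D_x$ the tensor $C_X$ vanishes; that is, $T(X,Z)\in D_x$ for all $X\in D_x$ and $Z\in D_x^\perp$. -/

import Mathlib

open Bundle Manifold ContDiff VectorField

noncomputable section

namespace NearlyKahler

/-! ## The Levi-Civita connection -/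

section LeviCivita

variable {E : Type*} [NormedAddCommGroup E] [NormedSpace ℝ E]
  {M : Type*} [TopologicalSpace M] [ChartedSpace E M]

instance instFiniteDimensionalTangentSpace [FiniteDimensional ℝ E] (x : M) :
    FiniteDimensional ℝ (TangentSpace 𝓘(ℝ, E) x) :=
  inferInstanceAs (FiniteDimensional ℝ E)

variable [RiemannianBundle (fun x : M ↦ TangentSpace 𝓘(ℝ, E) x)]

/-- The right-hand side of the Koszul formula for `⟨∇_X Y, Z⟩`. -/
def koszul (X Y Z : Π x : M, TangentSpace 𝓘(ℝ, E) x) (x : M) : ℝ :=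
  (d% (fun y ↦ inner ℝ (Y y) (Z y)) x (X x) + d% (fun y ↦ inner ℝ (Z y) (X y)) x (Y x)
    - d% (fun y ↦ inner ℝ (X y) (Y y)) x (Z x)
    + inner ℝ (mlieBracket 𝓘(ℝ, E) X Y x) (Z x) - inner ℝ (mlieBracket 𝓘(ℝ, E) Y Z x) (X x)
    + inner ℝ (mlieBracket 𝓘(ℝ, E) Z X x) (Y x)) / 2

variable [IsManifold 𝓘(ℝ, E) ∞ M] [CompleteSpace E]
  [IsContMDiffRiemannianBundle 𝓘(ℝ, E) ∞ E (fun x : M ↦ TangentSpace 𝓘(ℝ, E) x)]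

variable {X X' Y Y' Z Z' : Π x : M, TangentSpace 𝓘(ℝ, E) x} {x : M} {g : M → ℝ}

theorem mdiff_inner (hX : MDiffAt (T% X) x) (hY : MDiffAt (T% Y) x) :
    MDiffAt (fun y ↦ inner ℝ (X y) (Y y)) x :=
  MDifferentiableAt.inner_bundle (IB := 𝓘(ℝ, E)) (F := E)
    (E := fun x : M ↦ TangentSpace 𝓘(ℝ, E) x) (b := id) (v := X) (w := Y) hX hY

theorem koszul_tensorial_left (hY : MDiffAt (T% Y) x) (hZ : MDiffAt (T% Z) x) :
    TensorialAt 𝓘(ℝ, E) E (koszul · Y Z x) x where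
  smul {f X} hf hX := by
    have h1 := mvfderiv_fun_mul hf (mdiff_inner hZ hX)
    have h2 := mvfderiv_fun_mul hf (mdiff_inner hX hY)
    simp [koszul, inner_smul_left, inner_smul_right, h1, h2, mlieBracket_smul_left hf hX,
      mlieBracket_smul_right hf hX, inner_add_left]
    simp only [real_inner_comm]
    ring
  add {X X'} hX hX' := by
    have h1 := mvfderiv_fun_add (mdiff_inner hZ hX) (mdiff_inner hZ hX')
    have h2 := mvfderiv_fun_add (mdiff_inner hX hY) (mdiff_inner hX' hY)
    simp [koszul, inner_add_left, inner_add_right, h1, h2, mlieBracket_add_left hX hX',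
      mlieBracket_add_right hX hX']
    ring

theorem koszul_tensorial_right (hX : MDiffAt (T% X) x) (hY : MDiffAt (T% Y) x) :
    TensorialAt 𝓘(ℝ, E) E (koszul X Y · x) x where
  smul {f Z} hf hZ := by
    have h1 := mvfderiv_fun_mul hf (mdiff_inner hY hZ)
    have h2 := mvfderiv_fun_mul hf (mdiff_inner hZ hX)
    simp [koszul, inner_smul_left, inner_smul_right, h1, h2, mlieBracket_smul_left hf hZ,
      mlieBracket_smul_right hf hZ, inner_add_left]
    simp only [real_inner_comm]
    ring
  add {Z Z'} hZ hZ' := by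
    have h1 := mvfderiv_fun_add (mdiff_inner hY hZ) (mdiff_inner hY hZ')
    have h2 := mvfderiv_fun_add (mdiff_inner hZ hX) (mdiff_inner hZ' hX)
    simp [koszul, inner_add_left, inner_add_right, h1, h2, mlieBracket_add_left hZ hZ',
      mlieBracket_add_right hZ hZ']
    ring

theorem koszul_add (hX : MDiffAt (T% X) x) (hY : MDiffAt (T% Y) x) (hY' : MDiffAt (T% Y') x)
    (hZ : MDiffAt (T% Z) x) : koszul X (Y + Y') Z x = koszul X Y Z x + koszul X Y' Z x := by
  have h1 := mvfderiv_fun_add (mdiff_inner hY hZ) (mdiff_inner hY' hZ)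
  have h2 := mvfderiv_fun_add (mdiff_inner hX hY) (mdiff_inner hX hY')
  simp [koszul, inner_add_left, inner_add_right, h1, h2, mlieBracket_add_left hY hY',
      mlieBracket_add_right hY hY']
  ring

theorem koszul_smul (hX : MDiffAt (T% X) x) (hY : MDiffAt (T% Y) x) (hg : MDiffAt g x)
    (hZ : MDiffAt (T% Z) x) : koszul X (g • Y) Z x =
      g x * koszul X Y Z x + d% g x (X x) * inner ℝ (Y x) (Z x) := by
  have h1 := mvfderiv_fun_mul hg (mdiff_inner hY hZ)
  have h2 := mvfderiv_fun_mul hg (mdiff_inner hX hY)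
  simp [koszul, inner_smul_left, inner_smul_right, h1, h2, mlieBracket_smul_left hg hY,
      mlieBracket_smul_right hg hY, inner_add_left]
  simp only [real_inner_comm]
  ring

variable [FiniteDimensional ℝ E]

open scoped Classical in
/-- The underlying operator of the Levi-Civita connection: for `Y` differentiable at `x`,
`leviCivitaFun Y x v` is the vector `∇_v Y` of `T_x M` determined by the Koszul formula, written in
an orthonormal basis of `T_x M`. (Where `Y` is not differentiable the value is `0`.) -/
def leviCivitaFun (Y : Π x : M, TangentSpace 𝓘(ℝ, E) x) (x : M) :
    TangentSpace 𝓘(ℝ, E) x →L[ℝ] TangentSpace 𝓘(ℝ, E) x :=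
  if hY : MDiffAt (T% Y) x then
    ∑ i, ((TensorialAt.mkHom₂ (I := 𝓘(ℝ, E)) (F := E) (F' := E) (koszul · Y · x) x
      (fun _ hZ ↦ koszul_tensorial_left hY hZ)
      (fun _ hX ↦ koszul_tensorial_right hX hY)).flip
        (stdOrthonormalBasis ℝ (TangentSpace 𝓘(ℝ, E) x) i)).smulRight
      (stdOrthonormalBasis ℝ (TangentSpace 𝓘(ℝ, E) x) i)
  else 0

theorem inner_leviCivitaFun (hX : MDiffAt (T% X) x) (hY : MDiffAt (T% Y) x)
    (hZ : MDiffAt (T% Z) x) :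
    inner ℝ (leviCivitaFun Y x (X x)) (Z x) = koszul X Y Z x := by
  rw [← TensorialAt.mkHom₂_apply (I := 𝓘(ℝ, E)) (F := E) (F' := E)
    (Φ := fun X Z ↦ koszul X Y Z x) (fun _ hZ ↦ koszul_tensorial_left hY hZ)
      (fun _ hX ↦ koszul_tensorial_right hX hY) hX hZ]
  set B := TensorialAt.mkHom₂ (I := 𝓘(ℝ, E)) (F := E) (F' := E)
    (fun X Z ↦ koszul X Y Z x) x (fun _ hZ ↦ koszul_tensorial_left hY hZ)
      (fun _ hX ↦ koszul_tensorial_right hX hY) with hB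
  set b := stdOrthonormalBasis ℝ (TangentSpace 𝓘(ℝ, E) x) with hb
  conv_rhs => rw [← b.sum_repr' (Z x)]
  simp only [leviCivitaFun, dif_pos hY, map_sum, map_smul]
  simp [sum_inner, inner_smul_left, ← hB, ← hb, mul_comm]

theorem mdiff_extend (v : TangentSpace 𝓘(ℝ, E) x) :
    MDiffAt (T% (FiberBundle.extend E v : Π y : M, TangentSpace 𝓘(ℝ, E) y)) x :=
  FiberBundle.mdifferentiableAt_extend ..

theorem eq_of_inner_eq {u v : TangentSpace 𝓘(ℝ, E) x}
    (h : ∀ Z : Π x : M, TangentSpace 𝓘(ℝ, E) x, MDiffAt (T% Z) x →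
      inner ℝ u (Z x) = inner ℝ v (Z x)) : u = v := by
  refine ext_inner_right ℝ fun w ↦ ?_
  have := h (FiberBundle.extend E w) (mdiff_extend _)
  simpa using this

theorem eq_of_forall_field {A B : TangentSpace 𝓘(ℝ, E) x →L[ℝ] TangentSpace 𝓘(ℝ, E) x}
    (h : ∀ X : Π x : M, TangentSpace 𝓘(ℝ, E) x, MDiffAt (T% X) x → A (X x) = B (X x)) :
    A = B := by
  ext w
  have := h (FiberBundle.extend E w) (mdiff_extend _)
  simpa using this

/-- The Levi-Civita connection `∇` of a Riemannian manifold; `leviCivita Y x v` is `∇_v Y`. That it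
is metric and torsion-free is `leviCivita_metric` and `leviCivita_torsion`. -/
def leviCivita : CovariantDerivative 𝓘(ℝ, E) E (TangentSpace 𝓘(ℝ, E) : M → Type _) where
  toFun := leviCivitaFun
  isCovariantDerivativeOnUniv :=
    { add := fun {Y Y' x} hY hY' _ ↦ by
        refine eq_of_forall_field fun X hX ↦ eq_of_inner_eq fun Z hZ ↦ ?_
        rw [inner_leviCivitaFun hX (by exact mdifferentiableAt_add_section hY hY') hZ]
        simp [inner_add_left, inner_leviCivitaFun hX hY hZ, inner_leviCivitaFun hX hY' hZ,
          koszul_add hX hY hY' hZ]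
      leibniz := fun {Y g x} hY hg _ ↦ by
        refine eq_of_forall_field fun X hX ↦ eq_of_inner_eq fun Z hZ ↦ ?_
        rw [inner_leviCivitaFun hX (hg.smul_section hY) hZ]
        simp [inner_add_left, inner_smul_left, inner_leviCivitaFun hX hY hZ,
          koszul_smul hX hY hg hZ] }

/-- The Levi-Civita connection is metric. -/
theorem leviCivita_metric (hY : MDiffAt (T% Y) x) (hZ : MDiffAt (T% Z) x)
    (v : TangentSpace 𝓘(ℝ, E) x) :
    d% (fun y ↦ inner ℝ (Y y) (Z y)) x v =
      inner ℝ (leviCivita Y x v) (Z x) + inner ℝ (Y x) (leviCivita Z x v) := by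
  obtain ⟨X, hX, rfl⟩ : ∃ X : Π x : M, TangentSpace 𝓘(ℝ, E) x, MDiffAt (T% X) x ∧ X x = v :=
    ⟨FiberBundle.extend E v, mdiff_extend _, by simp⟩
  rw [real_inner_comm (leviCivita Z x (X x))]
  change _ = inner ℝ (leviCivitaFun Y x (X x)) (Z x) + inner ℝ (leviCivitaFun Z x (X x)) (Y x)
  rw [inner_leviCivitaFun hX hY hZ, inner_leviCivitaFun hX hZ hY]
  simp only [koszul, mlieBracket_swap_apply (V := Z) (W := Y),
    mlieBracket_swap_apply (V := Z) (W := X), mlieBracket_swap_apply (V := Y) (W := X),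
    inner_neg_left, real_inner_comm]
  ring

/-- The Levi-Civita connection is torsion-free. -/
theorem leviCivita_torsion :
    (leviCivita : CovariantDerivative 𝓘(ℝ, E) E (TangentSpace 𝓘(ℝ, E) : M → Type _)).torsion
      = 0 := by
  refine (CovariantDerivative.torsion_eq_zero_iff _).2 fun {X Y x} hX hY ↦
    eq_of_inner_eq fun Z hZ ↦ ?_
  rw [inner_sub_left]
  change inner ℝ (leviCivitaFun Y x (X x)) (Z x) - inner ℝ (leviCivitaFun X x (Y x)) (Z x) = _
  rw [inner_leviCivitaFun hX hY hZ, inner_leviCivitaFun hY hX hZ]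
  simp only [koszul, mlieBracket_swap_apply (V := Z) (W := Y),
    mlieBracket_swap_apply (V := Z) (W := X), mlieBracket_swap_apply (V := Y) (W := X),
    inner_neg_left, real_inner_comm]
  ring

/-! ## Almost Hermitian and nearly Kähler manifolds -/

/-- `J` is a (smooth) almost complex structure compatible with the Riemannian metric, i.e.
`(M, g, J)` is an almost Hermitian manifold. -/
structure IsAlmostHermitian
    (J : Π x : M, TangentSpace 𝓘(ℝ, E) x →L[ℝ] TangentSpace 𝓘(ℝ, E) x) : Prop where
  smooth : ContMDiff 𝓘(ℝ, E) (𝓘(ℝ, E).prod 𝓘(ℝ, E →L[ℝ] E)) ∞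
    (fun x ↦ TotalSpace.mk' (E →L[ℝ] E)
      (E := fun x : M ↦ TangentSpace 𝓘(ℝ, E) x →L[ℝ] TangentSpace 𝓘(ℝ, E) x) x (J x))
  sq (x : M) (v : TangentSpace 𝓘(ℝ, E) x) : J x (J x v) = -v
  inner_map (x : M) (v w : TangentSpace 𝓘(ℝ, E) x) : inner ℝ (J x v) (J x w) = inner ℝ v w

variable {J : Π x : M, TangentSpace 𝓘(ℝ, E) x →L[ℝ] TangentSpace 𝓘(ℝ, E) x}

theorem IsAlmostHermitian.mdiff (hJ : IsAlmostHermitian J) (hY : MDiffAt (T% Y) x) :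
    MDiffAt (T% (fun y ↦ J y (Y y))) x :=
  MDifferentiableAt.clm_bundle_apply (F₁ := E) (F₂ := E)
    (E₁ := fun x : M ↦ TangentSpace 𝓘(ℝ, E) x) (E₂ := fun x : M ↦ TangentSpace 𝓘(ℝ, E) x)
    (hJ.smooth.mdifferentiableAt (by simp)) hY

theorem nablaJ_tensorial (hJ : IsAlmostHermitian J) (x : M) :
    TensorialAt 𝓘(ℝ, E) E (fun Y : Π x : M, TangentSpace 𝓘(ℝ, E) x ↦
      leviCivita (fun y ↦ J y (Y y)) x - J x ∘L leviCivita Y x) x where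
  smul {g Y} hg hY := by
    have h1 : (fun y ↦ J y ((g • Y) y)) = g • (fun y ↦ J y (Y y)) := by ext y; simp
    rw [h1, leviCivita.isCovariantDerivativeOnUniv.leibniz (hJ.mdiff hY) hg,
      leviCivita.isCovariantDerivativeOnUniv.leibniz hY hg]
    ext v
    simp
    module
  add {Y Y'} hY hY' := by
    have h1 : (fun y ↦ J y ((Y + Y') y)) = (fun y ↦ J y (Y y)) + (fun y ↦ J y (Y' y)) := by
      ext y; simp
    rw [h1, leviCivita.isCovariantDerivativeOnUniv.add (hJ.mdiff hY) (hJ.mdiff hY'),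
      leviCivita.isCovariantDerivativeOnUniv.add hY hY']
    ext v
    simp
    module

/-- The covariant derivative `∇J` of the almost complex structure, as a tensor:
`nablaJ hJ x w v` is `(∇_v J) w`. See `nablaJ_apply`. -/
def nablaJ (hJ : IsAlmostHermitian J) (x : M) :
    TangentSpace 𝓘(ℝ, E) x →L[ℝ] TangentSpace 𝓘(ℝ, E) x →L[ℝ] TangentSpace 𝓘(ℝ, E) x :=
  TensorialAt.mkHom _ x (nablaJ_tensorial hJ x)

/-- `(∇_v J) Y = ∇_v (J Y) - J (∇_v Y)`. -/
theorem nablaJ_apply (hJ : IsAlmostHermitian J) (hY : MDiffAt (T% Y) x)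
    (v : TangentSpace 𝓘(ℝ, E) x) :
    nablaJ hJ x (Y x) v = leviCivita (fun y ↦ J y (Y y)) x v - J x (leviCivita Y x v) := by
  rw [nablaJ, TensorialAt.mkHom_apply _ hY]
  rfl

/-- The almost Hermitian manifold `(M, g, J)` is nearly Kähler: `(∇_v J) v = 0` for all tangent
vectors `v`. -/
def IsNearlyKahler (hJ : IsAlmostHermitian J) : Prop :=
  ∀ (x : M) (v : TangentSpace 𝓘(ℝ, E) x), nablaJ hJ x v v = 0

/-! ## The intrinsic Hermitian connection -/

/-- `D` is an intrinsic (canonical) Hermitian connection of `(M, g, J)`: it is Hermitian, i.e.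
preserves `g` and `J`, and `∇ - D` is a 1-form with values in `u(M)^⊥`, the bundle of skew-symmetric
endomorphisms of `TM` anticommuting with `J`. -/
structure IsCanonicalConnection
    (J : Π x : M, TangentSpace 𝓘(ℝ, E) x →L[ℝ] TangentSpace 𝓘(ℝ, E) x)
    (D : CovariantDerivative 𝓘(ℝ, E) E (TangentSpace 𝓘(ℝ, E) : M → Type _)) : Prop where
  metric {Y Z : Π x : M, TangentSpace 𝓘(ℝ, E) x} {x : M} (hY : MDiffAt (T% Y) x)
    (hZ : MDiffAt (T% Z) x) (v : TangentSpace 𝓘(ℝ, E) x) :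
    d% (fun y ↦ inner ℝ (Y y) (Z y)) x v = inner ℝ (D Y x v) (Z x) + inner ℝ (Y x) (D Z x v)
  complex {Y : Π x : M, TangentSpace 𝓘(ℝ, E) x} {x : M} (hY : MDiffAt (T% Y) x)
    (v : TangentSpace 𝓘(ℝ, E) x) : D (fun y ↦ J y (Y y)) x v = J x (D Y x v)
  skew {Y Z : Π x : M, TangentSpace 𝓘(ℝ, E) x} {x : M} (hY : MDiffAt (T% Y) x)
    (hZ : MDiffAt (T% Z) x) (v : TangentSpace 𝓘(ℝ, E) x) :
    inner ℝ (leviCivita Y x v - D Y x v) (Z x) = -inner ℝ (Y x) (leviCivita Z x v - D Z x v)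
  anticomm {Y : Π x : M, TangentSpace 𝓘(ℝ, E) x} {x : M} (hY : MDiffAt (T% Y) x)
    (v : TangentSpace 𝓘(ℝ, E) x) :
    leviCivita (fun y ↦ J y (Y y)) x v - D (fun y ↦ J y (Y y)) x v =
      -J x (leviCivita Y x v - D Y x v)

/-- The intrinsic (canonical) Hermitian connection `∇̄ = ∇ - η` of an almost Hermitian manifold, where
`η_v = (1/2) J ∘ (∇_v J)`. It satisfies `IsCanonicalConnection` (`canonicalConnection_spec`), which
determines it uniquely (`IsCanonicalConnection.eq_of_mdiff`). -/
def canonicalConnection (hJ : IsAlmostHermitian J) :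
    CovariantDerivative 𝓘(ℝ, E) E (TangentSpace 𝓘(ℝ, E) : M → Type _) :=
  leviCivita.addOneForm fun x ↦
    (-(1 / 2 : ℝ)) • (ContinuousLinearMap.compL ℝ _ _ _ (J x)) ∘L nablaJ hJ x

theorem canonicalConnection_apply (hJ : IsAlmostHermitian J) (hY : MDiffAt (T% Y) x)
    (v : TangentSpace 𝓘(ℝ, E) x) :
    canonicalConnection hJ Y x v = (1 / 2 : ℝ) • (leviCivita Y x v
      - J x (leviCivita (fun y ↦ J y (Y y)) x v)) := by
  change leviCivita Y x v + (-(1 / 2 : ℝ)) • J x (nablaJ hJ x (Y x) v) = _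
  rw [nablaJ_apply hJ hY]
  simp [hJ.sq]
  module

theorem leviCivita_neg (hY : MDiffAt (T% Y) x) :
    leviCivita (fun y ↦ -Y y) x = -leviCivita Y x := by
  have := leviCivita.isCovariantDerivativeOnUniv.smul_const (-1 : ℝ) hY
  simp only [neg_smul, one_smul] at this
  exact this

/-- `canonicalConnection hJ` is a Hermitian connection with `∇ - ∇̄` valued in `u(M)^⊥`. -/
theorem canonicalConnection_spec (hJ : IsAlmostHermitian J) :
    IsCanonicalConnection J (canonicalConnection hJ) := by
  have skewJ (x : M) (v w : TangentSpace 𝓘(ℝ, E) x) :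
      inner ℝ (J x v) w = -inner ℝ v (J x w) := by
    rw [← hJ.inner_map x v, hJ.sq, inner_neg_right, neg_neg]
  have skew {Y Z : Π x : M, TangentSpace 𝓘(ℝ, E) x} {x : M} (hY : MDiffAt (T% Y) x)
      (hZ : MDiffAt (T% Z) x) (v : TangentSpace 𝓘(ℝ, E) x) :
      inner ℝ (leviCivita Y x v - canonicalConnection hJ Y x v) (Z x)
        = -inner ℝ (Y x) (leviCivita Z x v - canonicalConnection hJ Z x v) := by
    have h1 := leviCivita_metric hY hZ v
    have h2 := leviCivita_metric (hJ.mdiff hY) (hJ.mdiff hZ) v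
    simp only [hJ.inner_map] at h2
    simp only [canonicalConnection_apply hJ hY, canonicalConnection_apply hJ hZ,
      inner_sub_left, inner_sub_right, inner_smul_left, inner_smul_right, skewJ x _ (Z x)]
    have h3 := skewJ x (Y x) (leviCivita (fun y ↦ J y (Z y)) x v)
    simp
    linarith
  refine ⟨fun hY hZ v ↦ ?_, fun hY v ↦ ?_, skew, fun hY v ↦ ?_⟩
  · have h1 := leviCivita_metric hY hZ v
    have h2 := skew hY hZ v
    simp only [inner_sub_left, inner_sub_right] at h2
    linarith
  all_goals
    rw [canonicalConnection_apply hJ hY, canonicalConnection_apply hJ (hJ.mdiff hY)]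
    simp only [hJ.sq]
    rw [leviCivita_neg hY]
    simp [hJ.sq]
    try module

/-- Two connections satisfying `IsCanonicalConnection` agree on differentiable vector fields. -/
theorem IsCanonicalConnection.eq_of_mdiff (hJ : IsAlmostHermitian J)
    {D D' : CovariantDerivative 𝓘(ℝ, E) E (TangentSpace 𝓘(ℝ, E) : M → Type _)}
    (hD : IsCanonicalConnection J D) (hD' : IsCanonicalConnection J D')
    (hY : MDiffAt (T% Y) x) : D Y x = D' Y x := by
  ext v
  have h1 := hD.anticomm hY v
  have h2 := hD'.anticomm hY v
  rw [hD.complex hY, map_sub, sub_eq_iff_eq_add] at h1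
  rw [hD'.complex hY, map_sub, sub_eq_iff_eq_add] at h2
  have h3 := h1.symm.trans h2
  have h4 : (2 : ℝ) • J x (D Y x v) = (2 : ℝ) • J x (D' Y x v) := by
    have h5 := congrArg (fun u ↦ J x (leviCivita Y x v) + u) h3
    have h6 : ∀ a b : TangentSpace 𝓘(ℝ, E) x, a + (-(a - b) + b) = (2 : ℝ) • b := by
      intro a b; module
    simpa only [h6] using h5
  have := congrArg (J x) (smul_right_injective _ (two_ne_zero' ℝ) h4)
  simpa [hJ.sq] using this

/-- The torsion `T` of the intrinsic Hermitian connection, `T(X, Y) = ∇̄_X Y - ∇̄_Y X - [X, Y]`. -/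
def hermitianTorsion (hJ : IsAlmostHermitian J) (x : M) :
    TangentSpace 𝓘(ℝ, E) x →L[ℝ] TangentSpace 𝓘(ℝ, E) x →L[ℝ] TangentSpace 𝓘(ℝ, E) x :=
  (canonicalConnection hJ).torsion x

/-! ## Curvature -/

/-- The curvature `R(X, Y) Z = ∇_X ∇_Y Z - ∇_Y ∇_X Z - ∇_[X, Y] Z` of a Riemannian manifold. -/
def curvature (X Y Z : Π x : M, TangentSpace 𝓘(ℝ, E) x) (x : M) : TangentSpace 𝓘(ℝ, E) x :=
  leviCivita (fun y ↦ leviCivita Z y (Y y)) x (X x)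
    - leviCivita (fun y ↦ leviCivita Z y (X y)) x (Y x)
    - leviCivita Z x (mlieBracket 𝓘(ℝ, E) X Y x)

variable (E M) in
/-- `M` has constant sectional curvature `c`: `⟨R(X, Y) Y, X⟩ = c (|X|² |Y|² - ⟨X, Y⟩²)` at every
point `x`, for all vector fields `X`, `Y` which are smooth near `x`. -/
def HasConstantSectionalCurvature (c : ℝ) : Prop :=
  ∀ (x : M) (X Y : Π x : M, TangentSpace 𝓘(ℝ, E) x), (∃ U ∈ nhds x, CMDiff[U] ∞ (T% X)) →
    (∃ U ∈ nhds x, CMDiff[U] ∞ (T% Y)) →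
    inner ℝ (curvature X Y Y x) (X x) =
      c * (inner ℝ (X x) (X x) * inner ℝ (Y x) (Y x) - inner ℝ (X x) (Y x) ^ 2)

end LeviCivita

/-! ## Isometric immersions and the second fundamental form -/

section Immersion

variable {E : Type*} [NormedAddCommGroup E] [NormedSpace ℝ E]
  {M : Type*} [TopologicalSpace M] [ChartedSpace E M]
  {F : Type*} [NormedAddCommGroup F] [NormedSpace ℝ F]
  {Q : Type*} [TopologicalSpace Q] [ChartedSpace F Q] [IsManifold 𝓘(ℝ, F) ∞ Q]

/-- The covariant derivative along `f : M → Q` of a vector field `V` along `f`, induced by a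
connection `D` on `Q`: if `V = ∑ Vⁱ (eᵢ ∘ f)` in the local frame `eᵢ` of `TQ` given by the preferred
trivialization at `f x`, then `pullbackCov D f V x v = ∑ (dVⁱ(v) eᵢ + Vⁱ D_{df(v)} eᵢ)` at `x`. Here
`∑ Vⁱ(x) eᵢ` is the section `FiberBundle.extend F (V x)`. It satisfies the chain rule
`pullbackCov_comp`. -/
def pullbackCov (D : CovariantDerivative 𝓘(ℝ, F) F (TangentSpace 𝓘(ℝ, F) : Q → Type _))
    (f : M → Q) (V : Π x : M, TangentSpace 𝓘(ℝ, F) (f x)) (x : M) :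
    TangentSpace 𝓘(ℝ, E) x →L[ℝ] TangentSpace 𝓘(ℝ, F) (f x) :=
  letI e := trivializationAt F (TangentSpace 𝓘(ℝ, F) : Q → Type _) (f x)
  (e.symmL ℝ (f x)) ∘L (d% (fun y : M ↦ (e ⟨f y, V y⟩).2) x)
    + D (FiberBundle.extend F (V x)) (f x) ∘L mfderiv 𝓘(ℝ, E) 𝓘(ℝ, F) f x

/-- Chain rule: for the restriction `W ∘ f` of a vector field `W` on `Q`,
`(f^*D)_v (W ∘ f) = D_{df(v)} W`. -/
theorem pullbackCov_comp [FiniteDimensional ℝ F]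
    (D : CovariantDerivative 𝓘(ℝ, F) F (TangentSpace 𝓘(ℝ, F) : Q → Type _))
    {f : M → Q} {x : M} (hf : MDifferentiableAt 𝓘(ℝ, E) 𝓘(ℝ, F) f x)
    {W : Π y : Q, TangentSpace 𝓘(ℝ, F) y} (hW : MDiffAt (T% W) (f x)) :
    pullbackCov (E := E) D f (fun y ↦ W (f y)) x =
      D W (f x) ∘L mfderiv 𝓘(ℝ, E) 𝓘(ℝ, F) f x := by
  set e := trivializationAt F (TangentSpace 𝓘(ℝ, F) : Q → Type _) (f x) with he
  have hmem : f x ∈ e.baseSet := FiberBundle.mem_baseSet_trivializationAt' (f x)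
  have hco {W : Π y : Q, TangentSpace 𝓘(ℝ, F) y} (hW : MDiffAt (T% W) (f x)) :
      MDiffAt (fun z ↦ (e ⟨z, W z⟩).2) (f x) :=
    (mdifferentiableAt_section 𝓘(ℝ, F) W).1 hW
  -- the operator `D W - e⁻¹ dŴ` is tensorial
  have ht : TensorialAt 𝓘(ℝ, F) F (fun W : Π y : Q, TangentSpace 𝓘(ℝ, F) y ↦
      D W (f x) - (e.symmL ℝ (f x)) ∘L (d% (fun z ↦ (e ⟨z, W z⟩).2) (f x))) (f x) := by
    constructor
    · intro g W hg hW
      have h1 : (fun z ↦ (e ⟨z, (g • W) z⟩).2) =ᶠ[nhds (f x)]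
          (g • fun z ↦ (e ⟨z, W z⟩).2) := by
        filter_upwards [e.open_baseSet.mem_nhds hmem] with z hz
        simpa using ((e.linear ℝ hz).map_smul (g z) (W z))
      have h2 : d% (fun z ↦ (e ⟨z, (g • W) z⟩).2) (f x)
          = d% (g • fun z ↦ (e ⟨z, W z⟩).2) (f x) := by
        ext v
        exact congrArg (fun L : F →L[ℝ] F ↦ L v) h1.mfderiv_eq
      rw [h2, mvfderiv_smul hg (hco hW), D.isCovariantDerivativeOnUniv.leibniz hW hg]
      ext v
      have h3 : e.symmL ℝ (f x) (e ⟨f x, W (f x)⟩).2 = W (f x) := by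
        rw [e.symmL_apply hmem]
        exact e.symm_apply_apply_mk hmem _
      simp [h3]
      module
    · intro W W' hW hW'
      have h1 : (fun z ↦ (e ⟨z, (W + W') z⟩).2) =ᶠ[nhds (f x)]
          ((fun z ↦ (e ⟨z, W z⟩).2) + fun z ↦ (e ⟨z, W' z⟩).2) := by
        filter_upwards [e.open_baseSet.mem_nhds hmem] with z hz
        simpa using ((e.linear ℝ hz).map_add (W z) (W' z))
      have h2 : d% (fun z ↦ (e ⟨z, (W + W') z⟩).2) (f x)
          = d% ((fun z ↦ (e ⟨z, W z⟩).2) + fun z ↦ (e ⟨z, W' z⟩).2) (f x) := by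
        ext v
        exact congrArg (fun L : F →L[ℝ] F ↦ L v) h1.mfderiv_eq
      rw [h2, mvfderiv_add (hco hW) (hco hW'), D.isCovariantDerivativeOnUniv.add hW hW']
      ext v
      simp
      module
  have hx := ht.pointwise hW (FiberBundle.mdifferentiableAt_extend 𝓘(ℝ, F) F (W (f x)))
    (by simp)
  have h4 : (fun z ↦ (e ⟨z, (FiberBundle.extend F (W (f x)) :
      Π y : Q, TangentSpace 𝓘(ℝ, F) y) z⟩).2) =ᶠ[nhds (f x)] fun _ ↦ (e ⟨f x, W (f x)⟩).2 := by
    filter_upwards [e.open_baseSet.mem_nhds hmem] with z hz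
    simp [FiberBundle.extend, ← he, hz]
  have h5 : d% (fun z ↦ (e ⟨z, (FiberBundle.extend F (W (f x)) :
      Π y : Q, TangentSpace 𝓘(ℝ, F) y) z⟩).2) (f x) = 0 := by
    refine Eq.trans ?_ (mvfderiv_const (I := 𝓘(ℝ, F)) (e ⟨f x, W (f x)⟩).2 (x := f x))
    ext v
    exact congrArg (fun L : F →L[ℝ] F ↦ L v)
      (h4.mfderiv_eq (I := 𝓘(ℝ, F)) (I' := 𝓘(ℝ, F)))
  rw [h5] at hx
  have h6 : d% (fun y : M ↦ (e ⟨f y, W (f y)⟩).2) x =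
      d% (fun z ↦ (e ⟨z, W z⟩).2) (f x) ∘L mfderiv 𝓘(ℝ, E) 𝓘(ℝ, F) f x :=
    mfderiv_comp x (hco hW) hf
  rw [sub_eq_iff_eq_add] at hx
  rw [hx]
  simp only [pullbackCov, ← he]
  rw [h6]
  ext v
  simp [add_comm]

variable (E F) in
/-- The image `df(T_x M)` of the tangent space, a subspace of `T_{f x} Q`. -/
def tangentImage (f : M → Q) (x : M) : Submodule ℝ (TangentSpace 𝓘(ℝ, F) (f x)) :=
  LinearMap.range (mfderiv 𝓘(ℝ, E) 𝓘(ℝ, F) f x).toLinearMap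

variable [RiemannianBundle (fun x : M ↦ TangentSpace 𝓘(ℝ, E) x)]
  [RiemannianBundle (fun y : Q ↦ TangentSpace 𝓘(ℝ, F) y)]

variable (E F) in
/-- `f : M → Q` is a smooth isometric immersion of Riemannian manifolds. -/
structure IsIsometricImmersion (f : M → Q) : Prop where
  smooth : ContMDiff 𝓘(ℝ, E) 𝓘(ℝ, F) ∞ f
  isometric (x : M) (v w : TangentSpace 𝓘(ℝ, E) x) :
    inner ℝ (mfderiv 𝓘(ℝ, E) 𝓘(ℝ, F) f x v) (mfderiv 𝓘(ℝ, E) 𝓘(ℝ, F) f x w) = inner ℝ v w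

variable (E F) in
/-- The normal space of `f` at `x`, the orthogonal complement of `df(T_x M)` in `T_{f x} Q`. -/
def normalSpace (f : M → Q) (x : M) : Submodule ℝ (TangentSpace 𝓘(ℝ, F) (f x)) :=
  Submodule.orthogonal (tangentImage E F f x)

variable (E F) in
/-- `η` is a smooth normal vector field along `f`, i.e. a smooth section of the normal bundle. -/
structure IsSmoothNormalField (f : M → Q) (η : Π x : M, TangentSpace 𝓘(ℝ, F) (f x)) : Prop where
  smooth : ContMDiff 𝓘(ℝ, E) 𝓘(ℝ, F).tangent ∞ (fun x ↦ (⟨f x, η x⟩ : TangentBundle 𝓘(ℝ, F) Q))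
  normal (x : M) : η x ∈ normalSpace E F f x

variable [IsManifold 𝓘(ℝ, E) ∞ M] [FiniteDimensional ℝ F] [CompleteSpace F]
  [IsContMDiffRiemannianBundle 𝓘(ℝ, F) ∞ F (fun y : Q ↦ TangentSpace 𝓘(ℝ, F) y)]

/-- The second fundamental form `α(v, w)` of `f` at `x`: the normal component of the ambient
Levi-Civita derivative along `v` of `df(W)`, for a local vector field `W` on `M` with `W x = w`. -/
def secondFundamentalForm (f : M → Q) (x : M) (v w : TangentSpace 𝓘(ℝ, E) x) :
    TangentSpace 𝓘(ℝ, F) (f x) :=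
  (normalSpace E F f x).starProjection
    (pullbackCov leviCivita f
      (fun y ↦ mfderiv 𝓘(ℝ, E) 𝓘(ℝ, F) f y (FiberBundle.extend E w y)) x v)

theorem secondFundamentalForm_add_left (f : M → Q) (x : M) (v v' w : TangentSpace 𝓘(ℝ, E) x) :
    secondFundamentalForm (F := F) f x (v + v') w =
      secondFundamentalForm (F := F) f x v w + secondFundamentalForm (F := F) f x v' w := by
  simp [secondFundamentalForm]

theorem secondFundamentalForm_smul_left (f : M → Q) (x : M) (a : ℝ)
    (v w : TangentSpace 𝓘(ℝ, E) x) :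
    secondFundamentalForm (F := F) f x (a • v) w =
      a • secondFundamentalForm (F := F) f x v w := by
  simp [secondFundamentalForm]

/-! ## The distributions -/

/-- The totally umbilic distribution `Δ` associated to `η`:
`Δ_x = {X | α(X, Y) = ⟨X, Y⟩ η for all Y}`. -/
def umbilicDistribution (f : M → Q) (η : Π x : M, TangentSpace 𝓘(ℝ, F) (f x)) (x : M) :
    Submodule ℝ (TangentSpace 𝓘(ℝ, E) x) where
  carrier := {X | ∀ Y, secondFundamentalForm f x X Y = inner ℝ X Y • η x}
  add_mem' {X X'} hX hX' Y := by
    rw [secondFundamentalForm_add_left, hX, hX', inner_add_left, add_smul]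
  zero_mem' Y := by
    have := secondFundamentalForm_smul_left (F := F) f x 0 0 Y
    simpa using this
  smul_mem' a X hX Y := by
    rw [secondFundamentalForm_smul_left, hX, inner_smul_left, smul_smul]
    simp

/-- `Δ'_x = {X | α(X, J Y) + α(J X, Y) = 0 for all Y}`. -/
def umbilicDistribution' (f : M → Q)
    (J : Π x : M, TangentSpace 𝓘(ℝ, E) x →L[ℝ] TangentSpace 𝓘(ℝ, E) x) (x : M) :
    Submodule ℝ (TangentSpace 𝓘(ℝ, E) x) where
  carrier := {X | ∀ Y, secondFundamentalForm (F := F) f x X (J x Y)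
    + secondFundamentalForm f x (J x X) Y = 0}
  add_mem' {X X'} hX hX' Y := by
    rw [map_add, secondFundamentalForm_add_left, secondFundamentalForm_add_left,
      add_add_add_comm, hX, hX', add_zero]
  zero_mem' Y := by
    have h1 := secondFundamentalForm_smul_left (F := F) f x 0 0 (J x Y)
    have h2 := secondFundamentalForm_smul_left (F := F) f x 0 0 Y
    simp only [zero_smul] at h1 h2
    rw [map_zero, h1, h2, add_zero]
  smul_mem' a X hX Y := by
    rw [map_smul, secondFundamentalForm_smul_left, secondFundamentalForm_smul_left, ← smul_add,
      hX, smul_zero]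

variable [CompleteSpace E] [FiniteDimensional ℝ E]
  [IsContMDiffRiemannianBundle 𝓘(ℝ, E) ∞ E (fun x : M ↦ TangentSpace 𝓘(ℝ, E) x)]
  {J : Π x : M, TangentSpace 𝓘(ℝ, E) x →L[ℝ] TangentSpace 𝓘(ℝ, E) x}

/-- `Δ''_x = {X | α(T(X, Y), Z) + α(T(X, Z), Y) = 0 for all Y, Z}`. -/
def umbilicDistribution'' (f : M → Q) (hJ : IsAlmostHermitian J) (x : M) :
    Submodule ℝ (TangentSpace 𝓘(ℝ, E) x) where
  carrier := {X | ∀ Y Z, secondFundamentalForm (F := F) f x (hermitianTorsion hJ x X Y) Z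
    + secondFundamentalForm f x (hermitianTorsion hJ x X Z) Y = 0}
  add_mem' {X X'} hX hX' Y Z := by
    rw [map_add, add_apply, add_apply,
      secondFundamentalForm_add_left, secondFundamentalForm_add_left,
      add_add_add_comm, hX, hX', add_zero]
  zero_mem' Y Z := by
    have h1 := secondFundamentalForm_smul_left (F := F) f x 0 0 Z
    have h2 := secondFundamentalForm_smul_left (F := F) f x 0 0 Y
    simp only [zero_smul] at h1 h2
    rw [map_zero, zero_apply, zero_apply, h1, h2, add_zero]
  smul_mem' a X hX Y Z := by
    rw [map_smul, smul_apply, smul_apply,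
      secondFundamentalForm_smul_left, secondFundamentalForm_smul_left, ← smul_add, hX, smul_zero]

/-- The complex and invariant totally umbilic distribution `D_x = Δ_x ∩ Δ'_x ∩ Δ''_x`. -/
def invariantDistribution (f : M → Q) (hJ : IsAlmostHermitian J)
    (η : Π x : M, TangentSpace 𝓘(ℝ, F) (f x)) (x : M) :
    Submodule ℝ (TangentSpace 𝓘(ℝ, E) x) :=
  umbilicDistribution f η x ⊓ umbilicDistribution' (F := F) f J x
    ⊓ umbilicDistribution'' (F := F) f hJ x

/-- The tensor `C_X : D_x^⊥ → D_x^⊥`, `C_X(Z) = T(X, Z)^⊥`, where `^⊥` on the right-hand side is the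
orthogonal projection of `T_x M` onto `D_x^⊥`. -/
def tensorC (f : M → Q) (hJ : IsAlmostHermitian J)
    (η : Π x : M, TangentSpace 𝓘(ℝ, F) (f x)) (x : M) (X : TangentSpace 𝓘(ℝ, E) x) :
    Submodule.orthogonal (invariantDistribution f hJ η x) →L[ℝ]
      Submodule.orthogonal (invariantDistribution f hJ η x) :=
  (Submodule.orthogonal (invariantDistribution f hJ η x)).orthogonalProjectionOnto ∘L
    hermitianTorsion hJ x X ∘L
    (Submodule.orthogonal (invariantDistribution f hJ η x)).subtypeL

end Immersion

end NearlyKahler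

end

/-! The statement is algebra in one tangent space once the curvature of `M` is understood. Write T_X
= T(X, ·), let R be the Riemannian curvature and R̄(u, v) = R(u, v) - ¼[T_u, T_v] + ½ T_{T(u, v)}.
On a nearly Kähler manifold T is totally skew, anticommutes with J and is parallel for ∇̄
(Kirichenko; `IsLocalNearlyKahler.nablaT_eq_zero`). Hence R̄ is the curvature of ∇̄, and since a
parallel tensor is annihilated by the curvature (`curvatureEnd_of_parallel`), R̄(u, v) commutes with
J and is a derivation of T. The first property gives Gray's identity ⟨R(u,v)w, z⟩ - ⟨R(u,v)Jw, Jz⟩ =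
-⟨T(u,v), T(w,z)⟩. These facts and the Gauss equation make up `PointwiseImmersion`.

Let X lie in D_x and put κ = c + |η|². Both X and JX are umbilic, so the Gauss equation determines
R(X, JX), and the derivation property of R̄(X, JX) gives T_X³ = -κ|X|² T_X (`T_cube`). If κ|X|² = 0,
skewness of T_X forces T_X = 0. Otherwise take Y in the image of T_X and W = T_X Y. Gray's identity
at (X, Y, Y, X) gives ⟨η, α(Y,Y)⟩ = |η|²|Y|². At (Y, W, Y, W), with the condition Δ'' used to move
T_X across α, it gives |α(Y,Y)|² ≤ |η|²|Y|⁴. Therefore |α(Y,Y) - |Y|²η|² ≤ 0, so α(Y,Y) = |Y|²η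
(`α_T_self`). Polarisation and the cubic relation upgrade this to α(T_X Z, ·) = ⟨T_X Z, ·⟩η (`α_T`).

Thus T_X Z is in Δ, and so is J T_X Z = -T_X JZ, which gives Δ'. For Δ'', Gray's identity puts T(T_X
Z, Y) in span{X, JX} when Y is orthogonal to X and JX, while for Y in that span it lies in the image
of T_X. It is umbilic in either case, and skewness of T finishes (`T_mem`). So T_X maps all of T_x M
into D_x, which is more than C_X = 0.

The curvature identities are proved for metrics on open sets of a vector space and carried to the
manifold by its preferred charts. -/

noncomputable section

namespace NearlyKahler

/-! ### Pointwise algebra: stability of the invariant umbilic subspace under the torsion -/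

section Algebra

variable {V N : Type*} [NormedAddCommGroup V] [InnerProductSpace ℝ V]
  [NormedAddCommGroup N] [InnerProductSpace ℝ N]

/-- The pointwise data of an isometric immersion of a nearly Kähler manifold into a space of
constant curvature `c`: the almost complex structure `J`, the torsion `T` of the canonical
connection, the second fundamental form `α` and the curvature tensor `R`. -/
structure PointwiseImmersion (J : V →ₗ[ℝ] V) (T : V →ₗ[ℝ] V →ₗ[ℝ] V) (α : V →ₗ[ℝ] V →ₗ[ℝ] N)
    (c : ℝ) (R : V → V → V → V) : Prop where
  sq (v : V) : J (J v) = -v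
  inner_map (v w : V) : inner ℝ (J v) (J w) = inner ℝ v w
  T_swap (u v : V) : T u v = -T v u
  T_inner (u v w : V) : inner ℝ (T u v) w = -inner ℝ v (T u w)
  T_J (u v : V) : T u (J v) = -J (T u v)
  α_symm (u v : V) : α u v = α v u
  gauss (u v w z : V) : inner ℝ (R u v w) z =
    c * (inner ℝ v w * inner ℝ u z - inner ℝ u w * inner ℝ v z)
      + inner ℝ (α u z) (α v w) - inner ℝ (α u w) (α v z)
  -- The combination R - ¼[T_u, T_v] + ½ T_{T(u,v)} is the curvature of the canonical connection.
  -- This field says that it commutes with J, the next one that it is a derivation of T.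
  R_J (u v w : V) :
    R u v (J w) - (1 / 4 : ℝ) • (T u (T v (J w)) - T v (T u (J w))) + (1 / 2 : ℝ) • T (T u v) (J w)
      = J (R u v w - (1 / 4 : ℝ) • (T u (T v w) - T v (T u w)) + (1 / 2 : ℝ) • T (T u v) w)
  R_T (u v w z : V) :
    R u v (T w z) - (1 / 4 : ℝ) • (T u (T v (T w z)) - T v (T u (T w z)))
        + (1 / 2 : ℝ) • T (T u v) (T w z)
      = T (R u v w - (1 / 4 : ℝ) • (T u (T v w) - T v (T u w)) + (1 / 2 : ℝ) • T (T u v) w) z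
        + T w (R u v z - (1 / 4 : ℝ) • (T u (T v z) - T v (T u z)) + (1 / 2 : ℝ) • T (T u v) z)

namespace PointwiseImmersion

variable {J : V →ₗ[ℝ] V} {T : V →ₗ[ℝ] V →ₗ[ℝ] V} {α : V →ₗ[ℝ] V →ₗ[ℝ] N} {c : ℝ}
  {R : V → V → V → V}

theorem J_inner (h : PointwiseImmersion J T α c R) (v w : V) : inner ℝ (J v) w = -inner ℝ v (J w) := by
  rw [← h.inner_map v, h.sq, inner_neg_right, neg_neg]

theorem T_J_left (h : PointwiseImmersion J T α c R) (u v : V) : T (J u) v = -J (T u v) := by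
  rw [h.T_swap, h.T_J, h.T_swap v u]; simp

theorem T_self (h : PointwiseImmersion J T α c R) (u : V) : T u u = 0 := by
  have h1 : (2 : ℝ) • T u u = 0 := by
    rw [two_smul]
    nth_rewrite 1 [h.T_swap]
    simp
  simpa using h1

theorem T_self_J (h : PointwiseImmersion J T α c R) (u : V) : T u (J u) = 0 := by
  rw [h.T_J, h.T_self]; simp

theorem inner_J_self (h : PointwiseImmersion J T α c R) (v : V) : inner ℝ v (J v) = (0 : ℝ) := by
  have := h.J_inner v v
  rw [real_inner_comm] at this
  linarith

theorem inner_T_self (h : PointwiseImmersion J T α c R) (u v : V) : inner ℝ v (T u v) = (0 : ℝ) := by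
  have := h.T_inner u v v
  rw [real_inner_comm] at this
  linarith

/-- Gray's curvature identity. -/
theorem gray (h : PointwiseImmersion J T α c R) (u v w z : V) :
    inner ℝ (R u v w) z - inner ℝ (R u v (J w)) (J z) = -inner ℝ (T u v) (T w z) := by
  have h1 := h.R_J u v w
  simp only [h.T_J, map_neg, map_sub, map_add, map_smul, neg_neg] at h1
  -- Each T_u anticommutes with J, so [T_u, T_v] commutes with J and cancels, while the two halves
  -- of T_{T(u,v)} add up.
  have h2 : R u v (J w) = J (R u v w) + J (T (T u v) w) := by
    rw [← sub_eq_zero] at h1 ⊢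
    rw [← h1]
    module
  rw [h2, inner_add_left, h.inner_map, h.inner_map, h.T_swap (T u v), inner_neg_left, h.T_inner]
  ring

/-- If `X` and `J X` are umbilic for `η`, then `T_X` satisfies `T_X³ = -κ |X|² T_X`. -/
theorem T_cube (h : PointwiseImmersion J T α c R) {η : N} {X : V} (hX : ∀ Y, α X Y = inner ℝ X Y • η)
    (hJX : ∀ Y, α (J X) Y = inner ℝ (J X) Y • η) (Y : V) :
    T X (T X (T X Y)) = -((c + inner ℝ η η) * inner ℝ X X) • T X Y := by
  set κ := c + inner ℝ η η with hκ
  have hR (Z : V) : R X (J X) Z = κ • (inner ℝ (J X) Z • X - inner ℝ X Z • J X) := by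
    refine ext_inner_right ℝ fun W ↦ ?_
    rw [h.gauss, hX, hX, hJX, hJX]
    simp only [inner_smul_left, inner_smul_right, inner_sub_left, hκ]
    simp
    ring
  -- Since T(X, JX) = 0 and T_{JX} = -J T_X, the canonical curvature at (X, JX) is R(X, JX) - ½ J
  -- T_X². The image of T_X is orthogonal to X and JX, so R(X, JX) vanishes there; its only
  -- surviving contribution is R(X, JX)X = -κ|X|² JX.
  have h1 := h.R_T X (J X) X (J Y)
  have e1 : inner ℝ X (J (T X Y)) = (0 : ℝ) := by
    rw [← neg_inj, ← inner_neg_right, ← h.T_J, ← neg_inj, ← h.T_inner, h.T_self]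
    simp
  have e2 : inner ℝ (J X) (J (T X Y)) = (0 : ℝ) := by
    rw [h.inner_map, ← neg_eq_zero, ← h.T_inner, h.T_self, inner_zero_left]
  have e3 : inner ℝ (J X) X = (0 : ℝ) := by rw [real_inner_comm, h.inner_J_self]
  simp only [hR, h.T_self, h.T_J_left, h.T_J, h.sq, map_zero, LinearMap.zero_apply,
    smul_zero, add_zero, map_neg, map_sub, map_smul, LinearMap.neg_apply, LinearMap.smul_apply,
    inner_neg_right, e1, e2, e3, zero_smul, sub_zero, neg_zero,
    sub_self, zero_sub, neg_neg, smul_neg] at h1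
  rw [← sub_eq_zero] at h1 ⊢
  rw [← neg_eq_zero, ← h1]
  module

/-- In Gray's identity at (X, Y, Z, W), umbilicity of X makes every term of the Gauss equation carry
a factor ⟨X, Z⟩, ⟨X, W⟩, ⟨X, JZ⟩ or ⟨X, JW⟩. -/
theorem inner_T_T_eq_zero (h : PointwiseImmersion J T α c R) {η : N} {X : V} (hX : ∀ Y, α X Y = inner ℝ X Y • η)
    {Y Z W : V} (hZ : inner ℝ X Z = (0 : ℝ)) (hZ' : inner ℝ (J X) Z = (0 : ℝ))
    (hW : inner ℝ X W = (0 : ℝ)) (hW' : inner ℝ (J X) W = (0 : ℝ)) :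
    inner ℝ (T X Y) (T Z W) = (0 : ℝ) := by
  have h1 := h.gray X Y Z W
  have hZ2 : inner ℝ X (J Z) = (0 : ℝ) := by rw [← neg_eq_zero, ← h.J_inner, hZ']
  have hW2 : inner ℝ X (J W) = (0 : ℝ) := by rw [← neg_eq_zero, ← h.J_inner, hW']
  rw [h.gauss, h.gauss, hX, hX, hX, hX, hZ, hW, hZ2, hW2] at h1
  simpa using h1.symm

theorem eq_of_inner_eq_zero (h : PointwiseImmersion J T α c R) {X t : V} (hX0 : X ≠ 0)
    (ht : ∀ w, inner ℝ X w = (0 : ℝ) → inner ℝ (J X) w = (0 : ℝ) → inner ℝ t w = (0 : ℝ)) :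
    t = (inner ℝ t X / inner ℝ X X) • X + (inner ℝ t (J X) / inner ℝ X X) • J X := by
  have hXX : inner ℝ X X ≠ (0 : ℝ) := inner_self_ne_zero.2 hX0
  have e3 : inner ℝ (J X) X = (0 : ℝ) := by rw [real_inner_comm, h.inner_J_self]
  set r := t - ((inner ℝ t X / inner ℝ X X) • X + (inner ℝ t (J X) / inner ℝ X X) • J X) with hr
  have h1 : inner ℝ X r = (0 : ℝ) := by
    rw [hr, inner_sub_right, inner_add_right, inner_smul_right, inner_smul_right, h.inner_J_self,
      real_inner_comm X t]
    field_simp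
    ring
  have h2 : inner ℝ (J X) r = (0 : ℝ) := by
    rw [hr, inner_sub_right, inner_add_right, inner_smul_right, inner_smul_right, h.inner_map, e3,
      real_inner_comm (J X) t]
    field_simp
    ring
  have h3 : inner ℝ r r = (0 : ℝ) := by
    nth_rewrite 1 [hr]
    rw [inner_sub_left, inner_add_left, inner_smul_left, inner_smul_left, ht r h1 h2, h1, h2]
    simp
  exact sub_eq_zero.1 (inner_self_eq_zero.1 h3)

/-- By skewness ⟨T(T(X,Y), Z), w⟩ = ⟨T(X,Y), T(Z,w)⟩ for every w, and this vanishes for w orthogonal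
to X and JX by `inner_T_T_eq_zero`. Only the components along X and JX remain. -/
theorem T_T_eq (h : PointwiseImmersion J T α c R) {η : N} {X : V} (hX : ∀ Y, α X Y = inner ℝ X Y • η) (hX0 : X ≠ 0) {Y Z : V}
    (hZ : inner ℝ X Z = (0 : ℝ)) (hZ' : inner ℝ (J X) Z = (0 : ℝ)) :
    T (T X Y) Z = (inner ℝ (T (T X Y) Z) X / inner ℝ X X) • X
      + (inner ℝ (T (T X Y) Z) (J X) / inner ℝ X X) • J X := by
  refine h.eq_of_inner_eq_zero hX0 fun w hw hw' ↦ ?_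
  rw [h.T_swap, inner_neg_left, h.T_inner, h.inner_T_T_eq_zero hX hZ hZ' hw hw', neg_zero,
    neg_zero]

theorem inner_X_T (h : PointwiseImmersion J T α c R) (X Y : V) : inner ℝ X (T X Y) = (0 : ℝ) := by
  rw [← neg_eq_zero, ← h.T_inner, h.T_self, inner_zero_left]

theorem inner_JX_T (h : PointwiseImmersion J T α c R) (X Y : V) : inner ℝ (J X) (T X Y) = (0 : ℝ) := by
  rw [← neg_eq_zero, ← h.T_inner, h.T_self_J, inner_zero_left]

/-- On the image of `T_X` the second fundamental form is umbilic. -/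
theorem α_T_self (h : PointwiseImmersion J T α c R) {η : N} {X : V} (hX : ∀ Y, α X Y = inner ℝ X Y • η)
    (hJX : ∀ Y, α (J X) Y = inner ℝ (J X) Y • η)
    (hX'' : ∀ Y Z, α (T X Y) Z + α (T X Z) Y = 0) (Z : V) :
    α (T X Z) (T X Z) = inner ℝ (T X Z) (T X Z) • η := by
  by_cases hX0 : X = 0
  · simp [hX0]
  by_cases hk : (c + inner ℝ η η) * inner ℝ X X = 0
  -- Here T_X³ = 0; a skew operator with vanishing cube is zero, by taking norms twice.
  · have h1 := h.T_cube hX hJX Z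
    rw [hk, neg_zero, zero_smul] at h1
    have h2 : T X (T X Z) = 0 := by
      rw [← inner_self_eq_zero (𝕜 := ℝ), h.T_inner, h1, inner_zero_right, neg_zero]
    have h3 : T X Z = 0 := by
      rw [← inner_self_eq_zero (𝕜 := ℝ), h.T_inner, h2, inner_zero_right, neg_zero]
    simp [h3]
  set κ := c + inner ℝ η η with hκ
  have hXX : (0 : ℝ) < inner ℝ X X := real_inner_self_pos.2 hX0
  set Y := T X Z with hY
  set W := T X Y with hW
  have hcube : T X W = -(κ * inner ℝ X X) • Y := h.T_cube hX hJX Z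
  have hWW : inner ℝ W W = κ * inner ℝ X X * inner ℝ Y Y := by
    rw [hW, h.T_inner, ← hW, hcube, inner_smul_right]; ring
  rcases eq_or_ne Y 0 with hY0 | hY0
  · simp [hY0]
  have hXY : inner ℝ X Y = (0 : ℝ) := h.inner_X_T X Z
  have hJXY : inner ℝ (J X) Y = (0 : ℝ) := h.inner_JX_T X Z
  have hXW : inner ℝ X W = (0 : ℝ) := h.inner_X_T X Y
  have hJXW : inner ℝ (J X) W = (0 : ℝ) := h.inner_JX_T X Y
  -- The condition Δ'' in the form used throughout: T_X is skew with respect to α.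
  have hswap (U U' : V) : α (T X U) U' = -α U (T X U') := by
    rw [eq_neg_iff_add_eq_zero, ← h.α_symm (T X U') U, hX'']
  -- the trace of the shape operator in the direction `η`
  have hη : inner ℝ η (α Y Y) = inner ℝ η η * inner ℝ Y Y := by
    have h1 := h.gray X Y Y X
    have hYJX : inner ℝ Y (J X) = (0 : ℝ) := by rw [real_inner_comm, hJXY]
    have hXJY : inner ℝ X (J Y) = (0 : ℝ) := by rw [← neg_eq_zero, ← h.J_inner, hJXY]
    rw [h.gauss, h.gauss, hX, hX, hX, hX, h.T_swap Y X, ← hW, inner_neg_right, hWW, hXY, hYJX,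
      hXJY, h.inner_J_self X] at h1
    simp only [zero_smul, inner_zero_left, inner_smul_left, hκ] at h1
    simp only [conj_trivial] at h1
    have h2 : inner ℝ X X * (inner ℝ η (α Y Y) - inner ℝ η η * inner ℝ Y Y) = 0 := by
      linarith
    rcases mul_eq_zero.1 h2 with h3 | h3
    · exact absurd h3 hXX.ne'
    · linarith
  -- W is orthogonal to X and JX, so T(Y, W) lies in span{X, JX}; total skewness of T gives the
  -- components ⟨T(Y,W), X⟩ = |W|² and ⟨T(Y,W), JX⟩ = 0.
  have hTYW : T Y W = (inner ℝ W W / inner ℝ X X) • X := by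
    have h1 := h.T_T_eq hX hX0 (Y := Z) hXW hJXW
    rw [← hY] at h1
    have h2 : inner ℝ (T Y W) X = inner ℝ W W := by
      rw [h.T_inner, h.T_swap Y X, ← hW, inner_neg_right, neg_neg]
    have h3 : inner ℝ (T Y W) (J X) = (0 : ℝ) := by
      rw [h.T_inner, h.T_J, h.T_swap Y X, ← hW, map_neg, neg_neg, h.inner_J_self, neg_zero]
    rw [h1, h2, h3]; simp
  have hYW : inner ℝ Y W = (0 : ℝ) := h.inner_T_self X Y
  have hWJY : inner ℝ W (J Y) = (0 : ℝ) := by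
    have h1 : inner ℝ W (J Y) = inner ℝ Y (J W) := by
      rw [hW, h.T_inner, h.T_J, inner_neg_right, neg_neg]
    have h2 := h.J_inner Y W
    rw [real_inner_comm] at h2
    linarith
  have a1 : α Y W = 0 := by
    have h1 := hswap Y Y
    rw [← hW, h.α_symm W Y, eq_neg_iff_add_eq_zero, ← two_smul ℝ] at h1
    simpa using h1
  have a2 : α W W = (κ * inner ℝ X X) • α Y Y := by
    nth_rewrite 1 [hW]
    rw [hswap, hcube]; simp
  have a3 : α Y (J W) = α W (J Y) := by
    have h1 := hswap Y (J Y)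
    rw [← hW, h.T_J, ← hW, map_neg, neg_neg] at h1
    exact h1.symm
  have a4 : α W (J W) = -(κ * inner ℝ X X) • α Y (J Y) := by
    have h1 : J W = -T X (J Y) := by rw [h.T_J, neg_neg]
    rw [h1, map_neg, ← hswap, hcube]; simp
  -- The decisive instance. With |W|² = κ|X|²|Y|² it becomes κ|X|²|α(Y,Y)|² + |α(W,JY)|² +
  -- κ|X|²|α(Y,JY)|² = κ|X|²(κ - c)|Y|⁴, where κ - c = |η|².
  have h1 := h.gray Y W Y W
  rw [h.gauss, h.gauss, h.α_symm W Y, a1, a2, a3, a4, hTYW, real_inner_comm Y W, hYW, hWJY,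
    h.inner_J_self Y, inner_zero_left, inner_smul_left, inner_smul_right, inner_smul_right,
    inner_smul_right] at h1
  simp only [conj_trivial] at h1
  have h2 : inner ℝ W W / inner ℝ X X = κ * inner ℝ Y Y := by
    rw [hWW]; field_simp
  rw [h2, hWW] at h1
  have hκ0 : 0 ≤ κ * inner ℝ X X := by
    have h3 : (0 : ℝ) ≤ inner ℝ W W := real_inner_self_nonneg
    rw [hWW] at h3
    exact nonneg_of_mul_nonneg_left h3 (real_inner_self_pos.2 hY0)
  have h3 : (0 : ℝ) ≤ inner ℝ (α W (J Y)) (α W (J Y)) := real_inner_self_nonneg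
  have h4 : (0 : ℝ) ≤ inner ℝ (α Y (J Y)) (α Y (J Y)) := real_inner_self_nonneg
  have h5 : inner ℝ (α Y Y) (α Y Y) ≤ inner ℝ η η * inner ℝ Y Y * inner ℝ Y Y := by
    have h6 : 0 < κ * inner ℝ X X := lt_of_le_of_ne hκ0 (Ne.symm hk)
    have h7 : (κ * inner ℝ X X) * inner ℝ (α Y Y) (α Y Y)
        ≤ (κ * inner ℝ X X) * (inner ℝ η η * inner ℝ Y Y * inner ℝ Y Y) := by
      have h8 := mul_nonneg hκ0 h4
      have h9 : inner ℝ η η = κ - c := by rw [hκ]; ring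
      rw [h9]
      nlinarith
    exact le_of_mul_le_mul_left h7 h6
  -- Expand |α(Y,Y) - |Y|²η|²: the mixed term is known exactly from `hη`, and `h5` bounds |α(Y,Y)|²,
  -- so the total is at most 0.
  rw [← sub_eq_zero, ← inner_self_eq_zero (𝕜 := ℝ)]
  refine le_antisymm ?_ real_inner_self_nonneg
  rw [inner_sub_left, inner_sub_right, inner_sub_right, inner_smul_left, inner_smul_left,
    inner_smul_right, inner_smul_right, real_inner_comm η (α Y Y), hη]
  simp only [conj_trivial]
  linarith

/-- The image of `T_X` is umbilic. -/
theorem α_T (h : PointwiseImmersion J T α c R) {η : N} {X : V} (hX : ∀ Y, α X Y = inner ℝ X Y • η)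
    (hJX : ∀ Y, α (J X) Y = inner ℝ (J X) Y • η)
    (hX'' : ∀ Y Z, α (T X Y) Z + α (T X Z) Y = 0) (Z W : V) :
    α (T X Z) W = inner ℝ (T X Z) W • η := by
  have hpol (Y Z : V) : α (T X Y) (T X Z) = inner ℝ (T X Y) (T X Z) • η := by
    have h1 := h.α_T_self hX hJX hX'' Y
    have h2 := h.α_T_self hX hJX hX'' Z
    have h3 := h.α_T_self hX hJX hX'' (Y + Z)
    simp only [map_add, LinearMap.add_apply, inner_add_left, inner_add_right, h1, h2,
      h.α_symm (T X Z) (T X Y), real_inner_comm (T X Y) (T X Z)] at h3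
    have h4 : (2 : ℝ) • (α (T X Y) (T X Z) - inner ℝ (T X Y) (T X Z) • η) = 0 := by
      rw [← sub_eq_zero] at h3
      rw [← h3]
      module
    rw [← sub_eq_zero]
    simpa using h4
  have hswap (U U' : V) : α (T X U) U' = -α U (T X U') := by
    rw [eq_neg_iff_add_eq_zero, ← h.α_symm (T X U') U, hX'']
  have h1 := h.T_cube hX hJX Z
  set k := (c + inner ℝ η η) * inner ℝ X X with hk
  rcases eq_or_ne k 0 with hk0 | hk0
  · have h3 : T X Z = 0 := by
      have h2 : T X (T X Z) = 0 := by
        rw [← inner_self_eq_zero (𝕜 := ℝ), h.T_inner, h1, hk0, neg_zero, zero_smul,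
          inner_zero_right, neg_zero]
      rw [← inner_self_eq_zero (𝕜 := ℝ), h.T_inner, h2, inner_zero_right, neg_zero]
    simp [h3]
  -- Moving two factors T_X onto W puts both arguments of α in the image of T_X, where umbilicity is
  -- already known; the cubic relation then allows division by k.
  have h2 : α (T X (T X (T X Z))) W = inner ℝ (T X (T X (T X Z))) W • η := by
    rw [hswap, hswap, neg_neg, hpol, h.T_inner X (T X (T X Z)), h.T_inner X (T X Z) (T X W), neg_neg]
  rw [h1, map_smul, LinearMap.smul_apply, inner_smul_left, mul_smul] at h2
  exact smul_right_injective _ (neg_ne_zero.2 hk0) h2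

/-- The invariant umbilic subspace is stable under its own torsion operators. -/
theorem T_mem (h : PointwiseImmersion J T α c R) {η : N} {X : V} (hX : ∀ Y, α X Y = inner ℝ X Y • η)
    (hX' : ∀ Y, α X (J Y) + α (J X) Y = 0)
    (hX'' : ∀ Y Z, α (T X Y) Z + α (T X Z) Y = 0) (Z : V) :
    (∀ Y, α (T X Z) Y = inner ℝ (T X Z) Y • η) ∧
    (∀ Y, α (T X Z) (J Y) + α (J (T X Z)) Y = 0) ∧
    ∀ Y W, α (T (T X Z) Y) W + α (T (T X Z) W) Y = 0 := by
  have hJX (Y : V) : α (J X) Y = inner ℝ (J X) Y • η := by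
    rw [eq_neg_of_add_eq_zero_right (hX' Y), hX, h.J_inner, neg_smul]
  have hT := h.α_T hX hJX hX''
  have hTJ (Y W : V) : α (J (T X Y)) W = inner ℝ (J (T X Y)) W • η := by
    have h1 : J (T X Y) = -T X (J Y) := by rw [h.T_J, neg_neg]
    rw [h1, map_neg, LinearMap.neg_apply, hT, inner_neg_left, neg_smul]
  refine ⟨hT Z, fun Y ↦ ?_, ?_⟩
  · rw [hT, hTJ, ← add_smul, h.J_inner, add_neg_cancel, zero_smul]
  · rcases eq_or_ne X 0 with rfl | hX0
    · simp
    -- Split Y into its part in span{X, JX}, which T(T_X Z, ·) sends into the image of T_X, and its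
    -- part orthogonal to X and JX, which it sends into span{X, JX}. Both images are umbilic.
    have hTT (Y W : V) : α (T (T X Z) Y) W = inner ℝ (T (T X Z) Y) W • η := by
      have hXX : inner ℝ X X ≠ (0 : ℝ) := inner_self_ne_zero.2 hX0
      obtain ⟨a, b, Y', rfl, hY, hY'⟩ : ∃ (a b : ℝ) (Y' : V), Y = a • X + b • J X + Y' ∧
          inner ℝ X Y' = (0 : ℝ) ∧ inner ℝ (J X) Y' = (0 : ℝ) := by
        refine ⟨inner ℝ X Y / inner ℝ X X, inner ℝ (J X) Y / inner ℝ X X,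
          Y - ((inner ℝ X Y / inner ℝ X X) • X + (inner ℝ (J X) Y / inner ℝ X X) • J X),
          by module, ?_, ?_⟩
        · rw [inner_sub_right, inner_add_right, inner_smul_right, inner_smul_right, h.inner_J_self]
          field_simp
          ring
        · rw [inner_sub_right, inner_add_right, inner_smul_right, inner_smul_right, h.inner_map,
            real_inner_comm X (J X), h.inner_J_self]
          field_simp
          ring
      have h1 := h.T_T_eq hX hX0 (Y := Z) hY hY'
      generalize inner ℝ (T (T X Z) Y') X / inner ℝ X X = p at h1
      generalize inner ℝ (T (T X Z) Y') (J X) / inner ℝ X X = q at h1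
      simp only [map_add, map_smul, h1, h.T_J, h.T_swap (T X Z) X, map_neg, LinearMap.add_apply,
        LinearMap.smul_apply, LinearMap.neg_apply, hX, hJX, hT, hTJ, inner_add_left, inner_neg_left,
        inner_smul_left, conj_trivial]
      module
    intro Y W
    rw [hTT, hTT, ← add_smul, h.T_inner, real_inner_comm, neg_add_cancel, zero_smul]

end PointwiseImmersion
end Algebra

/-! ### Algebraic curvature tensors and the algebra behind the parallelism of the torsion -/

section AlgebraicCurvature

variable {E : Type*}

/-- The symmetries of a Riemannian curvature tensor. -/
structure IsCurvatureLike (K : E → E → E → E → ℝ) : Prop where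
  swap (u v w z : E) : K u v w z = -K v u w z
  skew (u v w z : E) : K u v w z = -K u v z w
  bianchi (u v w z : E) : K u v w z + K v w u z + K w u v z = 0

theorem IsCurvatureLike.pair_symm {K : E → E → E → E → ℝ} (hK : IsCurvatureLike K) (u v w z : E) :
    K u v w z = K w z u v := by
  -- A combination of the Bianchi identities for the four cyclic shifts of the arguments.
  have h1 := hK.bianchi u v w z
  have h2 := hK.bianchi v w z u
  have h3 := hK.bianchi w z u v
  have h4 := hK.bianchi z u v w
  linarith [hK.swap u v w z, hK.swap v w u z, hK.swap w u v z, hK.skew v w z u, hK.skew w z v u,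
    hK.skew z v w u, hK.swap z v w u, hK.skew w z u v, hK.skew z u w v, hK.skew u w z v,
    hK.swap u w z v, hK.skew z u v w, hK.skew u v z w, hK.skew v z u w, hK.swap v z u w,
    hK.swap z u w v, hK.skew u w v z, hK.skew v w u z, hK.skew v z w u]

/-- A curvature-like tensor is determined by its sectional curvatures. -/
theorem IsCurvatureLike.eq_zero [AddCommGroup E] {K : E → E → E → E → ℝ} (hK : IsCurvatureLike K)
    (h₁ : ∀ u u' v w z, K (u + u') v w z = K u v w z + K u' v w z)
    (h0 : ∀ u v, K u v v u = 0) (u v w z : E) : K u v w z = 0 := by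
  have h₂ (u v v' w z : E) : K u (v + v') w z = K u v w z + K u v' w z := by
    rw [hK.swap, h₁, hK.swap u v, hK.swap u v']; ring
  have h₃ (u v w w' z : E) : K u v (w + w') z = K u v w z + K u v w' z := by
    rw [hK.pair_symm, h₁, hK.pair_symm w, hK.pair_symm w']
  have h₄ (u v w z z' : E) : K u v w (z + z') = K u v w z + K u v w z' := by
    rw [hK.pair_symm, h₂, hK.pair_symm w z, hK.pair_symm w z']
  -- Polarising in the outer pair and then, in `h6`, in the inner pair makes K skew in its middle
  -- arguments, so the three terms of the Bianchi identity coincide.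
  have h5 (u v w : E) : K u v v w = 0 := by
    have h := h0 (u + w) v
    rw [h₁, h₄, h₄, h0, h0] at h
    linarith [hK.pair_symm w v v u, hK.swap u v v w, hK.skew v u v w]
  have h6 (u v w z : E) : K u v w z = -K u w v z := by
    have h := h5 u (v + w) z
    rw [h₂, h₃, h₃, h5, h5] at h
    linarith
  linarith [hK.bianchi u v w z, h6 v w u z, hK.swap v u w z, hK.swap w u v z, h6 u w v z]

/-- Algebraic part of Kirichenko's theorem. Here `s x u v w` stands for `⟨(∇̄_x T)(u, v), w⟩` and
`q u v w z` for `⟨T(u, v), T(w, z)⟩`. -/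
theorem IsCurvatureLike.nablaT_eq_zero {K : E → E → E → E → ℝ} (hK : IsCurvatureLike K)
    {J : E → E} {s q : E → E → E → E → ℝ}
    (hKJ₁ : ∀ u v w z, K (J (J u)) v w z = -K u v w z)
    (hs₁ : ∀ x u v w, s x u v w = -s x v u w) (hs₂ : ∀ x u v w, s x u v w = -s x u w v)
    (hsJ₁ : ∀ x u v w, s x (J u) v w = s x u (J v) w)
    (hsJJ : ∀ x u v w, s x (J (J u)) v w = -s x u v w)
    (hqJ : ∀ u v w z, q (J u) v w z = q u (J v) w z)
    (hqJ' : ∀ u v w z, q (J u) v w z = -q u v (J w) z)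
    (hqJJ : ∀ u v w z, q (J (J u)) v w z = -q u v w z)
    (hA : ∀ u v w z, K u v w z - K u v (J w) (J z)
      = -(q u v w z + s u v w z - s v u w z)) (x u v w : E) : s x u v w = 0 := by
  have hKJ₂ (u v w z : E) : K u (J (J v)) w z = -K u v w z := by
    rw [hK.swap, hKJ₁, hK.swap u v]
  have hKJ₃ (u v w z : E) : K u v (J (J w)) z = -K u v w z := by
    rw [hK.pair_symm, hKJ₁, hK.pair_symm w]
  have hsJ₁' (x u v w : E) : s x u (J v) w = s x (J u) v w := (hsJ₁ x u v w).symm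
  have hqJ₂ (u v w z : E) : q u (J v) w z = q (J u) v w z := (hqJ u v w z).symm
  have hqJ₃ (u v w z : E) : q u v (J w) z = -q (J u) v w z := by rw [hqJ', neg_neg]
  -- the part of type `(4, 0) + (0, 4)`
  set σ : E → E → E → E → ℝ := fun x u v w ↦ s x u v w - s (J x) (J u) v w with hσ
  set P : E → E → E → E → ℝ := fun u v w z ↦ K u v w z - K u v (J w) (J z) - K (J u) (J v) w z
    + K (J u) (J v) (J w) (J z) - K u (J v) (J w) z - K u (J v) w (J z) - K (J u) v (J w) z
    - K (J u) v w (J z) with hP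
  -- P is, up to scale, the component of K of type (4,0) + (0,4). The tensor q has no such
  -- component, so it drops out of the combination of the four instances of `hA`.
  have hPσ (u v w z : E) : P u v w z = -2 * (σ u v w z - σ v u w z) := by
    have a1 := hA u v w z
    have a2 := hA (J u) (J v) w z
    have a3 := hA u (J v) (J w) z
    have a4 := hA (J u) v (J w) z
    simp only [hKJ₃, hsJ₁', hsJJ, hqJ₂, hqJ₃, hqJJ] at a1 a2 a3 a4
    simp only [hP, hσ]
    linarith
  have hPK : IsCurvatureLike P := by
    refine ⟨fun u v w z ↦ ?_, fun u v w z ↦ ?_, fun u v w z ↦ ?_⟩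
    · simp only [hP, hK.swap v, hK.swap (J v)]; ring
    · simp only [hP, hK.skew _ _ z, hK.skew _ _ (J z)]; ring
    · simp only [hP]
      linarith [hK.bianchi u v w z, hK.bianchi (J u) (J v) w z, hK.bianchi (J u) v (J w) z,
        hK.bianchi (J u) v w (J z), hK.bianchi u (J v) (J w) z, hK.bianchi u (J v) w (J z),
        hK.bianchi u v (J w) (J z), hK.bianchi (J u) (J v) (J w) (J z)]
  have hσ₁ (x u v w : E) : σ x u v w = -σ x v u w := by
    simp only [hσ, hs₁ x u, hs₁ (J x) (J u), hsJ₁']; ring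
  have hσ₂ (x u v w : E) : σ x u v w = -σ x u w v := by
    simp only [hσ, hs₂ x u v, hs₂ (J x) (J u) v]; ring
  -- With suitable signs, let A_x, A_u, A_v, A_w be the values of σ with the indicated vector in the
  -- first slot. Each Bianchi identity of P says that three of these four numbers sum to zero, so
  -- all of them vanish.
  have hσ0 (x u v w : E) : σ x u v w = 0 := by
    have b1 := hPK.bianchi x u v w
    have b2 := hPK.bianchi x u w v
    have b3 := hPK.bianchi x v w u
    have b4 := hPK.bianchi u v w x
    simp only [hPσ] at b1 b2 b3 b4
    linarith [hσ₁ x u v w, hσ₁ x u w v, hσ₁ x v w u, hσ₂ x u v w, hσ₂ x v u w, hσ₂ x w u v,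
      hσ₁ u x v w, hσ₁ u x w v, hσ₁ u v w x, hσ₂ u x v w, hσ₂ u v x w, hσ₂ u w x v,
      hσ₁ v x u w, hσ₁ v x w u, hσ₁ v u w x, hσ₂ v x u w, hσ₂ v u x w, hσ₂ v w x u,
      hσ₁ w x u v, hσ₁ w x v u, hσ₁ w u v x, hσ₂ w x u v, hσ₂ w u x v, hσ₂ w v x u]
  have hs0 (x u v w : E) : s (J x) u v w = -s x (J u) v w := by
    have := hσ0 x (J u) v w
    simp only [hσ, hsJJ] at this
    linarith
  -- the part of type `(1, 3) + (3, 1)`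
  set M : E → E → E → E → ℝ := fun u v w z ↦ K u v w z - K u v (J w) (J z) + K (J u) (J v) w z
    - K (J u) (J v) (J w) (J z) + K (J u) v (J w) z + K (J u) v w (J z)
    - K u (J v) (J w) z - K u (J v) w (J z) with hM
  -- Once σ = 0, moving J out of the first slot of s costs a sign. In this combination q and the
  -- term with u and v exchanged cancel, isolating s itself.
  have hMs (u v w z : E) : M u v w z = -4 * s u v w z := by
    have a1 := hA u v w z
    have a2 := hA (J u) (J v) w z
    have a3 := hA u (J v) (J w) z
    have a4 := hA (J u) v (J w) z
    simp only [hKJ₃, hs0, hsJ₁', hsJJ, hqJ₂, hqJ₃, hqJJ] at a1 a2 a3 a4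
    simp only [hM]
    linarith
  have hb (x u v w : E) : K x u v w + K x w u v - K x v u w = 0 := by
    linarith [hK.bianchi x u v w, hK.pair_symm u v x w, hK.swap v x u w]
  -- The signs in M treat the last three slots alike, so M inherits the Bianchi identity in these
  -- slots. As s is totally skew in them, the identity reads 3s = 0.
  have hMb : M x u v w + M x w u v - M x v u w = 0 := by
    simp only [hM]
    linarith [hb x u v w, hb (J x) (J u) v w, hb (J x) u (J v) w, hb (J x) u v (J w),
      hb x (J u) (J v) w, hb x (J u) v (J w), hb x u (J v) (J w), hb (J x) (J u) (J v) (J w)]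
  simp only [hMs] at hMb
  linarith [hs₁ x v u w, hs₁ x w u v, hs₂ x u w v]

end AlgebraicCurvature

/-! ### Connections d + Γ on an open set: curvature and parallel sections -/

section LocalCalculus

variable {E : Type*} [NormedAddCommGroup E] [NormedSpace ℝ E]
  {X Y Z : Type*} [NormedAddCommGroup X] [NormedSpace ℝ X] [NormedAddCommGroup Y] [NormedSpace ℝ Y]
  [NormedAddCommGroup Z] [NormedSpace ℝ Z] {U : Set E} {z : E}

theorem hasFDerivAt_of_contDiffOn {s : E → X} (hs : ContDiffOn ℝ ∞ s U) (hU : IsOpen U)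
    (hz : z ∈ U) : HasFDerivAt s (fderiv ℝ s z) z :=
  ((hs.contDiffAt (hU.mem_nhds hz)).differentiableAt (by simp)).hasFDerivAt

theorem contDiffOn_fderiv {s : E → X} (hs : ContDiffOn ℝ ∞ s U) (hU : IsOpen U) :
    ContDiffOn ℝ ∞ (fderiv ℝ s) U :=
  hs.fderiv_of_isOpen hU (by simp)

theorem fderiv_fderiv_comm {s : E → X} (hs : ContDiffOn ℝ ∞ s U) (hU : IsOpen U)
    (hz : z ∈ U) (u v : E) : fderiv ℝ (fderiv ℝ s) z u v = fderiv ℝ (fderiv ℝ s) z v u :=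
  (((hs.contDiffAt (hU.mem_nhds hz)).isSymmSndFDerivAt
    (by rw [minSmoothness_of_isRCLikeNormedField]; exact ENat.LEInfty.out)).eq u v)

theorem fderiv_eq_of_eqOn {s t : E → X} (hU : IsOpen U) (h : ∀ y ∈ U, s y = t y) (hz : z ∈ U) :
    fderiv ℝ s z = fderiv ℝ t z :=
  Filter.EventuallyEq.fderiv_eq (Filter.eventually_of_mem (hU.mem_nhds hz) h)

theorem _root_.HasFDerivAt.apply_const {A : E → X →L[ℝ] Y} {A' : E →L[ℝ] X →L[ℝ] Y}
    (h : HasFDerivAt A A' z) (v : X) : HasFDerivAt (fun y ↦ A y v) (A'.flip v) z := by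
  have := h.clm_apply (hasFDerivAt_const v z)
  simpa using this

theorem fderiv_apply_const {A : E → X →L[ℝ] Y} (hA : DifferentiableAt ℝ A z) (v : X) (u : E) :
    fderiv ℝ (fun y ↦ A y v) z u = fderiv ℝ A z u v := by
  rw [(hA.hasFDerivAt.apply_const v).fderiv]; rfl

/-- The curvature endomorphism of the connection `d + Γ` on an open subset of `E`. -/
def curvatureEnd (Γ : E → E →L[ℝ] E →L[ℝ] E) (z u v : E) : E →L[ℝ] E :=
  fderiv ℝ Γ z u v - fderiv ℝ Γ z v u + (Γ z u ∘L Γ z v - Γ z v ∘L Γ z u)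

/-- A parallel section is annihilated by the curvature. -/
theorem curvatureEnd_of_parallel [FiniteDimensional ℝ E] [FiniteDimensional ℝ X] (hU : IsOpen U)
    {Γ : E → E →L[ℝ] E →L[ℝ] E} {s : E → X}
    {ρ : (E →L[ℝ] E) → X → X} (hρb : IsBilinearMap ℝ ρ)
    (hρ : ∀ a b x, ρ (a ∘L b - b ∘L a) x = ρ a (ρ b x) - ρ b (ρ a x))
    (hΓ : ContDiffOn ℝ ∞ Γ U) (hs : ContDiffOn ℝ ∞ s U)
    (h : ∀ z ∈ U, ∀ u, fderiv ℝ s z u = -ρ (Γ z u) (s z)) (hz : z ∈ U) (u v : E) :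
    ρ (curvatureEnd Γ z u v) (s z) = 0 := by
  obtain ⟨ρ, rfl⟩ : ∃ ρ' : (E →L[ℝ] E) →L[ℝ] X →L[ℝ] X, ρ = fun a x ↦ ρ' a x :=
    ⟨hρb.toContinuousBilinearMap, rfl⟩
  simp only at hρ h ⊢
  have hsd := hasFDerivAt_of_contDiffOn hs hU hz
  have hΓd := hasFDerivAt_of_contDiffOn hΓ hU hz
  have hs2 := hasFDerivAt_of_contDiffOn (contDiffOn_fderiv hs hU) hU hz
  -- Differentiating ds = -ρ(Γ)s once more expresses the second derivative of s through s alone; its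
  -- symmetry in u and v is the claim.
  have key (u v : E) : fderiv ℝ (fderiv ℝ s) z u v
      = -(ρ (fderiv ℝ Γ z u v) (s z) - ρ (Γ z v) (ρ (Γ z u) (s z))) := by
    have h2 := ((ρ.hasFDerivAt.comp z (hΓd.apply_const v)).clm_apply hsd).neg
    rw [← fderiv_apply_const hs2.differentiableAt,
      fderiv_eq_of_eqOn hU (fun y hy ↦ h y hy v) hz, (h2.congr_of_eventuallyEq (by rfl)).fderiv]
    simp [h z hz]
    abel
  have h1 := fderiv_fderiv_comm hs hU hz u v
  rw [key, key] at h1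
  rw [curvatureEnd, map_add, add_apply, hρ, map_sub, sub_apply]
  rw [← sub_eq_zero] at h1
  rw [← neg_eq_zero, ← h1]
  abel

/-- The action of endomorphisms of `E` on endomorphisms of `E`. -/
def actEnd (a b : E →L[ℝ] E) : E →L[ℝ] E := a ∘L b - b ∘L a

theorem isBilinearMap_actEnd : IsBilinearMap ℝ (actEnd (E := E)) where
  add_left a a' b := by ext; simp [actEnd]; abel
  add_right a b b' := by ext; simp [actEnd]; abel
  smul_left c a b := by ext; simp [actEnd, smul_sub]
  smul_right c a b := by ext; simp [actEnd, smul_sub]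

theorem actEnd_apply (a b : E →L[ℝ] E) (v : E) : actEnd a b v = a (b v) - b (a v) := rfl

theorem actEnd_comm (a b x : E →L[ℝ] E) :
    actEnd (a ∘L b - b ∘L a) x = actEnd a (actEnd b x) - actEnd b (actEnd a x) := by
  ext v; simp [actEnd_apply]; abel

/-- The action of endomorphisms of `E` on bilinear forms on `E`. -/
def actForm (a : E →L[ℝ] E) (b : E →L[ℝ] E →L[ℝ] ℝ) : E →L[ℝ] E →L[ℝ] ℝ :=
  -(b ∘L a) - (b.flip ∘L a).flip

theorem actForm_apply (a : E →L[ℝ] E) (b : E →L[ℝ] E →L[ℝ] ℝ) (v w : E) :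
    actForm a b v w = -b (a v) w - b v (a w) := rfl

theorem isBilinearMap_actForm : IsBilinearMap ℝ (actForm (E := E)) where
  add_left a a' b := by ext; simp [actForm_apply]; ring
  add_right a b b' := by ext; simp [actForm_apply]; ring
  smul_left c a b := by ext; simp [actForm_apply]; ring
  smul_right c a b := by ext; simp [actForm_apply]; ring

theorem actForm_comm (a b : E →L[ℝ] E) (x : E →L[ℝ] E →L[ℝ] ℝ) :
    actForm (a ∘L b - b ∘L a) x = actForm a (actForm b x) - actForm b (actForm a x) := by
  ext v w; simp [actForm_apply]; ring

/-- The action of endomorphisms of `E` on `E`-valued bilinear maps on `E`. -/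
def actBilin (a : E →L[ℝ] E) (b : E →L[ℝ] E →L[ℝ] E) : E →L[ℝ] E →L[ℝ] E :=
  ContinuousLinearMap.compL ℝ E E E a ∘L b - b ∘L a - (b.flip ∘L a).flip

theorem actBilin_apply (a : E →L[ℝ] E) (b : E →L[ℝ] E →L[ℝ] E) (v w : E) :
    actBilin a b v w = a (b v w) - b (a v) w - b v (a w) := rfl

theorem isBilinearMap_actBilin : IsBilinearMap ℝ (actBilin (E := E)) where
  add_left a a' b := by ext; simp [actBilin_apply]; abel
  add_right a b b' := by ext; simp [actBilin_apply]; abel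
  smul_left c a b := by ext; simp [actBilin_apply, smul_sub]
  smul_right c a b := by ext; simp [actBilin_apply, smul_sub]

theorem actBilin_comm (a b : E →L[ℝ] E) (x : E →L[ℝ] E →L[ℝ] E) :
    actBilin (a ∘L b - b ∘L a) x = actBilin a (actBilin b x) - actBilin b (actBilin a x) := by
  ext v w; simp [actBilin_apply]; abel

/-- `d + Γ` is the Levi-Civita connection of the metric `g` on the open set `U`. -/
structure IsLocalLeviCivita (U : Set E) (g : E → E →L[ℝ] E →L[ℝ] ℝ) (Γ : E → E →L[ℝ] E →L[ℝ] E) :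
    Prop where
  isOpen : IsOpen U
  smooth_g : ContDiffOn ℝ ∞ g U
  smooth_Γ : ContDiffOn ℝ ∞ Γ U
  symm {z : E} (hz : z ∈ U) (u v : E) : g z u v = g z v u
  pos {z : E} (hz : z ∈ U) {u : E} (hu : u ≠ 0) : 0 < g z u u
  torsion {z : E} (hz : z ∈ U) (u v : E) : Γ z u v = Γ z v u
  metric {z : E} (hz : z ∈ U) (u v w : E) :
    fderiv ℝ g z u v w = g z (Γ z u v) w + g z v (Γ z u w)

variable {g : E → E →L[ℝ] E →L[ℝ] ℝ} {Γ : E → E →L[ℝ] E →L[ℝ] E}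

theorem IsLocalLeviCivita.eq_of_forall (h : IsLocalLeviCivita U g Γ) (hz : z ∈ U) {u v : E}
    (huv : ∀ w, g z u w = g z v w) : u = v := by
  by_contra hne
  have h1 := h.pos hz (sub_ne_zero.2 hne)
  rw [map_sub (g z), sub_apply, huv, sub_self] at h1
  exact lt_irrefl _ h1

variable [FiniteDimensional ℝ E]

set_option synthInstance.maxHeartbeats 200000 in
-- Compatibility with g says that g is a parallel section for the action on bilinear forms, so the
-- curvature annihilates it.
theorem curvatureEnd_skew_of_metric (hU : IsOpen U) (hg : ContDiffOn ℝ ∞ g U)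
    (hΓ : ContDiffOn ℝ ∞ Γ U)
    (hm : ∀ z ∈ U, ∀ u v w, fderiv ℝ g z u v w = g z (Γ z u v) w + g z v (Γ z u w))
    (hz : z ∈ U) (u v w x : E) :
    g z (curvatureEnd Γ z u v w) x = -g z w (curvatureEnd Γ z u v x) := by
  have h1 := curvatureEnd_of_parallel hU isBilinearMap_actForm actForm_comm hΓ hg (fun z hz u ↦ by
    ext v w; simp [actForm_apply, hm z hz]; ring) hz u v
  have h2 := congrArg (fun b : E →L[ℝ] E →L[ℝ] ℝ ↦ b w x) h1
  simp only [actForm_apply, zero_apply] at h2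
  linarith

theorem IsLocalLeviCivita.isCurvatureLike (h : IsLocalLeviCivita U g Γ) (hz : z ∈ U) :
    IsCurvatureLike fun u v w x ↦ g z (curvatureEnd Γ z u v w) x where
  swap u v w x := by simp [curvatureEnd]; ring
  skew u v w x := by
    rw [curvatureEnd_skew_of_metric h.isOpen h.smooth_g h.smooth_Γ (fun z hz ↦ h.metric hz) hz,
      h.symm hz]
  bianchi u v w x := by
    have h1 (u v w : E) : fderiv ℝ Γ z u v w = fderiv ℝ Γ z u w v := by
      have hd := (hasFDerivAt_of_contDiffOn h.smooth_Γ h.isOpen hz)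
      have e (v w : E) : fderiv ℝ (fun y ↦ Γ y v w) z u = fderiv ℝ Γ z u v w := by
        rw [((hd.apply_const v).apply_const w).fderiv]; rfl
      rw [← e, ← e, fderiv_eq_of_eqOn h.isOpen (fun y hy ↦ h.torsion hy v w) hz]
    rw [← add_apply, ← map_add, ← add_apply, ← map_add]
    have : curvatureEnd Γ z u v w + curvatureEnd Γ z v w u + curvatureEnd Γ z w u v = 0 := by
      simp [curvatureEnd, h1 u w v, h1 v u w, h1 w v u, h.torsion hz u v, h.torsion hz w v, h.torsion hz w u]
      abel
    rw [this]; simp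

end LocalCalculus

/-! ### Nearly Kähler structures on an open set and their canonical connection -/

section LocalNearlyKahler

variable {E : Type*} [NormedAddCommGroup E] [NormedSpace ℝ E] {U : Set E} {z : E}
  {g : E → E →L[ℝ] E →L[ℝ] ℝ} {Γ : E → E →L[ℝ] E →L[ℝ] E} {J : E → E →L[ℝ] E}

/-- The covariant derivative `∇J` of `J` for the connection `d + Γ`. -/
def localNablaJ (Γ : E → E →L[ℝ] E →L[ℝ] E) (J : E → E →L[ℝ] E) (z : E) : E →L[ℝ] E →L[ℝ] E :=
  fderiv ℝ J z + (ContinuousLinearMap.compL ℝ E E E).flip (J z) ∘L Γ z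
    - ContinuousLinearMap.compL ℝ E E E (J z) ∘L Γ z

theorem localNablaJ_apply (u v : E) :
    localNablaJ Γ J z u v = fderiv ℝ J z u v + Γ z u (J z v) - J z (Γ z u v) := rfl

/-- The torsion `T(u, v) = -J (∇_u J) v` of the canonical connection. -/
def localTorsion (Γ : E → E →L[ℝ] E →L[ℝ] E) (J : E → E →L[ℝ] E) (z : E) :
    E →L[ℝ] E →L[ℝ] E :=
  -(ContinuousLinearMap.compL ℝ E E E (J z) ∘L localNablaJ Γ J z)

theorem localTorsion_apply (u v : E) :
    localTorsion Γ J z u v = -J z (localNablaJ Γ J z u v) := rfl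

/-- The canonical connection `∇̄ = ∇ + T / 2`. -/
def localCanonical (Γ : E → E →L[ℝ] E →L[ℝ] E) (J : E → E →L[ℝ] E) (z : E) :
    E →L[ℝ] E →L[ℝ] E :=
  Γ z + (1 / 2 : ℝ) • localTorsion Γ J z

theorem localCanonical_apply (u v : E) :
    localCanonical Γ J z u v = Γ z u v + (1 / 2 : ℝ) • localTorsion Γ J z u v := rfl

/-- The covariant derivative `∇̄T` of the torsion of the canonical connection. -/
def localNablaT (Γ : E → E →L[ℝ] E →L[ℝ] E) (J : E → E →L[ℝ] E) (z u : E) : E →L[ℝ] E →L[ℝ] E :=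
  fderiv ℝ (localTorsion Γ J) z u + actBilin (localCanonical Γ J z u) (localTorsion Γ J z)

theorem localNablaT_apply (u v w : E) :
    localNablaT Γ J z u v w = fderiv ℝ (localTorsion Γ J) z u v w
      + (localCanonical Γ J z u (localTorsion Γ J z v w)
      - localTorsion Γ J z (localCanonical Γ J z u v) w
      - localTorsion Γ J z v (localCanonical Γ J z u w)) := rfl

/-- `(g, J)` is a nearly Kähler structure on `U` with Levi-Civita connection `d + Γ`. -/
structure IsLocalNearlyKahler (U : Set E) (g : E → E →L[ℝ] E →L[ℝ] ℝ)
    (Γ : E → E →L[ℝ] E →L[ℝ] E) (J : E → E →L[ℝ] E) : Prop extends IsLocalLeviCivita U g Γ where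
  smooth_J : ContDiffOn ℝ ∞ J U
  sq {z : E} (hz : z ∈ U) (v : E) : J z (J z v) = -v
  inner_map {z : E} (hz : z ∈ U) (v w : E) : g z (J z v) (J z w) = g z v w
  nearly {z : E} (hz : z ∈ U) (v : E) : localNablaJ Γ J z v v = 0

namespace IsLocalNearlyKahler

theorem smooth_T (h : IsLocalNearlyKahler U g Γ J) : ContDiffOn ℝ ∞ (localTorsion Γ J) U := by
  have h1 : ContDiffOn ℝ ∞ (localNablaJ Γ J) U :=
    ((contDiffOn_fderiv h.smooth_J h.isOpen).add
      (((ContinuousLinearMap.compL ℝ E E E).flip.contDiff.comp_contDiffOn h.smooth_J).clm_comp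
        h.smooth_Γ)).sub
      (((ContinuousLinearMap.compL ℝ E E E).contDiff.comp_contDiffOn h.smooth_J).clm_comp
        h.smooth_Γ)
  exact (((ContinuousLinearMap.compL ℝ E E E).contDiff.comp_contDiffOn h.smooth_J).clm_comp h1).neg

set_option synthInstance.maxHeartbeats 200000 in
theorem smooth_canonical (h : IsLocalNearlyKahler U g Γ J) :
    ContDiffOn ℝ ∞ (localCanonical Γ J) U :=
  h.smooth_Γ.add (h.smooth_T.const_smul _)

theorem J_skew (h : IsLocalNearlyKahler U g Γ J) (hz : z ∈ U) (v w : E) :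
    g z (J z v) w = -g z v (J z w) := by
  rw [← h.inner_map hz v, h.sq hz, map_neg, neg_neg]

/-- Covariant derivative of the identity g(Jv, w) = -g(v, Jw), as g is parallel. -/
theorem nablaJ_skew (h : IsLocalNearlyKahler U g Γ J) (hz : z ∈ U) (u v w : E) :
    g z (localNablaJ Γ J z u v) w = -g z v (localNablaJ Γ J z u w) := by
  have hg := hasFDerivAt_of_contDiffOn h.smooth_g h.isOpen hz
  have hJ := hasFDerivAt_of_contDiffOn h.smooth_J h.isOpen hz
  have h1 := fderiv_eq_of_eqOn h.isOpen (fun y hy ↦ h.J_skew hy v w) hz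
  rw [((hg.clm_apply (hJ.apply_const v)).apply_const w).fderiv,
    ((hg.apply_const v).clm_apply (hJ.apply_const w)).fun_neg.fderiv] at h1
  have h2 := congrArg (fun L : E →L[ℝ] ℝ ↦ L u) h1
  simp [h.metric hz] at h2
  simp only [localNablaJ_apply, map_add, map_sub, add_apply, sub_apply, h.J_skew hz (Γ z u v)]
  rw [h.J_skew hz v (Γ z u w)] at h2
  linarith

theorem nablaJ_J (h : IsLocalNearlyKahler U g Γ J) (hz : z ∈ U) (u v : E) :
    localNablaJ Γ J z u (J z v) = -J z (localNablaJ Γ J z u v) := by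
  have hJ := hasFDerivAt_of_contDiffOn h.smooth_J h.isOpen hz
  have h1 := fderiv_eq_of_eqOn h.isOpen (fun y hy ↦ h.sq hy v) hz
  rw [(hJ.clm_apply (hJ.apply_const v)).fderiv] at h1
  have h2 := congrArg (fun L : E →L[ℝ] E ↦ L u) h1
  simp at h2
  simp only [localNablaJ_apply, map_add, map_sub, h.sq hz, map_neg]
  rw [← sub_eq_zero, ← h2]
  abel

theorem nablaJ_swap (h : IsLocalNearlyKahler U g Γ J) (hz : z ∈ U) (u v : E) :
    localNablaJ Γ J z u v = -localNablaJ Γ J z v u := by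
  have h1 := h.nearly hz (u + v)
  simp only [map_add, add_apply, h.nearly hz, zero_add, add_zero] at h1
  rw [add_comm] at h1
  exact eq_neg_of_add_eq_zero_left h1

theorem T_swap (h : IsLocalNearlyKahler U g Γ J) (hz : z ∈ U) (u v : E) :
    localTorsion Γ J z u v = -localTorsion Γ J z v u := by
  rw [localTorsion_apply, h.nablaJ_swap hz, localTorsion_apply, map_neg]

theorem T_J (h : IsLocalNearlyKahler U g Γ J) (hz : z ∈ U) (u v : E) :
    localTorsion Γ J z u (J z v) = -J z (localTorsion Γ J z u v) := by
  rw [localTorsion_apply, h.nablaJ_J hz, localTorsion_apply, map_neg]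

theorem T_skew (h : IsLocalNearlyKahler U g Γ J) (hz : z ∈ U) (u v w : E) :
    g z (localTorsion Γ J z u v) w = -g z v (localTorsion Γ J z u w) := by
  rw [localTorsion_apply, localTorsion_apply, map_neg, map_neg, neg_apply, h.J_skew hz,
    h.nablaJ_skew hz, h.nablaJ_J hz, map_neg, neg_neg, neg_neg]

theorem canonical_metric (h : IsLocalNearlyKahler U g Γ J) (hz : z ∈ U) (u v w : E) :
    fderiv ℝ g z u v w = g z (localCanonical Γ J z u v) w + g z v (localCanonical Γ J z u w) := by
  simp only [localCanonical_apply, map_add, map_smul, add_apply, smul_apply,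
    h.metric hz, h.T_skew hz]
  simp
  ring

/-- J is parallel for ∇̄: one has ∇_u J = J T_u, and since T_u anticommutes with J the correction
½[T_u, J] = -J T_u cancels it. -/
theorem canonical_complex (h : IsLocalNearlyKahler U g Γ J) (hz : z ∈ U) (u v : E) :
    fderiv ℝ J z u v = J z (localCanonical Γ J z u v) - localCanonical Γ J z u (J z v) := by
  have h1 : fderiv ℝ J z u v = localNablaJ Γ J z u v - Γ z u (J z v) + J z (Γ z u v) := by
    rw [localNablaJ_apply]; abel
  have h2 : localNablaJ Γ J z u v = J z (localTorsion Γ J z u v) := by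
    rw [localTorsion_apply, map_neg, h.sq hz, neg_neg]
  rw [h1, h2, localCanonical_apply, localCanonical_apply, h.T_J hz, map_add, map_smul]
  module

/-- Together with `nablaT_skew` and `nablaT_J`: since ∇̄ preserves g and J, differentiating the
pointwise symmetries of T shows that ∇̄_u T has the same ones. -/
theorem nablaT_swap (h : IsLocalNearlyKahler U g Γ J) (hz : z ∈ U) (u v w : E) :
    localNablaT Γ J z u v w = -localNablaT Γ J z u w v := by
  have hT := hasFDerivAt_of_contDiffOn h.smooth_T h.isOpen hz
  have h1 := fderiv_eq_of_eqOn h.isOpen (fun y hy ↦ h.T_swap hy v w) hz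
  rw [((hT.apply_const v).apply_const w).fderiv,
    ((hT.apply_const w).apply_const v).fun_neg.fderiv] at h1
  have h2 : fderiv ℝ (localTorsion Γ J) z u v w = -fderiv ℝ (localTorsion Γ J) z u w v :=
    congrArg (fun L : E →L[ℝ] E ↦ L u) h1
  rw [localNablaT_apply, localNablaT_apply, h2, h.T_swap hz v w, h.T_swap hz _ w, h.T_swap hz v,
    map_neg]
  abel

theorem nablaT_skew (h : IsLocalNearlyKahler U g Γ J) (hz : z ∈ U) (u v w x : E) :
    g z (localNablaT Γ J z u v w) x = -g z w (localNablaT Γ J z u v x) := by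
  have hg := hasFDerivAt_of_contDiffOn h.smooth_g h.isOpen hz
  have hT := hasFDerivAt_of_contDiffOn h.smooth_T h.isOpen hz
  have h1 := fderiv_eq_of_eqOn h.isOpen (fun y hy ↦ h.T_skew hy v w x) hz
  rw [((hg.clm_apply ((hT.apply_const v).apply_const w)).apply_const x).fderiv,
    ((hg.apply_const w).clm_apply ((hT.apply_const v).apply_const x)).fun_neg.fderiv] at h1
  have h2 := congrArg (fun L : E →L[ℝ] ℝ ↦ L u) h1
  simp [h.canonical_metric hz] at h2
  simp only [localNablaT_apply, map_add, map_sub, add_apply, sub_apply]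
  linarith [h.T_skew hz v (localCanonical Γ J z u w) x,
    h.T_skew hz (localCanonical Γ J z u v) w x, h.T_skew hz v w (localCanonical Γ J z u x)]

theorem nablaT_J (h : IsLocalNearlyKahler U g Γ J) (hz : z ∈ U) (u v w : E) :
    localNablaT Γ J z u v (J z w) = -J z (localNablaT Γ J z u v w) := by
  have hJ := hasFDerivAt_of_contDiffOn h.smooth_J h.isOpen hz
  have hT := hasFDerivAt_of_contDiffOn h.smooth_T h.isOpen hz
  have h1 := fderiv_eq_of_eqOn h.isOpen (fun y hy ↦ h.T_J hy v w) hz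
  rw [((hT.apply_const v).clm_apply (hJ.apply_const w)).fderiv,
    (hJ.clm_apply ((hT.apply_const v).apply_const w)).fun_neg.fderiv] at h1
  have h2 := congrArg (fun L : E →L[ℝ] E ↦ L u) h1
  simp [h.canonical_complex hz] at h2
  simp only [localNablaT_apply, map_add, map_sub, h.T_J hz] at h2 ⊢
  rw [← sub_eq_zero] at h2 ⊢
  rw [← h2]
  simp only [map_neg]
  abel

set_option synthInstance.maxHeartbeats 200000 in
theorem fderiv_canonical (h : IsLocalNearlyKahler U g Γ J) (hz : z ∈ U) :
    fderiv ℝ (localCanonical Γ J) z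
      = fderiv ℝ Γ z + (1 / 2 : ℝ) • fderiv ℝ (localTorsion Γ J) z :=
  ((hasFDerivAt_of_contDiffOn h.smooth_Γ h.isOpen hz).add
    ((hasFDerivAt_of_contDiffOn h.smooth_T h.isOpen hz).const_smul (1 / 2 : ℝ))).fderiv

/-- The curvatures of the Levi-Civita and of the canonical connection. -/
theorem curvatureEnd_eq (h : IsLocalNearlyKahler U g Γ J) (hz : z ∈ U) (u v w : E) :
    curvatureEnd Γ z u v w = curvatureEnd (localCanonical Γ J) z u v w
      - (1 / 2 : ℝ) • (localNablaT Γ J z u v w - localNablaT Γ J z v u w)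
      - (1 / 2 : ℝ) • localTorsion Γ J z (localTorsion Γ J z u v) w
      + (1 / 4 : ℝ) • (localTorsion Γ J z u (localTorsion Γ J z v w)
        - localTorsion Γ J z v (localTorsion Γ J z u w)) := by
  simp only [curvatureEnd, localNablaT_apply, h.fderiv_canonical hz, add_apply, sub_apply,
    smul_apply, ContinuousLinearMap.comp_apply, localCanonical_apply, map_add, map_smul,
    h.torsion hz v u, h.T_swap hz v u, map_neg, neg_apply]
  module

variable [FiniteDimensional ℝ E]

theorem canonical_curvature_J (h : IsLocalNearlyKahler U g Γ J) (hz : z ∈ U) (u v w : E) :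
    curvatureEnd (localCanonical Γ J) z u v (J z w)
      = J z (curvatureEnd (localCanonical Γ J) z u v w) := by
  have h1 := curvatureEnd_of_parallel h.isOpen isBilinearMap_actEnd actEnd_comm h.smooth_canonical
    h.smooth_J (fun z hz u ↦ by ext v; simp [actEnd_apply, h.canonical_complex hz]) hz u v
  have h2 := congrArg (fun b : E →L[ℝ] E ↦ b w) h1
  simpa [actEnd_apply, sub_eq_zero] using h2

set_option synthInstance.maxHeartbeats 200000 in
/-- The torsion of the canonical connection is parallel. -/
theorem nablaT_eq_zero (h : IsLocalNearlyKahler U g Γ J) (hz : z ∈ U) (u : E) :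
    localNablaT Γ J z u = 0 := by
  ext v w
  refine h.eq_of_forall hz fun x ↦ ?_
  have T_J_left (u v : E) : localTorsion Γ J z (J z u) v = -J z (localTorsion Γ J z u v) := by
    rw [h.T_swap hz, h.T_J hz, h.T_swap hz v u, map_neg, neg_neg]
  have S_J_left (u v w : E) : localNablaT Γ J z u (J z v) w = -J z (localNablaT Γ J z u v w) := by
    rw [h.nablaT_swap hz, h.nablaT_J hz, h.nablaT_swap hz u w v, map_neg, neg_neg]
  -- The last hypothesis comes from `curvatureEnd_eq`. In R(u,v) - J⁻¹R(u,v)J the canonical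
  -- curvature and [T_u, T_v], which commute with J, cancel; ∇̄T and T_{T(u,v)}, which anticommute
  -- with J, are doubled.
  have key := (h.isCurvatureLike hz).nablaT_eq_zero (J := J z)
    (s := fun x u v w ↦ g z (localNablaT Γ J z x u v) w)
    (q := fun u v w x ↦ g z (localTorsion Γ J z u v) (localTorsion Γ J z w x))
    (fun u v w x ↦ by simp [h.sq hz, curvatureEnd]; ring)
    (fun x u v w ↦ by rw [h.nablaT_swap hz]; simp)
    (fun x u v w ↦ by rw [h.nablaT_skew hz, h.symm hz])
    (fun x u v w ↦ by rw [S_J_left, h.nablaT_J hz])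
    (fun x u v w ↦ by rw [h.sq hz]; simp)
    (fun u v w x ↦ by rw [T_J_left, h.T_J hz])
    (fun u v w x ↦ by rw [T_J_left, T_J_left, map_neg, neg_apply, h.J_skew hz, map_neg])
    (fun u v w x ↦ by rw [h.sq hz]; simp)
    (fun u v w x ↦ by
      have e (a b : E) : g z (J z a) (J z b) = g z a b := h.inner_map hz a b
      have e1 : g z (localTorsion Γ J z (localTorsion Γ J z u v) w) x
          = g z (localTorsion Γ J z u v) (localTorsion Γ J z w x) := by
        rw [h.T_swap hz, map_neg, neg_apply, h.T_skew hz, neg_neg]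
      simp only [h.curvatureEnd_eq hz, h.canonical_curvature_J hz, h.nablaT_J hz, h.T_J hz,
        map_add, map_sub, map_smul, map_neg, add_apply, sub_apply, smul_apply, neg_apply, e, e1,
        smul_eq_mul]
      ring)
  simpa using key u v w x

set_option synthInstance.maxHeartbeats 200000 in
-- T is parallel for ∇̄ by `nablaT_eq_zero`, so the curvature of ∇̄ annihilates it under the action
-- on bilinear maps; written out, this is the derivation property.
theorem canonical_curvature_T (h : IsLocalNearlyKahler U g Γ J) (hz : z ∈ U) (u v w x : E) :
    curvatureEnd (localCanonical Γ J) z u v (localTorsion Γ J z w x)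
      = localTorsion Γ J z (curvatureEnd (localCanonical Γ J) z u v w) x
        + localTorsion Γ J z w (curvatureEnd (localCanonical Γ J) z u v x) := by
  have h1 := curvatureEnd_of_parallel (X := E →L[ℝ] E →L[ℝ] E) h.isOpen isBilinearMap_actBilin
    actBilin_comm h.smooth_canonical h.smooth_T
    (fun z hz u ↦ eq_neg_of_add_eq_zero_left (h.nablaT_eq_zero hz u)) hz u v
  have h2 := congrArg (fun b : E →L[ℝ] E →L[ℝ] E ↦ b w x) h1
  simp only [actBilin_apply, zero_apply] at h2
  rw [← sub_eq_zero, ← h2]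
  abel

/-- The canonical curvature in terms of the Riemannian curvature. -/
theorem canonical_curvature_eq (h : IsLocalNearlyKahler U g Γ J) (hz : z ∈ U) (u v w : E) :
    curvatureEnd (localCanonical Γ J) z u v w = curvatureEnd Γ z u v w
      - (1 / 4 : ℝ) • (localTorsion Γ J z u (localTorsion Γ J z v w)
        - localTorsion Γ J z v (localTorsion Γ J z u w))
      + (1 / 2 : ℝ) • localTorsion Γ J z (localTorsion Γ J z u v) w := by
  rw [h.curvatureEnd_eq hz, h.nablaT_eq_zero hz, h.nablaT_eq_zero hz]
  simp

end IsLocalNearlyKahler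
end LocalNearlyKahler

/-! ### Isometric immersions in coordinates and the Gauss equation -/

section LocalImmersion

variable {E : Type*} [NormedAddCommGroup E] [NormedSpace ℝ E]
  {F : Type*} [NormedAddCommGroup F] [NormedSpace ℝ F]
  {U : Set E} {U' : Set F} {z : E}
  {g : E → E →L[ℝ] E →L[ℝ] ℝ} {Γ : E → E →L[ℝ] E →L[ℝ] E}
  {k : F → F →L[ℝ] F →L[ℝ] ℝ} {Λ : F → F →L[ℝ] F →L[ℝ] F} {f : E → F}

/-- The derivative along `f` of `df(v)` in the direction `u`, for the connection `d + Λ`. -/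
def localHessian (Λ : F → F →L[ℝ] F →L[ℝ] F) (f : E → F) (z u v : E) : F :=
  fderiv ℝ (fderiv ℝ f) z u v + Λ (f z) (fderiv ℝ f z u) (fderiv ℝ f z v)

/-- The second fundamental form of `f`. -/
def localSecondForm (Γ : E → E →L[ℝ] E →L[ℝ] E) (Λ : F → F →L[ℝ] F →L[ℝ] F) (f : E → F)
    (z u v : E) : F :=
  localHessian Λ f z u v - fderiv ℝ f z (Γ z u v)

/-- `f` is an isometric immersion of `(U, g)` into `(U', k)`. -/
structure IsLocalIsometricImmersion (U : Set E) (g : E → E →L[ℝ] E →L[ℝ] ℝ)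
    (Γ : E → E →L[ℝ] E →L[ℝ] E) (U' : Set F) (k : F → F →L[ℝ] F →L[ℝ] ℝ)
    (Λ : F → F →L[ℝ] F →L[ℝ] F) (f : E → F) : Prop where
  source : IsLocalLeviCivita U g Γ
  target : IsLocalLeviCivita U' k Λ
  smooth : ContDiffOn ℝ ∞ f U
  mapsTo {z : E} (hz : z ∈ U) : f z ∈ U'
  isometric {z : E} (hz : z ∈ U) (u v : E) : k (f z) (fderiv ℝ f z u) (fderiv ℝ f z v) = g z u v

namespace IsLocalIsometricImmersion

theorem hessian_symm (h : IsLocalIsometricImmersion U g Γ U' k Λ f) (hz : z ∈ U) (u v : E) :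
    localHessian Λ f z u v = localHessian Λ f z v u := by
  rw [localHessian, fderiv_fderiv_comm h.smooth h.source.isOpen hz,
    h.target.torsion (h.mapsTo hz), localHessian]

theorem secondForm_symm (h : IsLocalIsometricImmersion U g Γ U' k Λ f) (hz : z ∈ U) (u v : E) :
    localSecondForm Γ Λ f z u v = localSecondForm Γ Λ f z v u := by
  rw [localSecondForm, h.hessian_symm hz, h.source.torsion hz, localSecondForm]

theorem hasFDerivAt_f (h : IsLocalIsometricImmersion U g Γ U' k Λ f) (hz : z ∈ U) :
    HasFDerivAt f (fderiv ℝ f z) z :=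
  hasFDerivAt_of_contDiffOn h.smooth h.source.isOpen hz

theorem hasFDerivAt_fderiv (h : IsLocalIsometricImmersion U g Γ U' k Λ f) (hz : z ∈ U) :
    HasFDerivAt (fderiv ℝ f) (fderiv ℝ (fderiv ℝ f) z) z :=
  hasFDerivAt_of_contDiffOn (contDiffOn_fderiv h.smooth h.source.isOpen) h.source.isOpen hz

theorem hasFDerivAt_comp (h : IsLocalIsometricImmersion U g Γ U' k Λ f) (hz : z ∈ U)
    {X : Type*} [NormedAddCommGroup X] [NormedSpace ℝ X] {A : F → X} (hA : ContDiffOn ℝ ∞ A U') :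
    HasFDerivAt (fun y ↦ A (f y)) (fderiv ℝ A (f z) ∘L fderiv ℝ f z) z :=
  (hasFDerivAt_of_contDiffOn hA h.target.isOpen (h.mapsTo hz)).comp z (h.hasFDerivAt_f hz)

/-- The metric along `f` is compatible with the covariant derivative along `f`. -/
theorem fderiv_metric (h : IsLocalIsometricImmersion U g Γ U' k Λ f) (hz : z ∈ U) {a b : E → F}
    {a' b' : E →L[ℝ] F} (ha : HasFDerivAt a a' z) (hb : HasFDerivAt b b' z) (u : E) :
    fderiv ℝ (fun y ↦ k (f y) (a y) (b y)) z u
      = k (f z) (a' u + Λ (f z) (fderiv ℝ f z u) (a z)) (b z)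
        + k (f z) (a z) (b' u + Λ (f z) (fderiv ℝ f z u) (b z)) := by
  have hk := h.hasFDerivAt_comp hz h.target.smooth_g
  rw [((hk.clm_apply ha).clm_apply hb).fderiv]
  simp [h.target.metric (h.mapsTo hz)]
  ring

/-- Uniqueness of the Levi-Civita connection: the tangential part of the ambient derivative is
torsion-free and metric. The difference d is symmetric in its first two arguments and skew in its
last two, hence zero. -/
theorem inner_hessian (h : IsLocalIsometricImmersion U g Γ U' k Λ f) (hz : z ∈ U) (u v w : E) :
    k (f z) (localHessian Λ f z u v) (fderiv ℝ f z w) = g z (Γ z u v) w := by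
  set d : E → E → E → ℝ := fun u v w ↦
    k (f z) (localHessian Λ f z u v) (fderiv ℝ f z w) - g z (Γ z u v) w with hd
  have d_symm (u v w : E) : d u v w = d v u w := by
    simp only [hd, h.hessian_symm hz u v, h.source.torsion hz u v]
  have d_skew (u v w : E) : d u v w = -d u w v := by
    have hf := h.hasFDerivAt_fderiv hz
    have hg := hasFDerivAt_of_contDiffOn h.source.smooth_g h.source.isOpen hz
    have h1 := fderiv_eq_of_eqOn h.source.isOpen (fun y hy ↦ h.isometric hy v w) hz
    have h2 := congrArg (fun L : E →L[ℝ] ℝ ↦ L u) h1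
    simp only [h.fderiv_metric hz (hf.apply_const v) (hf.apply_const w),
      ((hg.apply_const v).apply_const w).fderiv] at h2
    simp [h.source.metric hz] at h2
    simp only [hd, localHessian, map_add, add_apply]
    rw [h.target.symm (h.mapsTo hz) (fderiv ℝ f z v), h.target.symm (h.mapsTo hz) (fderiv ℝ f z v),
      h.source.symm hz v] at h2
    linarith
  have h0 : d u v w = 0 := by
    linarith [d_symm u v w, d_skew v u w, d_symm v w u, d_skew w v u, d_symm w u v, d_skew u w v]
  exact sub_eq_zero.1 h0

/-- The second fundamental form is normal. -/
theorem inner_secondForm (h : IsLocalIsometricImmersion U g Γ U' k Λ f) (hz : z ∈ U) (u v w : E) :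
    k (f z) (localSecondForm Γ Λ f z u v) (fderiv ℝ f z w) = 0 := by
  rw [localSecondForm, map_sub, sub_apply, h.inner_hessian hz, h.isometric hz, sub_self]

theorem inner_hessian_hessian (h : IsLocalIsometricImmersion U g Γ U' k Λ f) (hz : z ∈ U)
    (u v w x : E) :
    k (f z) (localHessian Λ f z u v) (localHessian Λ f z w x)
      = g z (Γ z u v) (Γ z w x)
        + k (f z) (localSecondForm Γ Λ f z u v) (localSecondForm Γ Λ f z w x) := by
  have e (u v : E) : localHessian Λ f z u v
      = fderiv ℝ f z (Γ z u v) + localSecondForm Γ Λ f z u v := by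
    rw [localSecondForm]; abel
  rw [e, e]
  simp only [map_add, add_apply, h.isometric hz, h.inner_secondForm hz]
  rw [h.target.symm (h.mapsTo hz), h.inner_secondForm hz]
  ring

/-- The Gauss equation. -/
theorem gauss (h : IsLocalIsometricImmersion U g Γ U' k Λ f) (hz : z ∈ U) (u v w x : E) :
    g z (curvatureEnd Γ z u v w) x =
      k (f z) (curvatureEnd Λ (f z) (fderiv ℝ f z u) (fderiv ℝ f z v) (fderiv ℝ f z w))
        (fderiv ℝ f z x)
      + k (f z) (localSecondForm Γ Λ f z u x) (localSecondForm Γ Λ f z v w)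
      - k (f z) (localSecondForm Γ Λ f z u w) (localSecondForm Γ Λ f z v x) := by
  have hf1 := h.hasFDerivAt_fderiv hz
  have hsf := contDiffOn_fderiv h.smooth h.source.isOpen
  have hf2 := hasFDerivAt_of_contDiffOn (contDiffOn_fderiv hsf h.source.isOpen) h.source.isOpen hz
  have hΛ := h.hasFDerivAt_comp hz h.target.smooth_Γ
  have hg := hasFDerivAt_of_contDiffOn h.source.smooth_g h.source.isOpen hz
  have hΓ := hasFDerivAt_of_contDiffOn h.source.smooth_Γ h.source.isOpen hz
  have hK (v w : E) := ((hf2.apply_const v).apply_const w).fun_add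
    ((hΛ.clm_apply (hf1.apply_const v)).clm_apply (hf1.apply_const w))
  set D3 : E → E → E → F := fun u v w ↦ fderiv ℝ (fderiv ℝ (fderiv ℝ f)) z u v w with hD3
  -- The derivative of `inner_hessian` in direction u. The product of two Hessians that appears
  -- splits into a tangential part, which is absorbed by the connection terms of g, and the product
  -- of second fundamental forms. Exchanging u and v then removes the third derivatives of f and
  -- leaves the Gauss equation.
  have key (u v w x : E) : k (f z) (D3 u v w
        + fderiv ℝ Λ (f z) (fderiv ℝ f z u) (fderiv ℝ f z v) (fderiv ℝ f z w)
        + Λ (f z) (fderiv ℝ (fderiv ℝ f) z u v) (fderiv ℝ f z w)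
        + Λ (f z) (fderiv ℝ f z v) (fderiv ℝ (fderiv ℝ f) z u w)
        + Λ (f z) (fderiv ℝ f z u) (fderiv ℝ (fderiv ℝ f) z v w)
        + Λ (f z) (fderiv ℝ f z u) (Λ (f z) (fderiv ℝ f z v) (fderiv ℝ f z w))) (fderiv ℝ f z x)
      = g z (fderiv ℝ Γ z u v w) x + g z (Γ z u (Γ z v w)) x
        - k (f z) (localSecondForm Γ Λ f z v w) (localSecondForm Γ Λ f z u x) := by
    have h1 := fderiv_eq_of_eqOn h.source.isOpen (fun y hy ↦ h.inner_hessian hy v w x) hz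
    have h2 := congrArg (fun L : E →L[ℝ] ℝ ↦ L u) h1
    simp only [localHessian, h.fderiv_metric hz (hK v w) (hf1.apply_const x),
      ((hg.clm_apply ((hΓ.apply_const v).apply_const w)).apply_const x).fderiv] at h2
    have h3 := h.inner_hessian_hessian hz v w u x
    simp [h.source.metric hz, localHessian] at h2 h3
    simp only [hD3, map_add, add_apply]
    linarith
  have k1 := key u v w x
  have k2 := key v u w x
  have hD : D3 u v w = D3 v u w := by
    simp only [hD3, fderiv_fderiv_comm hsf h.source.isOpen hz u v]
  rw [hD, fderiv_fderiv_comm h.smooth h.source.isOpen hz u v] at k1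
  rw [h.target.symm (h.mapsTo hz) (localSecondForm Γ Λ f z u x)]
  simp only [curvatureEnd, map_add, map_sub, add_apply, sub_apply,
    ContinuousLinearMap.comp_apply] at k1 k2 ⊢
  linarith

end IsLocalIsometricImmersion

set_option synthInstance.maxHeartbeats 200000 in
/-- Constant sectional curvature determines the curvature tensor. -/
theorem IsLocalLeviCivita.curvature_eq_of_constant [FiniteDimensional ℝ E]
    (h : IsLocalLeviCivita U g Γ) (hz : z ∈ U) {c : ℝ}
    (hc : ∀ u v, g z (curvatureEnd Γ z u v v) u = c * (g z u u * g z v v - g z u v ^ 2))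
    (u v w x : E) :
    g z (curvatureEnd Γ z u v w) x = c * (g z v w * g z u x - g z u w * g z v x) := by
  have hK := h.isCurvatureLike hz
  have hK' : IsCurvatureLike fun u v w x ↦ g z (curvatureEnd Γ z u v w) x
      - c * (g z v w * g z u x - g z u w * g z v x) := by
    refine ⟨fun u v w x ↦ ?_, fun u v w x ↦ ?_, fun u v w x ↦ ?_⟩
    · linarith [hK.swap u v w x]
    · linarith [hK.skew u v w x]
    · rw [h.symm hz w u, h.symm hz v u, h.symm hz w v]
      linarith [hK.bianchi u v w x]
  -- The difference from the model tensor is curvature-like with zero sectional curvatures.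
  refine sub_eq_zero.1 (hK'.eq_zero (fun u u' v w x ↦ ?_) (fun u v ↦ ?_) u v w x)
  · simp [curvatureEnd]; ring
  · rw [hc, h.symm hz v u]; ring

end LocalImmersion

/-! ### Existence of a smooth Levi-Civita connection on an open set -/

section LocalExistence

variable {E : Type*} [NormedAddCommGroup E] [NormedSpace ℝ E] [FiniteDimensional ℝ E]
  {U : Set E} {g : E → E →L[ℝ] E →L[ℝ] ℝ}

/-- The continuous bilinear map associated with a bilinear map on a finite-dimensional space. -/
def bilinOfFun {X : Type*} [NormedAddCommGroup X] [NormedSpace ℝ X] (B : E → E → X)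
    (hB : IsBilinearMap ℝ B) : E →L[ℝ] E →L[ℝ] X :=
  hB.toContinuousBilinearMap

theorem contDiffOn_bilin {X : Type*} [NormedAddCommGroup X] [NormedSpace ℝ X]
    {B : E → E →L[ℝ] E →L[ℝ] X} (h : ∀ u v, ContDiffOn ℝ ∞ (fun z ↦ B z u v) U) :
    ContDiffOn ℝ ∞ B U :=
  contDiffOn_clm_apply.2 fun u ↦ contDiffOn_clm_apply.2 fun v ↦ h u v

/-- A positive definite form is an isomorphism onto the dual. -/
theorem isInvertible_of_pos {b : E →L[ℝ] E →L[ℝ] ℝ} (hb : ∀ u, u ≠ 0 → 0 < b u u) :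
    b.IsInvertible := by
  have hinj : Function.Injective (b : E →ₗ[ℝ] E →L[ℝ] ℝ) := by
    rw [← LinearMap.ker_eq_bot, LinearMap.ker_eq_bot']
    intro u hu
    by_contra hne
    have h1 : b u = 0 := hu
    have h2 := hb u hne
    rw [h1] at h2
    simp at h2
  have hfr : Module.finrank ℝ E = Module.finrank ℝ (E →L[ℝ] ℝ) := by
    rw [LinearEquiv.finrank_eq (LinearMap.toContinuousLinearMap (𝕜 := ℝ) (E := E) (F' := ℝ)).symm]
    exact Subspace.dual_finrank_eq.symm
  exact ⟨(LinearEquiv.ofInjectiveOfFinrankEq _ hinj hfr).toContinuousLinearEquiv, by ext; rfl⟩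

/-- The Koszul formula for the derivative `D` of a metric. -/
def localKoszul (D : E →L[ℝ] E →L[ℝ] E →L[ℝ] ℝ) (u v : E) : E →L[ℝ] ℝ :=
  (1 / 2 : ℝ) • (D u v + D v u - (D.flip u).flip v)

theorem isBilinearMap_symmetrize {X : Type*} [NormedAddCommGroup X] [NormedSpace ℝ X]
    (D D' : E →L[ℝ] E →L[ℝ] X) (a : ℝ) :
    IsBilinearMap ℝ fun u v ↦ a • (D u v + D v u - D' u v) where
  add_left _ _ _ := by simp only [map_add, add_apply]; module
  smul_left _ _ _ := by simp only [map_smul, smul_apply]; module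
  add_right _ _ _ := by simp only [map_add, add_apply]; module
  smul_right _ _ _ := by simp only [map_smul, smul_apply]; module

set_option synthInstance.maxHeartbeats 200000 in
theorem isBilinearMap_localKoszul (D : E →L[ℝ] E →L[ℝ] E →L[ℝ] ℝ) :
    IsBilinearMap ℝ (localKoszul D) :=
  isBilinearMap_symmetrize (X := E →L[ℝ] ℝ) D
    ((ContinuousLinearMap.flipₗᵢ ℝ E E ℝ).toContinuousLinearEquiv.toContinuousLinearMap ∘L D.flip)
    (1 / 2)

theorem _root_.IsBilinearMap.comp_linear {X Y : Type*} [AddCommGroup X] [Module ℝ X]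
    [AddCommGroup Y] [Module ℝ Y] {B : E → E → X} (hB : IsBilinearMap ℝ B) (L : X →ₗ[ℝ] Y) :
    IsBilinearMap ℝ fun u v ↦ L (B u v) where
  add_left _ _ _ := by simp [hB.add_left]
  smul_left _ _ _ := by simp [hB.smul_left]
  add_right _ _ _ := by simp [hB.add_right]
  smul_right _ _ _ := by simp [hB.smul_right]

set_option synthInstance.maxHeartbeats 200000 in
/-- Existence of the Levi-Civita connection of a metric on an open set. -/
theorem exists_isLocalLeviCivita (hU : IsOpen U) (hg : ContDiffOn ℝ ∞ g U)
    (hsymm : ∀ z ∈ U, ∀ u v, g z u v = g z v u) (hpos : ∀ z ∈ U, ∀ u, u ≠ 0 → 0 < g z u u) :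
    ∃ Γ, IsLocalLeviCivita U g Γ := by
  set κ : E → E → E → E →L[ℝ] ℝ := fun z ↦ localKoszul (fderiv ℝ g z) with hκ
  have κ_apply (z u v w : E) : κ z u v w
      = 1 / 2 * (fderiv ℝ g z u v w + fderiv ℝ g z v u w - fderiv ℝ g z w u v) := rfl
  have hinv (z : E) (hz : z ∈ U) : (g z).IsInvertible := isInvertible_of_pos (hpos z hz)
  -- Bilinearity holds at every z, even outside U: `inverse` is a continuous linear map there too,
  -- with value 0 where g is not invertible.
  have hbil (z : E) : IsBilinearMap ℝ fun u v ↦ (g z).inverse (κ z u v) :=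
    (isBilinearMap_localKoszul (fderiv ℝ g z)).comp_linear (g z).inverse.toLinearMap
  have hright {z : E} (hz : z ∈ U) (φ : E →L[ℝ] ℝ) : g z ((g z).inverse φ) = φ :=
    (hinv z hz).self_apply_inverse φ
  have hdsymm {z : E} (hz : z ∈ U) (u v w : E) : fderiv ℝ g z u v w = fderiv ℝ g z u w v := by
    have hd := hasFDerivAt_of_contDiffOn hg hU hz
    have h1 := fderiv_eq_of_eqOn hU (fun y hy ↦ hsymm y hy v w) hz
    rw [((hd.apply_const v).apply_const w).fderiv, ((hd.apply_const w).apply_const v).fderiv] at h1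
    exact congrArg (fun L : E →L[ℝ] ℝ ↦ L u) h1
  refine ⟨fun z ↦ bilinOfFun _ (hbil z), hU, hg, ?_, fun hz ↦ hsymm _ hz, fun hz ↦ hpos _ hz _,
    fun {z} hz u v ↦ ?_, fun {z} hz u v w ↦ ?_⟩
  · refine contDiffOn_bilin fun u v ↦ ?_
    change ContDiffOn ℝ ∞ (fun z ↦ (g z).inverse (κ z u v)) U
    have h1 : ContDiffOn ℝ ∞ (fun z ↦ κ z u v) U := by
      have hd := contDiffOn_fderiv hg hU
      refine contDiffOn_clm_apply.2 fun w ↦ ?_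
      simp only [κ_apply]
      have e (u v w : E) : ContDiffOn ℝ ∞ (fun z ↦ fderiv ℝ g z u v w) U :=
        ((hd.clm_apply contDiffOn_const).clm_apply contDiffOn_const).clm_apply contDiffOn_const
      exact contDiffOn_const.mul (((e u v w).add (e v u w)).sub (e w u v))
    refine ContDiffOn.clm_apply (fun z hz ↦ ?_) h1
    obtain ⟨e, he⟩ := hinv z hz
    have h2 := contDiffAt_map_inverse (n := ∞) e
    rw [he] at h2
    exact h2.comp_contDiffWithinAt z (hg z hz)
  · change (g z).inverse (κ z u v) = (g z).inverse (κ z v u)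
    congr 1
    ext w
    rw [κ_apply, κ_apply, hdsymm hz w u v]
    ring
  · change fderiv ℝ g z u v w = g z ((g z).inverse (κ z u v)) w + g z v ((g z).inverse (κ z u w))
    rw [hsymm z hz v, hright hz, hright hz, κ_apply, κ_apply, hdsymm hz u w v, hdsymm hz v u w,
      hdsymm hz w u v]
    ring

end LocalExistence

/-! ### Coordinate frames, vector fields and Lie brackets in a chart -/

section Chart

variable {E : Type*} [NormedAddCommGroup E] [NormedSpace ℝ E]
  {M : Type*} [TopologicalSpace M] [ChartedSpace E M]

theorem eventually_mem_target {x₀ : M} {z : E} (hz : z ∈ (extChartAt 𝓘(ℝ, E) x₀).target) :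
    ∀ᶠ y in nhds z, y ∈ (extChartAt 𝓘(ℝ, E) x₀).target :=
  (isOpen_extChartAt_target x₀).mem_nhds hz

variable [IsManifold 𝓘(ℝ, E) ∞ M]

/-- The coordinate frame of the preferred chart at `x₀`, at the point with coordinates `z`. -/
def chartFrame (x₀ : M) (z : E) :
    E →L[ℝ] TangentSpace 𝓘(ℝ, E) ((extChartAt 𝓘(ℝ, E) x₀).symm z) :=
  (trivializationAt E (TangentSpace 𝓘(ℝ, E)) x₀).symmL ℝ ((extChartAt 𝓘(ℝ, E) x₀).symm z)

/-- The components of a tangent vector in the coordinate frame of the preferred chart at `x₀`. -/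
def chartCoord (x₀ : M) (z : E) :
    TangentSpace 𝓘(ℝ, E) ((extChartAt 𝓘(ℝ, E) x₀).symm z) →L[ℝ] E :=
  (trivializationAt E (TangentSpace 𝓘(ℝ, E)) x₀).continuousLinearMapAt ℝ
    ((extChartAt 𝓘(ℝ, E) x₀).symm z)

/-- The coordinate vector field in direction `u` of the preferred chart at `x₀`. -/
def chartField (x₀ : M) (u : E) (y : M) : TangentSpace 𝓘(ℝ, E) y :=
  (trivializationAt E (TangentSpace 𝓘(ℝ, E)) x₀).symmL ℝ y u

/-- The vector field `Y` in the coordinates of the preferred chart at `x₀`. -/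
def chartRep (x₀ : M) (Y : Π y : M, TangentSpace 𝓘(ℝ, E) y) (z : E) : E :=
  chartCoord x₀ z (Y ((extChartAt 𝓘(ℝ, E) x₀).symm z))

variable {x₀ : M} {z : E}

theorem mem_baseSet_of_mem_target (hz : z ∈ (extChartAt 𝓘(ℝ, E) x₀).target) :
    (extChartAt 𝓘(ℝ, E) x₀).symm z ∈
      (trivializationAt E (TangentSpace 𝓘(ℝ, E)) x₀).baseSet := by
  rw [TangentBundle.trivializationAt_baseSet, ← extChartAt_source 𝓘(ℝ, E)]
  exact (extChartAt 𝓘(ℝ, E) x₀).map_target hz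

theorem chartFrame_chartCoord (hz : z ∈ (extChartAt 𝓘(ℝ, E) x₀).target)
    (v : TangentSpace 𝓘(ℝ, E) ((extChartAt 𝓘(ℝ, E) x₀).symm z)) :
    chartFrame x₀ z (chartCoord x₀ z v) = v :=
  Trivialization.symmL_continuousLinearMapAt _ (mem_baseSet_of_mem_target hz) v

theorem chartCoord_chartFrame (hz : z ∈ (extChartAt 𝓘(ℝ, E) x₀).target) (u : E) :
    chartCoord x₀ z (chartFrame x₀ z u) = u :=
  Trivialization.continuousLinearMapAt_symmL _ (mem_baseSet_of_mem_target hz) u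

theorem chartFrame_chartRep (hz : z ∈ (extChartAt 𝓘(ℝ, E) x₀).target)
    (Y : Π y : M, TangentSpace 𝓘(ℝ, E) y) :
    chartFrame x₀ z (chartRep x₀ Y z) = Y ((extChartAt 𝓘(ℝ, E) x₀).symm z) :=
  chartFrame_chartCoord hz _

theorem chartRep_chartField (hz : z ∈ (extChartAt 𝓘(ℝ, E) x₀).target) (u : E) :
    chartRep x₀ (chartField x₀ u) z = u :=
  chartCoord_chartFrame hz u

theorem chartRep_eq (hz : z ∈ (extChartAt 𝓘(ℝ, E) x₀).target)
    (Y : Π y : M, TangentSpace 𝓘(ℝ, E) y) :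
    chartRep x₀ Y z = (trivializationAt E (TangentSpace 𝓘(ℝ, E)) x₀
      ⟨(extChartAt 𝓘(ℝ, E) x₀).symm z, Y ((extChartAt 𝓘(ℝ, E) x₀).symm z)⟩).2 := by
  rw [chartRep, chartCoord, Trivialization.continuousLinearMapAt_apply_of_mem]
  exact mem_baseSet_of_mem_target hz

theorem contMDiffAt_chart_symm (hz : z ∈ (extChartAt 𝓘(ℝ, E) x₀).target) :
    ContMDiffAt 𝓘(ℝ, E) 𝓘(ℝ, E) ∞ (extChartAt 𝓘(ℝ, E) x₀).symm z :=
  (contMDiffOn_extChartAt_symm x₀).contMDiffAt ((isOpen_extChartAt_target x₀).mem_nhds hz)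

theorem mdiff_chart_symm (hz : z ∈ (extChartAt 𝓘(ℝ, E) x₀).target) :
    MDifferentiableAt 𝓘(ℝ, E) 𝓘(ℝ, E) (extChartAt 𝓘(ℝ, E) x₀).symm z :=
  (contMDiffAt_chart_symm hz).mdifferentiableAt (by simp)

/-- The frame defined by the trivialization is the differential of the inverse chart, so derivatives
along the frame become ordinary partial derivatives. -/
theorem mfderiv_chart_symm (hz : z ∈ (extChartAt 𝓘(ℝ, E) x₀).target) :
    mfderiv 𝓘(ℝ, E) 𝓘(ℝ, E) (extChartAt 𝓘(ℝ, E) x₀).symm z = chartFrame x₀ z := by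
  have : IsManifold 𝓘(ℝ, E) 1 M := .of_le (n := ∞) (by simp)
  have h := TangentBundle.symmL_trivializationAt (I := 𝓘(ℝ, E)) (x₀ := x₀)
    (x := (extChartAt 𝓘(ℝ, E) x₀).symm z)
    (by rw [← extChartAt_source 𝓘(ℝ, E)]; exact (extChartAt 𝓘(ℝ, E) x₀).map_target hz)
  rw [(extChartAt 𝓘(ℝ, E) x₀).right_inv hz] at h
  rw [chartFrame, h]
  simp only [modelWithCornersSelf_coe, Set.range_id, mfderivWithin_univ]

theorem contMDiffOn_chartField (u : E) :
    ContMDiffOn 𝓘(ℝ, E) 𝓘(ℝ, E).tangent ∞ (T% (chartField x₀ u))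
      (trivializationAt E (TangentSpace 𝓘(ℝ, E)) x₀).baseSet := by
  rw [Trivialization.contMDiffOn_section_iff (trivializationAt E (TangentSpace 𝓘(ℝ, E)) x₀)
    (trivializationAt E (TangentSpace 𝓘(ℝ, E)) x₀).open_baseSet subset_rfl]
  refine contMDiffOn_const (c := u) |>.congr fun y hy ↦ ?_
  rw [chartField, Trivialization.symmL_apply _ hy, Trivialization.apply_mk_symm _ hy]

theorem mdiff_chartField (hz : z ∈ (extChartAt 𝓘(ℝ, E) x₀).target) (u : E) :
    MDiffAt (T% (chartField x₀ u)) ((extChartAt 𝓘(ℝ, E) x₀).symm z) :=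
  ((contMDiffOn_chartField u).contMDiffAt
    ((trivializationAt E (TangentSpace 𝓘(ℝ, E)) x₀).open_baseSet.mem_nhds
      (mem_baseSet_of_mem_target hz))).mdifferentiableAt (by simp)

/-- The derivative of a function on `M` in a coordinate direction. -/
theorem mvfderiv_chartFrame {X : Type*} [NormedAddCommGroup X] [NormedSpace ℝ X] {h : M → X}
    (hz : z ∈ (extChartAt 𝓘(ℝ, E) x₀).target)
    (hh : MDifferentiableAt 𝓘(ℝ, E) 𝓘(ℝ, X) h ((extChartAt 𝓘(ℝ, E) x₀).symm z)) (u : E) :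
    d% h ((extChartAt 𝓘(ℝ, E) x₀).symm z) (chartFrame x₀ z u) =
      fderiv ℝ (h ∘ (extChartAt 𝓘(ℝ, E) x₀).symm) z u := by
  rw [← mfderiv_chart_symm hz, ← mfderiv_eq_fderiv, mfderiv_comp z hh (mdiff_chart_symm hz)]
  rfl

theorem differentiableAt_comp_chart_symm {X : Type*} [NormedAddCommGroup X] [NormedSpace ℝ X]
    {h : M → X} (hz : z ∈ (extChartAt 𝓘(ℝ, E) x₀).target)
    (hh : MDifferentiableAt 𝓘(ℝ, E) 𝓘(ℝ, X) h ((extChartAt 𝓘(ℝ, E) x₀).symm z)) :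
    DifferentiableAt ℝ (h ∘ (extChartAt 𝓘(ℝ, E) x₀).symm) z :=
  (hh.comp z (mdiff_chart_symm hz)).differentiableAt

theorem differentiableAt_chartRep (hz : z ∈ (extChartAt 𝓘(ℝ, E) x₀).target)
    {Y : Π y : M, TangentSpace 𝓘(ℝ, E) y}
    (hY : MDiffAt (T% Y) ((extChartAt 𝓘(ℝ, E) x₀).symm z)) :
    DifferentiableAt ℝ (chartRep x₀ Y) z := by
  have h1 := differentiableAt_comp_chart_symm hz ((Trivialization.mdifferentiableAt_section_iff
    𝓘(ℝ, E) (trivializationAt E (TangentSpace 𝓘(ℝ, E)) x₀) Y (mem_baseSet_of_mem_target hz)).1 hY)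
  refine h1.congr_of_eventuallyEq ?_
  filter_upwards [eventually_mem_target hz] with y hy using chartRep_eq hy Y

/-- The Lie bracket in coordinates. -/
theorem mlieBracket_chart [CompleteSpace E] (hz : z ∈ (extChartAt 𝓘(ℝ, E) x₀).target)
    {V W : Π y : M, TangentSpace 𝓘(ℝ, E) y}
    (hV : MDiffAt (T% V) ((extChartAt 𝓘(ℝ, E) x₀).symm z))
    (hW : MDiffAt (T% W) ((extChartAt 𝓘(ℝ, E) x₀).symm z)) :
    mlieBracket 𝓘(ℝ, E) V W ((extChartAt 𝓘(ℝ, E) x₀).symm z) =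
      chartFrame x₀ z (fderiv ℝ (chartRep x₀ W) z (chartRep x₀ V z)
        - fderiv ℝ (chartRep x₀ V) z (chartRep x₀ W z)) := by
  have h2 : minSmoothness ℝ 2 ≤ (∞ : ℕ∞ω) := by
    rw [minSmoothness_of_isRCLikeNormedField]
    exact WithTop.coe_le_coe.2 (le_top : (2 : ℕ∞) ≤ ⊤)
  have : IsManifold 𝓘(ℝ, E) (minSmoothness ℝ 2) M := .of_le (n := ∞) h2
  have hpull {y : E} (hy : y ∈ (extChartAt 𝓘(ℝ, E) x₀).target)
      (Y : Π y : M, TangentSpace 𝓘(ℝ, E) y) :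
      mpullback 𝓘(ℝ, E) 𝓘(ℝ, E) (extChartAt 𝓘(ℝ, E) x₀).symm Y y = chartRep x₀ Y y := by
    have hinv : (chartFrame x₀ y).IsInvertible :=
      ⟨ContinuousLinearEquiv.equivOfInverse _ _ (chartCoord_chartFrame hy)
        (chartFrame_chartCoord hy), by ext; rfl⟩
    rw [mpullback_apply, mfderiv_chart_symm hy, ← chartFrame_chartRep hy Y]
    exact hinv.inverse_apply_self _
  have h := mpullback_mlieBracket (I := 𝓘(ℝ, E)) (I' := 𝓘(ℝ, E)) (n := ∞) hV hW
    (contMDiffAt_chart_symm hz) h2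
  rw [hpull hz] at h
  rw [← chartFrame_chartRep hz (mlieBracket 𝓘(ℝ, E) V W), h]
  congr 1
  have e (Y : Π y : M, TangentSpace 𝓘(ℝ, E) y) :
      mpullback 𝓘(ℝ, E) 𝓘(ℝ, E) (extChartAt 𝓘(ℝ, E) x₀).symm Y =ᶠ[nhds z] chartRep x₀ Y := by
    filter_upwards [eventually_mem_target hz] with y hy using hpull hy Y
  have hb (A B : Π y : E, TangentSpace 𝓘(ℝ, E) y) :
      mlieBracket 𝓘(ℝ, E) A B z = lieBracket ℝ A B z := by
    rw [← mlieBracketWithin_univ, mlieBracketWithin_eq_lieBracketWithin]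
    exact congrFun (lieBracketWithin_univ (𝕜 := ℝ) (V := fun y ↦ (A y : E)) (W := fun y ↦ (B y : E))) z
  exact ((e V).mlieBracket_vectorField_eq (e W)).trans (hb _ _)

theorem fderiv_chartRep_chartField (hz : z ∈ (extChartAt 𝓘(ℝ, E) x₀).target) (u : E) :
    fderiv ℝ (chartRep x₀ (chartField x₀ u)) z = 0 := by
  have h : chartRep x₀ (chartField x₀ u) =ᶠ[nhds z] fun _ ↦ u := by
    filter_upwards [eventually_mem_target hz] with y hy using chartRep_chartField hy u
  rw [h.fderiv_eq, fderiv_const_apply]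

end Chart

/-! ### The metric and the Levi-Civita connection in a chart -/

section ChartMetric

variable {E : Type*} [NormedAddCommGroup E] [NormedSpace ℝ E] [FiniteDimensional ℝ E]
  {M : Type*} [TopologicalSpace M] [ChartedSpace E M]
  [RiemannianBundle (fun x : M ↦ TangentSpace 𝓘(ℝ, E) x)] [IsManifold 𝓘(ℝ, E) ∞ M]

/-- The metric in the coordinates of the preferred chart at `x₀`. -/
def chartMetric (x₀ : M) (z : E) : E →L[ℝ] E →L[ℝ] ℝ :=
  bilinOfFun (fun u v ↦ inner ℝ (chartFrame x₀ z u) (chartFrame x₀ z v))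
    { add_left _ _ _ := by simp only [map_add, inner_add_left]
      smul_left _ _ _ := by simp only [map_smul, real_inner_smul_left, smul_eq_mul]
      add_right _ _ _ := by simp only [map_add, inner_add_right]
      smul_right _ _ _ := by simp only [map_smul, real_inner_smul_right, smul_eq_mul] }

variable {x₀ : M} {z : E}

theorem chartMetric_apply (u v : E) :
    chartMetric x₀ z u v = inner ℝ (chartFrame x₀ z u) (chartFrame x₀ z v) := rfl

theorem chartMetric_chartRep (hz : z ∈ (extChartAt 𝓘(ℝ, E) x₀).target)
    (V W : Π y : M, TangentSpace 𝓘(ℝ, E) y) :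
    chartMetric x₀ z (chartRep x₀ V z) (chartRep x₀ W z) =
      inner ℝ (V ((extChartAt 𝓘(ℝ, E) x₀).symm z)) (W ((extChartAt 𝓘(ℝ, E) x₀).symm z)) := by
  rw [chartMetric_apply, chartFrame_chartRep hz, chartFrame_chartRep hz]

theorem chartMetric_symm (u v : E) : chartMetric x₀ z u v = chartMetric x₀ z v u :=
  real_inner_comm (chartFrame x₀ z v) (chartFrame x₀ z u)

theorem chartMetric_pos (hz : z ∈ (extChartAt 𝓘(ℝ, E) x₀).target) {u : E} (hu : u ≠ 0) :
    0 < chartMetric x₀ z u u := by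
  rw [chartMetric_apply]
  refine real_inner_self_pos.2 fun h ↦ hu ?_
  rw [← chartCoord_chartFrame hz u, h, map_zero]

variable [CompleteSpace E]
  [IsContMDiffRiemannianBundle 𝓘(ℝ, E) ∞ E (fun x : M ↦ TangentSpace 𝓘(ℝ, E) x)]

theorem contDiffOn_chartMetric :
    ContDiffOn ℝ ∞ (chartMetric x₀) (extChartAt 𝓘(ℝ, E) x₀).target := by
  refine contDiffOn_bilin fun u v ↦ contMDiffOn_iff_contDiffOn.1 ?_
  have h := ContMDiffOn.inner_bundle (IB := 𝓘(ℝ, E)) (F := E)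
    (E := fun x : M ↦ TangentSpace 𝓘(ℝ, E) x) (b := id) (contMDiffOn_chartField (x₀ := x₀) u)
    (contMDiffOn_chartField (x₀ := x₀) v)
  exact h.comp (contMDiffOn_extChartAt_symm x₀) fun _ ↦ mem_baseSet_of_mem_target

variable (x₀) in
theorem exists_isLocalLeviCivita_chartMetric :
    ∃ Γ, IsLocalLeviCivita (extChartAt 𝓘(ℝ, E) x₀).target (chartMetric x₀) Γ :=
  exists_isLocalLeviCivita (isOpen_extChartAt_target x₀) contDiffOn_chartMetric
    (fun _ _ ↦ chartMetric_symm) fun _ hz _ ↦ chartMetric_pos hz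

variable {U : Set E} {Γ : E → E →L[ℝ] E →L[ℝ] E}

theorem mvfderiv_inner_chart (hz : z ∈ (extChartAt 𝓘(ℝ, E) x₀).target)
    {V W : Π y : M, TangentSpace 𝓘(ℝ, E) y}
    (hV : MDiffAt (T% V) ((extChartAt 𝓘(ℝ, E) x₀).symm z))
    (hW : MDiffAt (T% W) ((extChartAt 𝓘(ℝ, E) x₀).symm z)) (u : E) :
    d% (fun y ↦ inner ℝ (V y) (W y)) ((extChartAt 𝓘(ℝ, E) x₀).symm z) (chartFrame x₀ z u) =
      fderiv ℝ (chartMetric x₀) z u (chartRep x₀ V z) (chartRep x₀ W z)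
      + chartMetric x₀ z (fderiv ℝ (chartRep x₀ V) z u) (chartRep x₀ W z)
      + chartMetric x₀ z (chartRep x₀ V z) (fderiv ℝ (chartRep x₀ W) z u) := by
  rw [mvfderiv_chartFrame hz (mdiff_inner hV hW)]
  have h1 : (fun y ↦ inner ℝ (V y) (W y)) ∘ (extChartAt 𝓘(ℝ, E) x₀).symm =ᶠ[nhds z]
      fun y ↦ chartMetric x₀ y (chartRep x₀ V y) (chartRep x₀ W y) := by
    filter_upwards [eventually_mem_target hz] with y hy using (chartMetric_chartRep hy V W).symm
  have hg := hasFDerivAt_of_contDiffOn (contDiffOn_chartMetric (x₀ := x₀))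
    (isOpen_extChartAt_target x₀) hz
  rw [h1.fderiv_eq, ((hg.clm_apply (differentiableAt_chartRep hz hV).hasFDerivAt).clm_apply
    (differentiableAt_chartRep hz hW).hasFDerivAt).fderiv]
  simp
  ring

/-- The Levi-Civita connection in coordinates. -/
theorem leviCivita_chart (hΓ : IsLocalLeviCivita U (chartMetric x₀) Γ) (hzU : z ∈ U)
    (hz : z ∈ (extChartAt 𝓘(ℝ, E) x₀).target) {Y : Π y : M, TangentSpace 𝓘(ℝ, E) y}
    (hY : MDiffAt (T% Y) ((extChartAt 𝓘(ℝ, E) x₀).symm z)) (u : E) :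
    leviCivita Y ((extChartAt 𝓘(ℝ, E) x₀).symm z) (chartFrame x₀ z u) =
      chartFrame x₀ z (fderiv ℝ (chartRep x₀ Y) z u + Γ z u (chartRep x₀ Y z)) := by
  refine ext_inner_right ℝ fun w' ↦ ?_
  obtain ⟨w, rfl⟩ : ∃ w, chartFrame x₀ z w = w' := ⟨_, chartFrame_chartCoord hz w'⟩
  -- The test fields have constant coordinates, so only derivatives of Y and of the metric survive
  -- in the Koszul formula. The latter are then rewritten through Γ.
  have hu := mdiff_chartField hz u
  have hw := mdiff_chartField hz w
  have h := inner_leviCivitaFun hu hY hw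
  rw [koszul, mlieBracket_chart hz hu hY, mlieBracket_chart hz hY hw, mlieBracket_chart hz hw hu]
    at h
  have e (u : E) : chartField x₀ u ((extChartAt 𝓘(ℝ, E) x₀).symm z) = chartFrame x₀ z u := rfl
  simp only [e, mvfderiv_inner_chart hz hY hw, mvfderiv_inner_chart hz hu hY,
    chartRep_chartField hz, fderiv_chartRep_chartField hz] at h
  have hY' := mvfderiv_inner_chart hz hw hu (chartRep x₀ Y z)
  rw [chartFrame_chartRep hz, chartRep_chartField hz, chartRep_chartField hz,
    fderiv_chartRep_chartField hz, fderiv_chartRep_chartField hz] at hY'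
  rw [hY', ← chartFrame_chartRep hz Y] at h
  simp only [← chartMetric_apply, zero_apply, sub_zero, zero_sub, map_zero, map_neg] at h
  refine Eq.trans h ?_
  rw [← chartMetric_apply]
  set y := chartRep x₀ Y z
  set D := fderiv ℝ (chartRep x₀ Y) z
  rw [map_add, add_apply]
  have m1 := hΓ.metric hzU u y w
  have m2 := hΓ.metric hzU y w u
  have m3 := hΓ.metric hzU w u y
  have s (a b : E) : chartMetric x₀ z a b = chartMetric x₀ z b a := chartMetric_symm a b
  rw [hΓ.torsion hzU y u, s w] at m2
  rw [hΓ.torsion hzU w u, hΓ.torsion hzU w y, s u] at m3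
  rw [s y] at m1
  rw [inner_neg_left, inner_zero_left, ← chartMetric_apply, s u (D w)]
  linarith

end ChartMetric

/-! ### The nearly Kähler structure and its torsion in a chart -/

section ChartNearlyKahler

variable {E : Type*} [NormedAddCommGroup E] [NormedSpace ℝ E]
  {M : Type*} [TopologicalSpace M] [ChartedSpace E M] [IsManifold 𝓘(ℝ, E) ∞ M]
  {J : Π x : M, TangentSpace 𝓘(ℝ, E) x →L[ℝ] TangentSpace 𝓘(ℝ, E) x} {x₀ : M} {z : E}

/-- A field of endomorphisms in the coordinates of the preferred chart at `x₀`. -/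
def chartEnd (J : Π x : M, TangentSpace 𝓘(ℝ, E) x →L[ℝ] TangentSpace 𝓘(ℝ, E) x) (x₀ : M) (z : E) :
    E →L[ℝ] E :=
  chartCoord x₀ z ∘L J ((extChartAt 𝓘(ℝ, E) x₀).symm z) ∘L chartFrame x₀ z

theorem chartFrame_chartEnd (hz : z ∈ (extChartAt 𝓘(ℝ, E) x₀).target) (u : E) :
    chartFrame x₀ z (chartEnd J x₀ z u) =
      J ((extChartAt 𝓘(ℝ, E) x₀).symm z) (chartFrame x₀ z u) :=
  chartFrame_chartCoord hz _

theorem chartRep_chartEnd (u z : E) :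
    chartRep x₀ (fun y ↦ J y (chartField x₀ u y)) z = chartEnd J x₀ z u := rfl

theorem chartFrame_injective (hz : z ∈ (extChartAt 𝓘(ℝ, E) x₀).target) :
    Function.Injective (chartFrame x₀ z) :=
  Function.LeftInverse.injective (chartCoord_chartFrame hz)

theorem contDiffOn_chartRep {Y : Π y : M, TangentSpace 𝓘(ℝ, E) y}
    (hY : ContMDiffOn 𝓘(ℝ, E) 𝓘(ℝ, E).tangent ∞ (T% Y)
      (trivializationAt E (TangentSpace 𝓘(ℝ, E)) x₀).baseSet) :
    ContDiffOn ℝ ∞ (chartRep x₀ Y) (extChartAt 𝓘(ℝ, E) x₀).target := by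
  rw [Trivialization.contMDiffOn_section_iff (trivializationAt E (TangentSpace 𝓘(ℝ, E)) x₀)
    (trivializationAt E (TangentSpace 𝓘(ℝ, E)) x₀).open_baseSet subset_rfl] at hY
  refine contMDiffOn_iff_contDiffOn.1 ?_
  refine (hY.comp (contMDiffOn_extChartAt_symm x₀) fun _ ↦ mem_baseSet_of_mem_target).congr ?_
  exact fun y hy ↦ chartRep_eq hy Y

variable [FiniteDimensional ℝ E] [CompleteSpace E]
  [RiemannianBundle (fun x : M ↦ TangentSpace 𝓘(ℝ, E) x)]
  [IsContMDiffRiemannianBundle 𝓘(ℝ, E) ∞ E (fun x : M ↦ TangentSpace 𝓘(ℝ, E) x)]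
  {U : Set E} {Γ : E → E →L[ℝ] E →L[ℝ] E}

theorem contDiffOn_chartEnd (hJ : IsAlmostHermitian J) :
    ContDiffOn ℝ ∞ (chartEnd J x₀) (extChartAt 𝓘(ℝ, E) x₀).target := by
  refine contDiffOn_clm_apply.2 fun u ↦
    contDiffOn_chartRep (Y := fun y ↦ J y (chartField x₀ u y)) ?_
  exact ContMDiffOn.clm_bundle_apply (F₁ := E) (F₂ := E)
    (E₁ := fun x : M ↦ TangentSpace 𝓘(ℝ, E) x) (E₂ := fun x : M ↦ TangentSpace 𝓘(ℝ, E) x)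
    hJ.smooth.contMDiffOn (contMDiffOn_chartField u)

theorem leviCivita_chartField (hΓ : IsLocalLeviCivita U (chartMetric x₀) Γ) (hzU : z ∈ U)
    (hz : z ∈ (extChartAt 𝓘(ℝ, E) x₀).target) (u v : E) :
    leviCivita (chartField x₀ v) ((extChartAt 𝓘(ℝ, E) x₀).symm z) (chartFrame x₀ z u) =
      chartFrame x₀ z (Γ z u v) := by
  rw [leviCivita_chart hΓ hzU hz (mdiff_chartField hz v), fderiv_chartRep_chartField hz,
    chartRep_chartField hz, zero_apply, zero_add]

/-- The tensor `∇J` in coordinates. -/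
theorem nablaJ_chart (hJ : IsAlmostHermitian J) (hΓ : IsLocalLeviCivita U (chartMetric x₀) Γ)
    (hzU : z ∈ U) (hz : z ∈ (extChartAt 𝓘(ℝ, E) x₀).target) (u v : E) :
    nablaJ hJ ((extChartAt 𝓘(ℝ, E) x₀).symm z) (chartFrame x₀ z v) (chartFrame x₀ z u) =
      chartFrame x₀ z (localNablaJ Γ (chartEnd J x₀) z u v) := by
  have h := nablaJ_apply hJ (mdiff_chartField hz v) (chartFrame x₀ z u)
  rw [leviCivita_chart hΓ hzU hz (hJ.mdiff (mdiff_chartField hz v)),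
    leviCivita_chartField hΓ hzU hz, ← chartFrame_chartEnd hz, ← map_sub] at h
  refine h.trans ?_
  rw [localNablaJ_apply, chartRep_chartEnd]
  have hd := hasFDerivAt_of_contDiffOn (contDiffOn_chartEnd (x₀ := x₀) hJ)
    (isOpen_extChartAt_target x₀) hz
  have he : fderiv ℝ (chartRep x₀ fun y ↦ J y (chartField x₀ v y)) z u =
      fderiv ℝ (chartEnd J x₀) z u v := fderiv_apply_const hd.differentiableAt v u
  rw [he]

theorem isLocalNearlyKahler_chart {hJ : IsAlmostHermitian J} (hM : IsNearlyKahler hJ)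
    (hΓ : IsLocalLeviCivita U (chartMetric x₀) Γ) (hU : U ⊆ (extChartAt 𝓘(ℝ, E) x₀).target) :
    IsLocalNearlyKahler U (chartMetric x₀) Γ (chartEnd J x₀) where
  toIsLocalLeviCivita := hΓ
  smooth_J := (contDiffOn_chartEnd hJ).mono hU
  sq hz v := chartFrame_injective (hU hz) <| by
    rw [chartFrame_chartEnd (hU hz), chartFrame_chartEnd (hU hz), hJ.sq, map_neg]
  inner_map hz v w := by
    rw [chartMetric_apply, chartFrame_chartEnd (hU hz), chartFrame_chartEnd (hU hz), hJ.inner_map,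
      chartMetric_apply]
  nearly hz v := chartFrame_injective (hU hz) <| by
    rw [← nablaJ_chart hJ hΓ hz (hU hz), hM, map_zero]

/-- The torsion of the canonical connection in coordinates. -/
theorem hermitianTorsion_chart {hJ : IsAlmostHermitian J} (hM : IsNearlyKahler hJ)
    (hΓ : IsLocalLeviCivita U (chartMetric x₀) Γ) (hU : U ⊆ (extChartAt 𝓘(ℝ, E) x₀).target)
    (hz : z ∈ U) (u v : E) :
    hermitianTorsion hJ ((extChartAt 𝓘(ℝ, E) x₀).symm z) (chartFrame x₀ z u) (chartFrame x₀ z v) =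
      chartFrame x₀ z (localTorsion Γ (chartEnd J x₀) z u v) := by
  have hu := mdiff_chartField (hU hz) u
  have hv := mdiff_chartField (hU hz) v
  have h := (canonicalConnection hJ).torsion_apply hu hv
  rw [mlieBracket_chart (hU hz) hu hv, fderiv_chartRep_chartField (hU hz),
    fderiv_chartRep_chartField (hU hz)] at h
  have e (u v : E) : canonicalConnection hJ (chartField x₀ v)
      ((extChartAt 𝓘(ℝ, E) x₀).symm z) (chartFrame x₀ z u) = chartFrame x₀ z (Γ z u v
        - (1 / 2 : ℝ) • chartEnd J x₀ z (localNablaJ Γ (chartEnd J x₀) z u v)) := by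
    change leviCivita (chartField x₀ v) ((extChartAt 𝓘(ℝ, E) x₀).symm z) (chartFrame x₀ z u)
      + (-(1 / 2 : ℝ)) • J ((extChartAt 𝓘(ℝ, E) x₀).symm z)
        (nablaJ hJ ((extChartAt 𝓘(ℝ, E) x₀).symm z) (chartFrame x₀ z v) (chartFrame x₀ z u)) = _
    rw [leviCivita_chartField hΓ hz (hU hz), nablaJ_chart hJ hΓ hz (hU hz),
      ← chartFrame_chartEnd (hU hz), neg_smul, ← sub_eq_add_neg, map_sub, map_smul]
  have hNK := isLocalNearlyKahler_chart hM hΓ hU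
  refine Eq.trans h ?_
  change canonicalConnection hJ (chartField x₀ v)
      ((extChartAt 𝓘(ℝ, E) x₀).symm z) (chartFrame x₀ z u) - canonicalConnection hJ (chartField x₀ u)
      ((extChartAt 𝓘(ℝ, E) x₀).symm z) (chartFrame x₀ z v) - _ = _
  rw [e, e, ← map_sub, zero_apply, zero_apply, sub_self, map_zero, sub_zero, localTorsion_apply,
    hNK.nablaJ_swap hz v u, hΓ.torsion hz v u]
  congr 1
  rw [map_neg]
  module

end ChartNearlyKahler

/-! ### Curvature in a chart and evaluation at the base point -/

section ChartCurvature

variable {E : Type*} [NormedAddCommGroup E] [NormedSpace ℝ E]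
  {M : Type*} [TopologicalSpace M] [ChartedSpace E M] [IsManifold 𝓘(ℝ, E) ∞ M]
  {x₀ : M} {z : E}

theorem mdiff_of_comp_chart_symm {X : Type*} [NormedAddCommGroup X] [NormedSpace ℝ X] {h : M → X}
    (hz : z ∈ (extChartAt 𝓘(ℝ, E) x₀).target)
    (hh : DifferentiableAt ℝ (h ∘ (extChartAt 𝓘(ℝ, E) x₀).symm) z) :
    MDifferentiableAt 𝓘(ℝ, E) 𝓘(ℝ, X) h ((extChartAt 𝓘(ℝ, E) x₀).symm z) := by
  have : IsManifold 𝓘(ℝ, E) 1 M := .of_le (n := ∞) (by simp)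
  have hs := (extChartAt 𝓘(ℝ, E) x₀).map_target hz
  have h1 : MDifferentiableAt 𝓘(ℝ, E) 𝓘(ℝ, E) (extChartAt 𝓘(ℝ, E) x₀)
      ((extChartAt 𝓘(ℝ, E) x₀).symm z) :=
    mdifferentiableAt_extChartAt (by rwa [extChartAt_source] at hs)
  have h2 : MDifferentiableAt 𝓘(ℝ, E) 𝓘(ℝ, X) (h ∘ (extChartAt 𝓘(ℝ, E) x₀).symm)
      (extChartAt 𝓘(ℝ, E) x₀ ((extChartAt 𝓘(ℝ, E) x₀).symm z)) := by
    rw [(extChartAt 𝓘(ℝ, E) x₀).right_inv hz]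
    exact hh.mdifferentiableAt
  refine (h2.comp _ h1).congr_of_eventuallyEq ?_
  filter_upwards [(isOpen_extChartAt_source (I := 𝓘(ℝ, E)) x₀).mem_nhds hs] with y hy
  simp only [Function.comp_apply, (extChartAt 𝓘(ℝ, E) x₀).left_inv hy]

theorem mdiff_of_chartRep (hz : z ∈ (extChartAt 𝓘(ℝ, E) x₀).target)
    {Y : Π y : M, TangentSpace 𝓘(ℝ, E) y} (hY : DifferentiableAt ℝ (chartRep x₀ Y) z) :
    MDiffAt (T% Y) ((extChartAt 𝓘(ℝ, E) x₀).symm z) := by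
  refine (Trivialization.mdifferentiableAt_section_iff 𝓘(ℝ, E)
    (trivializationAt E (TangentSpace 𝓘(ℝ, E)) x₀) Y (mem_baseSet_of_mem_target hz)).2
    (mdiff_of_comp_chart_symm hz (hY.congr_of_eventuallyEq ?_))
  filter_upwards [eventually_mem_target hz] with y hy using (chartRep_eq hy Y).symm

/-- The coordinate frame of the preferred chart at `x`, at `x` itself. -/
def baseFrame (x : M) : E ≃L[ℝ] TangentSpace 𝓘(ℝ, E) x :=
  ((trivializationAt E (TangentSpace 𝓘(ℝ, E)) x).continuousLinearEquivAt ℝ x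
    (FiberBundle.mem_baseSet_trivializationAt' x)).symm

theorem baseFrame_apply (x : M) (u : E) :
    baseFrame (E := E) x u = (trivializationAt E (TangentSpace 𝓘(ℝ, E)) x).symmL ℝ x u := by
  rw [Trivialization.symmL_apply _ (FiberBundle.mem_baseSet_trivializationAt' x)]
  rfl

theorem coe_baseFrame (x : M) : (baseFrame (E := E) x).toContinuousLinearMap =
    (trivializationAt E (TangentSpace 𝓘(ℝ, E)) x).symmL ℝ x :=
  ContinuousLinearMap.ext (baseFrame_apply x)

/-- The point obtained from its coordinates equals y only propositionally, so the tangent spaces are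
different types. Quantifying over a predicate of the point and the frame allows the transport by
substitution. -/
theorem chartFrame_congr {p : ∀ y : M, (E →L[ℝ] TangentSpace 𝓘(ℝ, E) y) → Prop}
    (h : p ((extChartAt 𝓘(ℝ, E) x₀).symm z) (chartFrame x₀ z)) {y : M}
    (hy : (extChartAt 𝓘(ℝ, E) x₀).symm z = y) :
    p y ((trivializationAt E (TangentSpace 𝓘(ℝ, E)) x₀).symmL ℝ y) := by
  subst hy
  exact h

/-- Statements about the coordinate frame of the chart at `x` hold for the frame at `x` itself. -/
theorem chartFrame_base {x : M} {p : ∀ y : M, (E →L[ℝ] TangentSpace 𝓘(ℝ, E) y) → Prop}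
    (h : p ((extChartAt 𝓘(ℝ, E) x).symm (extChartAt 𝓘(ℝ, E) x x))
      (chartFrame x (extChartAt 𝓘(ℝ, E) x x))) :
    p x (baseFrame (E := E) x).toContinuousLinearMap := by
  rw [coe_baseFrame]
  exact chartFrame_congr h (extChartAt_to_inv x)

/-- The extensions entering the second fundamental form have constant coordinates near x, so their
coordinate derivatives vanish. -/
theorem extend_eq_chartField {x : M} (w : TangentSpace 𝓘(ℝ, E) x) {y : M}
    (hy : y ∈ (trivializationAt E (TangentSpace 𝓘(ℝ, E)) x).baseSet) :
    FiberBundle.extend E w y = chartField x ((baseFrame x).symm w) y := by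
  rw [chartField, Trivialization.symmL_apply _ hy]
  rfl

variable [FiniteDimensional ℝ E] [CompleteSpace E]
  [RiemannianBundle (fun x : M ↦ TangentSpace 𝓘(ℝ, E) x)]
  [IsContMDiffRiemannianBundle 𝓘(ℝ, E) ∞ E (fun x : M ↦ TangentSpace 𝓘(ℝ, E) x)]
  {U : Set E} {Γ : E → E →L[ℝ] E →L[ℝ] E}

/-- The curvature in coordinates. -/
theorem curvature_chart (hΓ : IsLocalLeviCivita U (chartMetric x₀) Γ)
    (hU : U ⊆ (extChartAt 𝓘(ℝ, E) x₀).target) (hz : z ∈ U) (u v w : E) :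
    curvature (chartField x₀ u) (chartField x₀ v) (chartField x₀ w)
      ((extChartAt 𝓘(ℝ, E) x₀).symm z) = chartFrame x₀ z (curvatureEnd Γ z u v w) := by
  have hd := hasFDerivAt_of_contDiffOn hΓ.smooth_Γ hΓ.isOpen hz
  have hrep (a b : E) : (chartRep x₀ fun y ↦ leviCivita (chartField x₀ b) y (chartField x₀ a y))
      =ᶠ[nhds z] fun z ↦ Γ z a b := by
    filter_upwards [hΓ.isOpen.mem_nhds hz] with y hy
    refine chartFrame_injective (hU hy) ?_
    rw [chartFrame_chartRep (hU hy), ← leviCivita_chartField hΓ hy (hU hy)]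
    rfl
  have hda (a b : E) : HasFDerivAt (fun z ↦ Γ z a b) _ z := (hd.apply_const a).apply_const b
  have hW (a b t : E) :
      leviCivita (fun y ↦ leviCivita (chartField x₀ b) y (chartField x₀ a y))
        ((extChartAt 𝓘(ℝ, E) x₀).symm z) (chartFrame x₀ z t) =
      chartFrame x₀ z (fderiv ℝ Γ z t a b + Γ z t (Γ z a b)) := by
    rw [leviCivita_chart hΓ hz (hU hz) (mdiff_of_chartRep (hU hz)
      ((hda a b).differentiableAt.congr_of_eventuallyEq (hrep a b))), (hrep a b).fderiv_eq,
      (hrep a b).eq_of_nhds, (hda a b).fderiv]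
    rfl
  -- Coordinate fields commute, so the bracket term of the curvature disappears.
  have hb : mlieBracket 𝓘(ℝ, E) (chartField x₀ u) (chartField x₀ v)
      ((extChartAt 𝓘(ℝ, E) x₀).symm z) = 0 := by
    rw [mlieBracket_chart (hU hz) (mdiff_chartField (hU hz) u) (mdiff_chartField (hU hz) v),
      fderiv_chartRep_chartField (hU hz), fderiv_chartRep_chartField (hU hz)]
    simp only [zero_apply, sub_self]
    exact map_zero _
  rw [curvature, hb, map_zero, sub_zero]
  refine (congrArg₂ (· - ·) (hW v w u) (hW u w v)).trans ?_
  rw [← map_sub]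
  congr 1
  simp only [curvatureEnd, add_apply, sub_apply, ContinuousLinearMap.comp_apply]
  abel

theorem curvature_chart_of_constant {c : ℝ} (hc : HasConstantSectionalCurvature E M c)
    (hΓ : IsLocalLeviCivita U (chartMetric x₀) Γ) (hU : U ⊆ (extChartAt 𝓘(ℝ, E) x₀).target)
    (hz : z ∈ U) (u v : E) : chartMetric x₀ z (curvatureEnd Γ z u v v) u =
      c * (chartMetric x₀ z u u * chartMetric x₀ z v v - chartMetric x₀ z u v ^ 2) := by
  have hs (u : E) : ∃ V ∈ nhds ((extChartAt 𝓘(ℝ, E) x₀).symm z), CMDiff[V] ∞ (T% (chartField x₀ u)) :=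
    ⟨_, (trivializationAt E (TangentSpace 𝓘(ℝ, E)) x₀).open_baseSet.mem_nhds
      (mem_baseSet_of_mem_target (hU hz)), contMDiffOn_chartField u⟩
  have h := hc _ _ _ (hs u) (hs v)
  rw [curvature_chart hΓ hU hz] at h
  exact h

end ChartCurvature

/-! ### The immersion and its second fundamental form in charts -/

section ChartImmersion

variable {E : Type*} [NormedAddCommGroup E] [NormedSpace ℝ E]
  {M : Type*} [TopologicalSpace M] [ChartedSpace E M]
  {F : Type*} [NormedAddCommGroup F] [NormedSpace ℝ F]
  {Q : Type*} [TopologicalSpace Q] [ChartedSpace F Q]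

/-- The coordinate expression of `f` in the preferred charts at `x` and `f x`. -/
def chartMap (E F : Type*) [NormedAddCommGroup E] [NormedSpace ℝ E] [NormedAddCommGroup F]
    [NormedSpace ℝ F] [ChartedSpace E M] [ChartedSpace F Q] (f : M → Q) (x : M) (z : E) : F :=
  extChartAt 𝓘(ℝ, F) (f x) (f ((extChartAt 𝓘(ℝ, E) x).symm z))

/-- The domain of the coordinate expression of `f` in the preferred charts at `x` and `f x`. -/
def chartDomain (E F : Type*) [NormedAddCommGroup E] [NormedSpace ℝ E] [NormedAddCommGroup F]
    [NormedSpace ℝ F] [ChartedSpace E M] [ChartedSpace F Q] (f : M → Q) (x : M) : Set E :=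
  (extChartAt 𝓘(ℝ, E) x).target ∩
    (f ∘ (extChartAt 𝓘(ℝ, E) x).symm) ⁻¹' (extChartAt 𝓘(ℝ, F) (f x)).source

variable {f : M → Q} {x : M} {z : E}

theorem chartDomain_subset : chartDomain E F f x ⊆ (extChartAt 𝓘(ℝ, E) x).target :=
  Set.inter_subset_left

theorem mapsTo_chartMap (hz : z ∈ chartDomain E F f x) :
    chartMap E F f x z ∈ (extChartAt 𝓘(ℝ, F) (f x)).target :=
  (extChartAt 𝓘(ℝ, F) (f x)).map_source hz.2

theorem symm_chartMap (hz : z ∈ chartDomain E F f x) :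
    (extChartAt 𝓘(ℝ, F) (f x)).symm (chartMap E F f x z) = f ((extChartAt 𝓘(ℝ, E) x).symm z) :=
  (extChartAt 𝓘(ℝ, F) (f x)).left_inv hz.2

theorem mem_chartDomain : extChartAt 𝓘(ℝ, E) x x ∈ chartDomain E F f x := by
  refine ⟨mem_extChartAt_target x, ?_⟩
  simp only [Set.mem_preimage, Function.comp_apply, extChartAt_to_inv]
  exact mem_extChartAt_source (f x)

theorem chartMap_base : chartMap E F f x (extChartAt 𝓘(ℝ, E) x x) =
    extChartAt 𝓘(ℝ, F) (f x) (f x) := by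
  rw [chartMap, extChartAt_to_inv]

variable [IsManifold 𝓘(ℝ, E) ∞ M] [IsManifold 𝓘(ℝ, F) ∞ Q]

theorem isOpen_chartDomain (hf : ContMDiff 𝓘(ℝ, E) 𝓘(ℝ, F) ∞ f) : IsOpen (chartDomain E F f x) :=
  (hf.continuous.comp_continuousOn (continuousOn_extChartAt_symm x)).isOpen_inter_preimage
    (isOpen_extChartAt_target x) (isOpen_extChartAt_source (f x))

theorem contDiffOn_chartMap (hf : ContMDiff 𝓘(ℝ, E) 𝓘(ℝ, F) ∞ f) :
    ContDiffOn ℝ ∞ (chartMap E F f x) (chartDomain E F f x) := by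
  refine contMDiffOn_iff_contDiffOn.1 ?_
  have h1 : ContMDiffOn 𝓘(ℝ, F) 𝓘(ℝ, F) ∞ (extChartAt 𝓘(ℝ, F) (f x))
      (extChartAt 𝓘(ℝ, F) (f x)).source := by
    rw [extChartAt_source]
    exact contMDiffOn_extChartAt
  exact h1.comp (hf.comp_contMDiffOn ((contMDiffOn_extChartAt_symm x).mono chartDomain_subset))
    fun _ hz ↦ hz.2

theorem mem_baseSet_of_mem_chartDomain (hz : z ∈ chartDomain E F f x) :
    f ((extChartAt 𝓘(ℝ, E) x).symm z) ∈
      (trivializationAt F (TangentSpace 𝓘(ℝ, F)) (f x)).baseSet := by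
  rw [TangentBundle.trivializationAt_baseSet, ← extChartAt_source 𝓘(ℝ, F)]
  exact hz.2

/-- The differential of `f` in coordinates. -/
theorem coord_mfderiv_chart (hf : ContMDiff 𝓘(ℝ, E) 𝓘(ℝ, F) ∞ f)
    (hz : z ∈ chartDomain E F f x) (u : E) :
    (trivializationAt F (TangentSpace 𝓘(ℝ, F)) (f x)).continuousLinearMapAt ℝ
      (f ((extChartAt 𝓘(ℝ, E) x).symm z))
      (mfderiv 𝓘(ℝ, E) 𝓘(ℝ, F) f ((extChartAt 𝓘(ℝ, E) x).symm z) (chartFrame x z u)) =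
      fderiv ℝ (chartMap E F f x) z u := by
  have : IsManifold 𝓘(ℝ, F) 1 Q := .of_le (n := ∞) (by simp)
  have hs : f ((extChartAt 𝓘(ℝ, E) x).symm z) ∈ (chartAt F (f x)).source := by
    rw [← extChartAt_source 𝓘(ℝ, F)]
    exact hz.2
  have hd := mdiff_chart_symm (chartDomain_subset hz)
  have hfd := hf.mdifferentiableAt (x := (extChartAt 𝓘(ℝ, E) x).symm z) (by simp)
  rw [TangentBundle.continuousLinearMapAt_trivializationAt hs,
    ← mfderiv_chart_symm (chartDomain_subset hz), ← mfderiv_eq_fderiv]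
  have h1 := mfderiv_comp z (mdifferentiableAt_extChartAt (I := 𝓘(ℝ, F)) hs) (hfd.comp z hd)
  rw [mfderiv_comp z hfd hd] at h1
  exact (congrArg (fun L : E →L[ℝ] F ↦ L u) h1).symm

theorem mfderiv_chart (hf : ContMDiff 𝓘(ℝ, E) 𝓘(ℝ, F) ∞ f)
    (hz : z ∈ chartDomain E F f x) (u : E) :
    mfderiv 𝓘(ℝ, E) 𝓘(ℝ, F) f ((extChartAt 𝓘(ℝ, E) x).symm z) (chartFrame x z u) =
      (trivializationAt F (TangentSpace 𝓘(ℝ, F)) (f x)).symmL ℝ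
        (f ((extChartAt 𝓘(ℝ, E) x).symm z)) (fderiv ℝ (chartMap E F f x) z u) := by
  rw [← coord_mfderiv_chart hf hz]
  exact (Trivialization.symmL_continuousLinearMapAt _ (mem_baseSet_of_mem_chartDomain hz) _).symm

theorem mfderiv_base (hf : ContMDiff 𝓘(ℝ, E) 𝓘(ℝ, F) ∞ f) (u : E) :
    mfderiv 𝓘(ℝ, E) 𝓘(ℝ, F) f x (baseFrame (E := E) x u) = baseFrame (E := F) (f x)
      (fderiv ℝ (chartMap E F f x) (extChartAt 𝓘(ℝ, E) x x) u) := by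
  rw [baseFrame_apply (f x)]
  exact chartFrame_base (p := fun y L ↦ mfderiv 𝓘(ℝ, E) 𝓘(ℝ, F) f y (L u) =
    (trivializationAt F (TangentSpace 𝓘(ℝ, F)) (f x)).symmL ℝ (f y)
      (fderiv ℝ (chartMap E F f x) (extChartAt 𝓘(ℝ, E) x x) u)) (mfderiv_chart hf mem_chartDomain u)

variable [FiniteDimensional ℝ E] [CompleteSpace E]
  [RiemannianBundle (fun x : M ↦ TangentSpace 𝓘(ℝ, E) x)]
  [FiniteDimensional ℝ F] [CompleteSpace F]
  [RiemannianBundle (fun y : Q ↦ TangentSpace 𝓘(ℝ, F) y)]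

theorem inner_baseFrame (u v : E) : inner ℝ (baseFrame (E := E) x u) (baseFrame (E := E) x v) =
    chartMetric x (extChartAt 𝓘(ℝ, E) x x) u v :=
  chartFrame_base (p := fun _ L ↦ Inner.inner ℝ (L u) (L v) =
    chartMetric x (extChartAt 𝓘(ℝ, E) x x) u v) rfl

theorem isometric_chart (hf : IsIsometricImmersion E F f) (hz : z ∈ chartDomain E F f x) (u v : E) :
    chartMetric (f x) (chartMap E F f x z) (fderiv ℝ (chartMap E F f x) z u)
      (fderiv ℝ (chartMap E F f x) z v) = chartMetric x z u v := by
  rw [chartMetric_apply (x₀ := x), ← hf.isometric, mfderiv_chart hf.smooth hz,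
    mfderiv_chart hf.smooth hz]
  exact (chartFrame_congr (p := fun y L ↦ Inner.inner ℝ (L (fderiv ℝ (chartMap E F f x) z u))
    (L (fderiv ℝ (chartMap E F f x) z v)) = chartMetric (f x) (chartMap E F f x z)
      (fderiv ℝ (chartMap E F f x) z u) (fderiv ℝ (chartMap E F f x) z v)) rfl
    (symm_chartMap hz)).symm

variable {Γ : E → E →L[ℝ] E →L[ℝ] E} {Λ : F → F →L[ℝ] F →L[ℝ] F}

theorem isLocalIsometricImmersion_chart (hf : IsIsometricImmersion E F f)
    (hΓ : IsLocalLeviCivita (chartDomain E F f x) (chartMetric x) Γ)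
    (hΛ : IsLocalLeviCivita (extChartAt 𝓘(ℝ, F) (f x)).target (chartMetric (f x)) Λ) :
    IsLocalIsometricImmersion (chartDomain E F f x) (chartMetric x) Γ
      (extChartAt 𝓘(ℝ, F) (f x)).target (chartMetric (f x)) Λ (chartMap E F f x) where
  source := hΓ
  target := hΛ
  smooth := contDiffOn_chartMap hf.smooth
  mapsTo hz := mapsTo_chartMap hz
  isometric hz u v := isometric_chart hf hz u v

variable [IsContMDiffRiemannianBundle 𝓘(ℝ, E) ∞ E (fun x : M ↦ TangentSpace 𝓘(ℝ, E) x)]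
  [IsContMDiffRiemannianBundle 𝓘(ℝ, F) ∞ F (fun y : Q ↦ TangentSpace 𝓘(ℝ, F) y)]

theorem leviCivita_extend_base (hΛ : IsLocalLeviCivita (extChartAt 𝓘(ℝ, F) (f x)).target
    (chartMetric (f x)) Λ) (a b : F) :
    leviCivita (FiberBundle.extend F (baseFrame (E := F) (f x) b) : Π y : Q, TangentSpace 𝓘(ℝ, F) y)
      (f x) (baseFrame (E := F) (f x) a) =
      baseFrame (E := F) (f x) (Λ (extChartAt 𝓘(ℝ, F) (f x) (f x)) a b) := by
  set Y : Π y : Q, TangentSpace 𝓘(ℝ, F) y :=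
    FiberBundle.extend F (baseFrame (E := F) (f x) b) with hY
  have ht := mem_extChartAt_target (I := 𝓘(ℝ, F)) (f x)
  have hd : MDiffAt (T% Y)
      ((extChartAt 𝓘(ℝ, F) (f x)).symm (extChartAt 𝓘(ℝ, F) (f x) (f x))) := by
    rw [extChartAt_to_inv]
    exact mdiff_extend _
  have hrep : chartRep (f x) Y =ᶠ[nhds (extChartAt 𝓘(ℝ, F) (f x) (f x))] fun _ ↦ b := by
    filter_upwards [eventually_mem_target ht] with y hy
    rw [chartRep, hY, extend_eq_chartField _ (mem_baseSet_of_mem_target hy),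
      ContinuousLinearEquiv.symm_apply_apply]
    exact chartRep_chartField hy b
  refine chartFrame_base (p := fun y L ↦ leviCivita Y y (L a) =
    L (Λ (extChartAt 𝓘(ℝ, F) (f x) (f x)) a b)) ?_
  rw [leviCivita_chart hΛ ht ht hd, hrep.fderiv_eq, hrep.eq_of_nhds, fderiv_const_apply,
    zero_apply, zero_add]

theorem pullbackCov_base (hf : ContMDiff 𝓘(ℝ, E) 𝓘(ℝ, F) ∞ f)
    (hΛ : IsLocalLeviCivita (extChartAt 𝓘(ℝ, F) (f x)).target (chartMetric (f x)) Λ) (u w : E) :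
    pullbackCov leviCivita f (fun y ↦ mfderiv 𝓘(ℝ, E) 𝓘(ℝ, F) f y
      (FiberBundle.extend E (baseFrame (E := E) x w) y)) x (baseFrame (E := E) x u) =
      baseFrame (E := F) (f x)
        (localHessian Λ (chartMap E F f x) (extChartAt 𝓘(ℝ, E) x x) u w) := by
  set V : Π y : M, TangentSpace 𝓘(ℝ, F) (f y) := fun y ↦ mfderiv 𝓘(ℝ, E) 𝓘(ℝ, F) f y
      (FiberBundle.extend E (baseFrame (E := E) x w) y) with hV
  set H : M → F := fun y ↦
    (trivializationAt F (TangentSpace 𝓘(ℝ, F) : Q → Type _) (f x) ⟨f y, V y⟩).2 with hH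
  have ho := isOpen_chartDomain (x := x) hf
  -- In coordinates the field df(W), for W the extension of a vector, is the directional derivative
  -- of the coordinate map in a fixed direction. Its derivative is the second derivative, and the
  -- connection term at f x supplies the rest of the Hessian.
  have hcomp : H ∘ (extChartAt 𝓘(ℝ, E) x).symm =ᶠ[nhds (extChartAt 𝓘(ℝ, E) x x)]
      fun z ↦ fderiv ℝ (chartMap E F f x) z w := by
    filter_upwards [ho.mem_nhds mem_chartDomain] with z hz
    rw [← coord_mfderiv_chart hf hz, Trivialization.continuousLinearMapAt_apply_of_mem ℝ _
      (mem_baseSet_of_mem_chartDomain hz)]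
    simp only [hH, hV, Function.comp_apply]
    rw [extend_eq_chartField _ (mem_baseSet_of_mem_target (chartDomain_subset hz)),
      ContinuousLinearEquiv.symm_apply_apply]
    rfl
  have hD := hasFDerivAt_of_contDiffOn (contDiffOn_fderiv (contDiffOn_chartMap (x := x) hf) ho) ho
    mem_chartDomain
  have h1 : d% H x (baseFrame (E := E) x u) =
      fderiv ℝ (fderiv ℝ (chartMap E F f x)) (extChartAt 𝓘(ℝ, E) x x) u w := by
    refine chartFrame_base (p := fun y L ↦ d% H y (L u) =
      fderiv ℝ (fderiv ℝ (chartMap E F f x)) (extChartAt 𝓘(ℝ, E) x x) u w) ?_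
    have ht := mem_extChartAt_target (I := 𝓘(ℝ, E)) x
    rw [mvfderiv_chartFrame ht (mdiff_of_comp_chart_symm ht
      ((hD.apply_const w).differentiableAt.congr_of_eventuallyEq hcomp)), hcomp.fderiv_eq,
      (hD.apply_const w).fderiv]
    rfl
  have hVx : V x = baseFrame (E := F) (f x)
      (fderiv ℝ (chartMap E F f x) (extChartAt 𝓘(ℝ, E) x x) w) := by
    rw [← mfderiv_base hf]
    simp [hV]
  change (trivializationAt F (TangentSpace 𝓘(ℝ, F)) (f x)).symmL ℝ (f x)
    (d% H x (baseFrame (E := E) x u)) + leviCivita (FiberBundle.extend F (V x)) (f x)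
      (mfderiv 𝓘(ℝ, E) 𝓘(ℝ, F) f x (baseFrame (E := E) x u)) = _
  rw [h1, hVx, mfderiv_base hf, leviCivita_extend_base hΛ, ← baseFrame_apply, ← map_add,
    localHessian, chartMap_base]

/-- The second fundamental form in coordinates. -/
theorem secondFundamentalForm_base (hf : IsIsometricImmersion E F f)
    (hΓ : IsLocalLeviCivita (chartDomain E F f x) (chartMetric x) Γ)
    (hΛ : IsLocalLeviCivita (extChartAt 𝓘(ℝ, F) (f x)).target (chartMetric (f x)) Λ) (u w : E) :
    secondFundamentalForm f x (baseFrame (E := E) x u) (baseFrame (E := E) x w) =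
      baseFrame (E := F) (f x)
        (localSecondForm Γ Λ (chartMap E F f x) (extChartAt 𝓘(ℝ, E) x x) u w) := by
  have hloc := isLocalIsometricImmersion_chart hf hΓ hΛ
  rw [secondFundamentalForm, pullbackCov_base hf.smooth hΛ]
  -- The Hessian is the sum of df(Γ_u w), which is tangent, and the local second form, which is
  -- normal by `inner_secondForm`; the projection keeps the latter.
  refine Submodule.eq_starProjection_of_mem_orthogonal' (K := normalSpace E F f x)
    (z := baseFrame (E := F) (f x) (fderiv ℝ (chartMap E F f x) (extChartAt 𝓘(ℝ, E) x x)
      (Γ (extChartAt 𝓘(ℝ, E) x x) u w))) ?_ ?_ ?_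
  · refine (Submodule.mem_orthogonal' _ _).2 ?_
    rintro _ ⟨v, rfl⟩
    obtain ⟨t, rfl⟩ := (baseFrame (E := E) x).surjective v
    refine Eq.trans ?_ (hloc.inner_secondForm mem_chartDomain u w t)
    change inner ℝ _ (mfderiv 𝓘(ℝ, E) 𝓘(ℝ, F) f x (baseFrame (E := E) x t)) = _
    rw [mfderiv_base hf.smooth, inner_baseFrame, chartMap_base]
  · refine Submodule.le_orthogonal_orthogonal (tangentImage E F f x) ?_
    rw [← mfderiv_base hf.smooth]
    exact ⟨_, rfl⟩
  · rw [← map_add, localSecondForm, sub_add_cancel]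

end ChartImmersion

/-! ### From local data to the pointwise algebraic structure -/

theorem IsLocalLeviCivita.mono {E : Type*} [NormedAddCommGroup E] [NormedSpace ℝ E] {U V : Set E}
    {g : E → E →L[ℝ] E →L[ℝ] ℝ} {Γ : E → E →L[ℝ] E →L[ℝ] E} (h : IsLocalLeviCivita U g Γ)
    (hV : IsOpen V) (hVU : V ⊆ U) : IsLocalLeviCivita V g Γ where
  isOpen := hV
  smooth_g := h.smooth_g.mono hVU
  smooth_Γ := h.smooth_Γ.mono hVU
  symm hz := h.symm (hVU hz)
  pos hz _ := h.pos (hVU hz)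
  torsion hz := h.torsion (hVU hz)
  metric hz := h.metric (hVU hz)

/-- The data of a local isometric immersion of a nearly Kähler structure into a metric of constant
curvature, read in frames of the tangent spaces. -/
theorem pointwiseImmersion_of_local {E F V N : Type*} [NormedAddCommGroup E]
    [NormedSpace ℝ E] [FiniteDimensional ℝ E] [NormedAddCommGroup F] [NormedSpace ℝ F]
    [FiniteDimensional ℝ F] [NormedAddCommGroup V] [InnerProductSpace ℝ V] [NormedAddCommGroup N]
    [InnerProductSpace ℝ N] {U : Set E} {U' : Set F} {g : E → E →L[ℝ] E →L[ℝ] ℝ}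
    {Γ : E → E →L[ℝ] E →L[ℝ] E} {k : F → F →L[ℝ] F →L[ℝ] ℝ} {Λ : F → F →L[ℝ] F →L[ℝ] F}
    {f : E → F} {J : E → E →L[ℝ] E} {c : ℝ} {z : E} (hloc : IsLocalIsometricImmersion U g Γ U' k Λ f)
    (hNK : IsLocalNearlyKahler U g Γ J) (hz : z ∈ U)
    (hc : ∀ u v, k (f z) (curvatureEnd Λ (f z) u v v) u =
      c * (k (f z) u u * k (f z) v v - k (f z) u v ^ 2))
    (b : E ≃ₗ[ℝ] V) (b' : F →ₗ[ℝ] N) {JV : V →ₗ[ℝ] V} {T : V →ₗ[ℝ] V →ₗ[ℝ] V}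
    {α : V →ₗ[ℝ] V →ₗ[ℝ] N} (hg : ∀ u v, inner ℝ (b u) (b v) = g z u v)
    (hk : ∀ u v, inner ℝ (b' u) (b' v) = k (f z) u v) (hJ : ∀ u, JV (b u) = b (J z u))
    (hT : ∀ u v, T (b u) (b v) = b (localTorsion Γ J z u v))
    (hα : ∀ u v, α (b u) (b v) = b' (localSecondForm Γ Λ f z u v)) :
    PointwiseImmersion JV T α c
      fun u v w ↦ b (curvatureEnd Γ z (b.symm u) (b.symm v) (b.symm w)) := by
  -- Identifies the combination occurring in `R_J` and `R_T` with the curvature of the canonical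
  -- connection.
  have hR (u v w : E) :
      b (curvatureEnd Γ z u v w) - (1 / 4 : ℝ) • (b (localTorsion Γ J z u (localTorsion Γ J z v w))
        - b (localTorsion Γ J z v (localTorsion Γ J z u w)))
        + (1 / 2 : ℝ) • b (localTorsion Γ J z (localTorsion Γ J z u v) w) =
          b (curvatureEnd (localCanonical Γ J) z u v w) := by
    rw [hNK.canonical_curvature_eq hz, map_add, map_sub, map_smul, map_smul, map_sub]
  constructor
  · refine b.surjective.forall.2 fun u ↦ ?_
    rw [hJ, hJ, hNK.sq hz, map_neg]
  · refine b.surjective.forall₂.2 fun u v ↦ ?_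
    rw [hJ, hJ, hg, hg, hNK.inner_map hz]
  · refine b.surjective.forall₂.2 fun u v ↦ ?_
    rw [hT, hT, hNK.T_swap hz, map_neg]
  · refine b.surjective.forall₃.2 fun u v w ↦ ?_
    rw [hT, hT, hg, hg, hNK.T_skew hz]
  · refine b.surjective.forall₂.2 fun u v ↦ ?_
    rw [hJ, hT, hT, hJ, hNK.T_J hz, map_neg]
  · refine b.surjective.forall₂.2 fun u v ↦ ?_
    rw [hα, hα, hloc.secondForm_symm hz]
  · refine b.surjective.forall₃.2 fun u v w ↦ b.surjective.forall.2 fun t ↦ ?_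
    simp only [b.symm_apply_apply, hα, hg, hk, hloc.gauss hz u v w t]
    rw [hloc.target.curvature_eq_of_constant (hloc.mapsTo hz) hc]
    simp only [hloc.isometric hz]
  · refine b.surjective.forall₃.2 fun u v w ↦ ?_
    simp only [hJ, hT, b.symm_apply_apply]
    rw [hR, hR, hNK.canonical_curvature_J hz, hJ]
  · refine b.surjective.forall₃.2 fun u v w ↦ b.surjective.forall.2 fun t ↦ ?_
    simp only [hT, b.symm_apply_apply]
    rw [hR, hR, hR, hNK.canonical_curvature_T hz, hT, hT, map_add]

/-! ### Application to the manifold and vanishing of the tensor C -/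

section Main

variable {E : Type*} [NormedAddCommGroup E] [NormedSpace ℝ E] [FiniteDimensional ℝ E]
  [CompleteSpace E] {M : Type*} [TopologicalSpace M] [ChartedSpace E M]
  [RiemannianBundle (fun x : M ↦ TangentSpace 𝓘(ℝ, E) x)] [IsManifold 𝓘(ℝ, E) ∞ M]
  [IsContMDiffRiemannianBundle 𝓘(ℝ, E) ∞ E (fun x : M ↦ TangentSpace 𝓘(ℝ, E) x)]
  {F : Type*} [NormedAddCommGroup F] [NormedSpace ℝ F] [FiniteDimensional ℝ F]
  [CompleteSpace F] {Q : Type*} [TopologicalSpace Q] [ChartedSpace F Q]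
  [RiemannianBundle (fun y : Q ↦ TangentSpace 𝓘(ℝ, F) y)] [IsManifold 𝓘(ℝ, F) ∞ Q]
  [IsContMDiffRiemannianBundle 𝓘(ℝ, F) ∞ F (fun y : Q ↦ TangentSpace 𝓘(ℝ, F) y)]
  {J : Π x : M, TangentSpace 𝓘(ℝ, E) x →L[ℝ] TangentSpace 𝓘(ℝ, E) x} {f : M → Q} {x : M}

theorem exists_isLocalLeviCivita_chartDomain (hf : IsIsometricImmersion E F f) (x : M) :
    ∃ Γ, IsLocalLeviCivita (chartDomain E F f x) (chartMetric x) Γ :=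
  let ⟨Γ, hΓ⟩ := exists_isLocalLeviCivita_chartMetric x
  ⟨Γ, hΓ.mono (isOpen_chartDomain hf.smooth) chartDomain_subset⟩

/-- Needed for bilinearity: linearity in the first argument is immediate from the definition, and
symmetry transfers it to the second. -/
theorem secondFundamentalForm_symm (hf : IsIsometricImmersion E F f)
    (u v : TangentSpace 𝓘(ℝ, E) x) :
    secondFundamentalForm (F := F) f x u v = secondFundamentalForm (F := F) f x v u := by
  obtain ⟨Γ, hΓ⟩ := exists_isLocalLeviCivita_chartDomain hf x
  obtain ⟨Λ, hΛ⟩ := exists_isLocalLeviCivita_chartMetric (E := F) (f x)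
  obtain ⟨u, rfl⟩ := (baseFrame (E := E) x).surjective u
  obtain ⟨v, rfl⟩ := (baseFrame (E := E) x).surjective v
  rw [secondFundamentalForm_base hf hΓ hΛ, secondFundamentalForm_base hf hΓ hΛ,
    (isLocalIsometricImmersion_chart hf hΓ hΛ).secondForm_symm mem_chartDomain]

/-- The second fundamental form as a bilinear map. -/
def secondFundamentalBilin (hf : IsIsometricImmersion E F f) (x : M) :
    TangentSpace 𝓘(ℝ, E) x →ₗ[ℝ] TangentSpace 𝓘(ℝ, E) x →ₗ[ℝ] TangentSpace 𝓘(ℝ, F) (f x) :=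
  LinearMap.mk₂ ℝ (secondFundamentalForm f x) (secondFundamentalForm_add_left f x)
    (secondFundamentalForm_smul_left f x)
    (fun u v w ↦ by
      simp only [secondFundamentalForm_symm hf u, secondFundamentalForm_add_left])
    fun a u v ↦ by simp only [secondFundamentalForm_symm hf u, secondFundamentalForm_smul_left]

theorem secondFundamentalBilin_apply (hf : IsIsometricImmersion E F f)
    (u v : TangentSpace 𝓘(ℝ, E) x) :
    secondFundamentalBilin hf x u v = secondFundamentalForm f x u v := rfl

/-- The torsion of the canonical connection as a bilinear map. -/
def torsionBilin (hJ : IsAlmostHermitian J) (x : M) :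
    TangentSpace 𝓘(ℝ, E) x →ₗ[ℝ] TangentSpace 𝓘(ℝ, E) x →ₗ[ℝ] TangentSpace 𝓘(ℝ, E) x :=
  LinearMap.mk₂ ℝ (fun u v ↦ hermitianTorsion hJ x u v) (fun u v w ↦ by rw [map_add]; rfl)
    (fun a u v ↦ by rw [map_smul]; rfl) (fun u v w ↦ map_add _ _ _) fun a u v ↦ map_smul _ _ _

/-- The data at `x` of an isometric immersion of a nearly Kähler manifold into a space of constant
curvature. -/
theorem exists_pointwiseImmersion {c : ℝ} (hQ : HasConstantSectionalCurvature F Q c)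
    {hJ : IsAlmostHermitian J} (hM : IsNearlyKahler hJ) (hf : IsIsometricImmersion E F f) (x : M) :
    ∃ R, PointwiseImmersion (J x).toLinearMap (torsionBilin hJ x) (secondFundamentalBilin hf x)
      c R := by
  obtain ⟨Γ, hΓ⟩ := exists_isLocalLeviCivita_chartDomain hf x
  obtain ⟨Λ, hΛ⟩ := exists_isLocalLeviCivita_chartMetric (E := F) (f x)
  have hloc := isLocalIsometricImmersion_chart hf hΓ hΛ
  have hNK := isLocalNearlyKahler_chart hM hΓ chartDomain_subset
  refine ⟨_, pointwiseImmersion_of_local (V := TangentSpace 𝓘(ℝ, E) x)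
    (N := TangentSpace 𝓘(ℝ, F) (f x)) hloc hNK (mem_chartDomain (x := x))
    (curvature_chart_of_constant hQ hΛ subset_rfl (mapsTo_chartMap mem_chartDomain))
    (baseFrame (E := E) x).toLinearEquiv (baseFrame (E := F) (f x)).toLinearMap
    inner_baseFrame (fun u v ↦ ?_) (fun u ↦ ?_) (fun u v ↦ ?_)
    fun u v ↦ ?_⟩
  · rw [chartMap_base]
    exact inner_baseFrame u v
  · exact chartFrame_base (p := fun y L ↦ J y (L u) = L (chartEnd J x (extChartAt 𝓘(ℝ, E) x x) u))
      (chartFrame_chartEnd (mem_extChartAt_target x) u).symm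
  · exact chartFrame_base (p := fun y L ↦ hermitianTorsion hJ y (L u) (L v) =
      L (localTorsion Γ (chartEnd J x) (extChartAt 𝓘(ℝ, E) x x) u v))
      (hermitianTorsion_chart hM hΓ chartDomain_subset mem_chartDomain u v)
  · rw [secondFundamentalBilin_apply]
    exact secondFundamentalForm_base hf hΓ hΛ u v

/-- The invariant umbilic distribution is stable under its own torsion operators. -/
theorem hermitianTorsion_mem_invariantDistribution {c : ℝ}
    (hQ : HasConstantSectionalCurvature F Q c) {hJ : IsAlmostHermitian J} (hM : IsNearlyKahler hJ)
    (hf : IsIsometricImmersion E F f) {η : Π x : M, TangentSpace 𝓘(ℝ, F) (f x)}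
    {X : TangentSpace 𝓘(ℝ, E) x} (hX : X ∈ invariantDistribution f hJ η x)
    (Z : TangentSpace 𝓘(ℝ, E) x) :
    hermitianTorsion hJ x X Z ∈ invariantDistribution f hJ η x := by
  obtain ⟨R, hR⟩ := exists_pointwiseImmersion hQ hM hf x
  obtain ⟨h1, h2, h3⟩ := hR.T_mem hX.1.1 hX.1.2 hX.2 Z
  exact ⟨⟨h1, h2⟩, h3⟩

theorem tensorC_eq_zero {c : ℝ} (hQ : HasConstantSectionalCurvature F Q c)
    {hJ : IsAlmostHermitian J} (hM : IsNearlyKahler hJ) (hf : IsIsometricImmersion E F f)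
    {η : Π x : M, TangentSpace 𝓘(ℝ, F) (f x)} {X : TangentSpace 𝓘(ℝ, E) x}
    (hX : X ∈ invariantDistribution f hJ η x) : tensorC f hJ η x X = 0 := by
  ext Z : 1
  change (Submodule.orthogonal (invariantDistribution f hJ η x)).orthogonalProjectionOnto
    (hermitianTorsion hJ x X Z) = 0
  exact Submodule.orthogonalProjectionOnto_orthogonal_apply_eq_zero
    (hermitianTorsion_mem_invariantDistribution hQ hM hf hX Z)

end Main

end NearlyKahler

end

theorem lemma3p2 {n p : ℕ}
    {M : Type*} [TopologicalSpace M] [ChartedSpace (EuclideanSpace ℝ (Fin (2 * n))) M]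
    [IsManifold (𝓡 (2 * n)) ∞ M]
    [RiemannianBundle (fun x : M ↦ TangentSpace (𝓡 (2 * n)) x)]
    [IsContMDiffRiemannianBundle (𝓡 (2 * n)) ∞
      (EuclideanSpace ℝ (Fin (2 * n)))
      (fun x : M ↦ TangentSpace (𝓡 (2 * n)) x)]
    {Q : Type*} [TopologicalSpace Q] [ChartedSpace (EuclideanSpace ℝ (Fin (2 * n + p))) Q]
    [IsManifold (𝓡 (2 * n + p)) ∞ Q]
    [RiemannianBundle (fun y : Q ↦ TangentSpace (𝓡 (2 * n + p)) y)]
    [IsContMDiffRiemannianBundle (𝓡 (2 * n + p)) ∞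
      (EuclideanSpace ℝ (Fin (2 * n + p)))
      (fun y : Q ↦ TangentSpace (𝓡 (2 * n + p)) y)]
    (c : ℝ)
    (hQ : NearlyKahler.HasConstantSectionalCurvature (EuclideanSpace ℝ (Fin (2 * n + p))) Q c)
    (J : Π x : M, TangentSpace (𝓡 (2 * n)) x →L[ℝ]
      TangentSpace (𝓡 (2 * n)) x)
    (hJ : NearlyKahler.IsAlmostHermitian J) (hM : NearlyKahler.IsNearlyKahler hJ)
    (f : M → Q)
    (hf : NearlyKahler.IsIsometricImmersion (EuclideanSpace ℝ (Fin (2 * n)))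
      (EuclideanSpace ℝ (Fin (2 * n + p))) f)
    (η : Π x : M, TangentSpace (𝓡 (2 * n + p)) (f x))
    (hη : NearlyKahler.IsSmoothNormalField (EuclideanSpace ℝ (Fin (2 * n)))
      (EuclideanSpace ℝ (Fin (2 * n + p))) f η)
    (x : M) (X : TangentSpace (𝓡 (2 * n)) x)
    (hX : X ∈ NearlyKahler.invariantDistribution f hJ η x) :
    NearlyKahler.tensorC f hJ η x X = 0 ∧
      ∀ Z ∈ Submodule.orthogonal (NearlyKahler.invariantDistribution f hJ η x),
        NearlyKahler.hermitianTorsion hJ x X Z ∈ NearlyKahler.invariantDistribution f hJ η x :=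

  ⟨NearlyKahler.tensorC_eq_zero hQ hM hf hX, fun Z _ ↦
    NearlyKahler.hermitianTorsion_mem_invariantDistribution hQ hM hf hX Z⟩
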